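/- **Setting.** Vectors carry the Euclidean norm and matrices the induced 2-norm; $\|x\|_{\infty}=\sup_{t\ge0}\|x(t)\|$, $\|x\|_{[0,\tau]}=\sup_{0\le t\le\tau}\|x(t)\|$; $\langle X\rangle=X+X^\top$; $M^\dagger$ is the pseudo-inverse. Let $\Theta,\Theta_d\subset\mathbb R^s$ be compact boxes with $\|v\|\le b_{\dot\theta}$ on $\Theta_d$; a parameter trajectory $\theta$ is admissible if $\theta(t)\in\Theta$ and $\dot\theta(t)\in\Theta_d$ for all $t\ge0$. All parameter-dependent matrices are continuous on $\Theta$. Consider the plant $$\dot x=A(\theta)x+B(\theta)\,\omega\,(K_x(\theta)x+u)+f(t,x),\qquad y=C(\theta)x,\qquad x(0)=x_0,\ \|x_0\|\le\rho_0,$$ with $x\in\mathbb R^n$, $u\in\mathbb R^m$, $y\in\mathbb R^p$, $\rho_0>0$, and put $A_m=A+BK_x$. Let $r$ be a bounded piecewise continuous reference signal. The ideal system is $\dot x_{id}=A_m(\theta)x_{id}+B(\theta)u_{id}$, $x_{id}(0)=x_0$, $u_{id}=K_r(\theta)r$, $y_{id}=C(\theta)x_{id}$. **Assumptions.** (a)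 There are $P(\theta)=P(\theta)^\top>0$ and $\mu_P>0$ with $\langle A_m^\top P\rangle+\dot P\le-\mu_PP$ on $\Theta\times\Theta_d$. (b) $\omega$ is strictly row-diagonally dominant and lies in a convex polytope $\Omega\ni I$. (c) $B(\theta)$ has full column rank on $\Theta$, and $B$, $B^\dagger$, $K_x$ are Lipschitz on $\Theta$ with constants $L_B,L_{B^\dagger},L_{K_x}>0$; $B_u(\theta)\in\mathbb R^{n\times(n-m)}$ satisfies $B^\top B_u=0$ and $\bar B=[B,B_u]$ is invertible on $\Theta$. (d) For $t,t_1,t_2\ge0$: $\|f(t,0)\|\le b_f^0$; for every $\delta>0$ there is $L_f^\delta>0$ with $\|f(t,x_1)-f(t,x_2)\|\le L_f^\delta\|x_1-x_2\|$ for $\|x_1\|,\|x_2\|\le\delta$; $\|f(t_1,x)-f(t_2,x)\|\le l_f|t_1-t_2|$ for all $x$, with $l_f>0$. **Controller.** Let $K\in\mathbb R^{m\times m}$ be such that for every $w\in\Omega$ the filter $wK(sI+wK)^{-1}$ is stable with DC gain $I$; $\mathcal C$ is the mapping of this filter for $w=\omega$. Let $\bar{\mathcal H}(\theta)$ be the mapping,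 with zero initial state, of an LPV state-space system with $n-m$ inputs and $m$ outputs. With $a>0$ and sampling time $T>0$, the adaptive controller is $$\dot{\hat x}=A_m(\theta)x+B(\theta)u+\hat\sigma-a(\hat x-x),\quad \hat x(0)=\hat x_0,\qquad \hat\sigma(t)=-\tfrac{a}{e^{aT}-1}\,(\hat x-x)(iT)\ \ \text{for } t\in[iT,(i+1)T),\ i=0,1,\dots,$$ $$\begin{bmatrix}\hat\sigma_m\\ \hat\sigma_{um}\end{bmatrix}=\bar B(\theta)^{-1}\hat\sigma_c,\quad \hat\sigma_c=0\text{ on }[0,T),\ \ \hat\sigma_c=\hat\sigma\text{ on }[T,\infty),\qquad \dot u=-K\big(u+\hat\sigma_m+\bar{\mathcal H}(\theta)\hat\sigma_{um}-K_r(\theta)r\big),\quad u(0)=0.$$ **Mappings and gains.** All mappings have zero initial state. $\mathcal H_{xm}$, $\mathcal H_m$ map $u$ to $x$, resp. to $C(\theta)x$, for $\dot x=A_m(\theta)x+B(\theta)u$; $\mathcal H_{xum}$ maps $u$ to $x$ for $\dot x=A_m(\theta)x+B_u(\theta)u$; $\mathcal G_{xm}=\mathcal H_{xm}(I-\mathcal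 C)$, $\mathcal G_{xum}=\mathcal H_{xum}-\mathcal H_{xm}\mathcal C\bar{\mathcal H}$, $\mathcal G_m=C(\theta)\mathcal G_{xm}$, $\mathcal G_{um}=C(\theta)\mathcal G_{xum}$, $\mathcal F=\mathcal C(B^\dagger+\bar{\mathcal H}B_u^\dagger)$. For a mapping $\mathcal G$, $\|\mathcal G\|_{\mathcal L_1}$ is the supremum of $\|\mathcal G u\|_\infty$ over $\|u\|_\infty\le1$ and admissible $\theta$, and $\|\mathcal G\|_{\bar{\mathcal L}_1}$ denotes an arbitrary peak-to-peak gain (PPG) bound: a number $\gamma>0$ with $\|\mathcal Gu\|_{[0,\tau]}\le\gamma\|u\|_{[0,\tau]}$ for all $\tau\ge0$, all inputs $u$ and all admissible $\theta$. One such bound is fixed for each mapping that appears below. (e) $\mathcal F$ has a realization $\dot x_F=A_Fx_F+B_F\sigma$, $y_F=C_Fx_F$, with matrices continuous in $\theta\in\Theta$, and there are $P_F(\theta)=P_F(\theta)^\top>0$ and $\mu_F>0$ with $\langle A_F^\top P_F\rangle+\dot P_F\le-\mu_FP_F$ on $\Theta\times\Theta_d$. **Constants.** $b_M=\max_{\Theta}\|M\|$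 for $M=A_m,B,B^\dagger,B_u^\dagger,\bar B^{-1},C,K_x,K_r$; $d_\Omega=\max_{w\in\Omega}\|w-I\|$; $$b_{f_1}^0=b_{B^\dagger}b_f^0,\quad b_{f_2}^0=b_{B_u^\dagger}b_f^0,\quad L_{f_1}^\delta=L_f^\delta b_{B^\dagger}+\max_{w\in\Omega,\theta\in\Theta}\|(w-I)K_x(\theta)\|,\quad L_{f_2}^\delta=L_f^\delta b_{B_u^\dagger},$$ $$L_{\bar f}^\delta=L_f^\delta+\max_\Theta\|BK_x\|\,d_\Omega,\qquad l_{\bar f}^\delta=l_f+d_\Omega(L_Bb_{K_x}+b_BL_{K_x})\,\delta\,b_{\dot\theta}.$$ For $\lambda_1=\min_\Theta\lambda_{\min}(Q)$, $\lambda_2=\max_\Theta\lambda_{\max}(Q)$ let $\tilde\lambda(Q)=\sqrt{\lambda_2/\lambda_1}$ and $\beta(t,\mu,Q,M)=\sqrt{\tilde\lambda(Q)(1-e^{-\mu t})}\,\frac{2}{\mu\lambda_1}\max_\Theta\|QM\|$, $0\le t\le\infty$. Put $\rho_{in}=\rho_0\tilde\lambda(P)$. For positive numbers $\rho_r,\gamma_1,\bar\gamma_0$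 let $\rho=\rho_r+\gamma_1$, $\rho_u=\rho_{ur}+\gamma_2$, $$\rho_{ur}=\|\omega^{-1}\mathcal C\|_{\mathcal L_1}\big(b_{K_r}\|r\|_\infty+L_{f_1}^{\rho_r}\rho_r+b_{f_1}^0+\|\bar{\mathcal H}\|_{\bar{\mathcal L}_1}(L_{f_2}^{\rho_r}\rho_r+b_{f_2}^0)\big),$$ $$\gamma_2=\big(\|\omega^{-1}\mathcal C\|_{\mathcal L_1}L_{f_1}^\rho+\|\omega^{-1}\mathcal C\bar{\mathcal H}\|_{\bar{\mathcal L}_1}L_{f_2}^\rho\big)\gamma_1+\|\omega^{-1}\|\bar\gamma_0,$$ $$b_\sigma=b_Bd_\Omega(\rho_u+b_{K_x}\rho)+L_f^\rho\rho+b_f^0,\qquad b_{\dot x}=b_{A_m}\rho+b_B\rho_u\max_{w\in\Omega}\|w\|+L_f^\rho\rho+b_f^0+b_Bd_\Omega b_{K_x}\rho,$$ $$b_{\dot u}=\|K\|\big[\rho_u+(1+\|\bar{\mathcal H}\|_{\bar{\mathcal L}_1})\,b_{\bar B^{-1}}\,e^{-aT}\sqrt n\,b_\sigma+b_{K_r}\|r\|_\infty\big],$$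 $$b_{\tilde\sigma}=2\sqrt n\,T\big[\|\omega-I\|(b_Bb_{\dot u}+L_Bb_{\dot\theta}\rho_u)+l_{\bar f}^\rho+L_{\bar f}^\rho b_{\dot x}\big]+(1-e^{-aT})\sqrt n\,b_\sigma,$$ $$\gamma_0=\max_\Theta\|C_F\|\big(\tilde\lambda(P_F)\,\beta(T,\mu_F,P_F,B_F)\,b_\sigma+\beta(\infty,\mu_F,P_F,B_F)\,b_{\tilde\sigma}\big).$$ **Theorem.** Suppose (a)–(e) hold and $\rho_r,\gamma_1,\bar\gamma_0>0$ satisfy $$\|\mathcal G_{xm}\|_{\bar{\mathcal L}_1}(L_{f_1}^\rho\rho_r+b_{f_1}^0)+\|\mathcal G_{xum}\|_{\bar{\mathcal L}_1}(L_{f_2}^\rho\rho_r+b_{f_2}^0)<\rho_r-\|\mathcal H_{xm}\mathcal CK_r\|_{\bar{\mathcal L}_1}\|r\|_\infty-\rho_{in},$$ $$\frac{\|\mathcal H_{xm}\|_{\bar{\mathcal L}_1}}{1-\|\mathcal G_{xm}\|_{\bar{\mathcal L}_1}L_{f_1}^\rho-\|\mathcal G_{xum}\|_{\bar{\mathcal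 L}_1}L_{f_2}^\rho}\,\bar\gamma_0<\gamma_1,\qquad \gamma_0<\bar\gamma_0.$$ Then for every admissible $\theta$ the trajectories of the adaptive closed loop and of the ideal system satisfy $$\|x-x_{id}\|_\infty\le\alpha_1+\gamma_1,\qquad \|u-u_{id}\|_\infty\le\alpha_2+\gamma_2,\qquad \|y-y_{id}\|_\infty\le\alpha_3+b_C\gamma_1,$$ where $$\alpha_1=\|\mathcal G_{xm}\|_{\bar{\mathcal L}_1}(L_{f_1}^{\rho_r}\rho_r+b_{f_1}^0)+\|\mathcal G_{xum}\|_{\bar{\mathcal L}_1}(L_{f_2}^{\rho_r}\rho_r+b_{f_2}^0)+\|\mathcal H_{xm}(\mathcal C-I)K_r\|_{\bar{\mathcal L}_1}\|r\|_\infty,$$ $$\alpha_2=\|\omega^{-1}\mathcal C\|_{\mathcal L_1}(L_{f_1}^{\rho_r}\rho_r+b_{f_1}^0)+\|\omega^{-1}\mathcal C\bar{\mathcal H}\|_{\bar{\mathcal L}_1}(L_{f_2}^{\rho_r}\rho_r+b_{f_2}^0)+\|(\omega^{-1}\mathcal C-I)K_r\|_{\bar{\mathcal L}_1}\|r\|_\infty,$$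 $$\alpha_3=\|\mathcal G_m\|_{\bar{\mathcal L}_1}(L_{f_1}^{\rho_r}\rho_r+b_{f_1}^0)+\|\mathcal G_{um}\|_{\bar{\mathcal L}_1}(L_{f_2}^{\rho_r}\rho_r+b_{f_2}^0)+\|\mathcal H_m(\mathcal C-I)K_r\|_{\bar{\mathcal L}_1}\|r\|_\infty.$$ In particular the $\alpha_i$ do not depend on $T$. -/

import Mathlib

namespace LPV

open Set MeasureTheory
open scoped ENNReal Matrix Matrix.Norms.L2Operator

/-! ### Vectors, matrices, signals

Vectors carry the Euclidean norm; matrices carry the induced 2-norm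
(the scope `Matrix.Norms.L2Operator` is open). -/

/-- Real column vectors with the Euclidean norm. -/
abbrev Vec (n : ℕ) := EuclideanSpace ℝ (Fin n)

/-- Real `a × b` matrices. -/
abbrev Mat (a b : ℕ) := Matrix (Fin a) (Fin b) ℝ

/-- Matrix-vector product on Euclidean spaces. -/
noncomputable def act {ι κ : Type} [Fintype ι] [Fintype κ] [DecidableEq κ]
    (M : Matrix ι κ ℝ) (v : EuclideanSpace ℝ κ) : EuclideanSpace ℝ ι :=
  Matrix.toEuclideanLin M v

infixr:73 " *ₑ " => act

/-- The pseudo-inverse `(MᵀM)⁻¹Mᵀ` of a matrix of full column rank. For an invertible matrix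
(the column type may differ from the row type) it is the inverse. -/
noncomputable def pinv {ι κ : Type} [Fintype ι] [Fintype κ] [DecidableEq κ]
    (M : Matrix ι κ ℝ) : Matrix κ ι ℝ :=
  (Mᵀ * M)⁻¹ * Mᵀ

/-- `max_{a ∈ S} ‖F a‖` (all uses are for continuous `F` and compact nonempty `S`). -/
noncomputable def maxNorm {α β : Type} [Norm β] (S : Set α) (F : α → β) : ℝ :=
  sSup ((fun a => ‖F a‖) '' S)

/-- The `L_∞` norm `sup_{t ≥ 0} ‖x(t)‖`, with value in `[0, ∞]`. -/
noncomputable def linfNorm {n : ℕ} (x : ℝ → Vec n) : ℝ≥0∞ :=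
  ⨆ t ∈ Ici (0 : ℝ), ‖x t‖ₑ

/-- The truncated `L_∞` norm `sup_{0 ≤ t ≤ τ} ‖x(t)‖`. -/
noncomputable def linfTrunc {n : ℕ} (τ : ℝ) (x : ℝ → Vec n) : ℝ≥0∞ :=
  ⨆ t ∈ Icc (0 : ℝ) τ, ‖x t‖ₑ

/-- Input signals: measurable and bounded on bounded intervals. Only times `t ≥ 0` matter. -/
def IsSignal {n : ℕ} (u : ℝ → Vec n) : Prop :=
  Measurable u ∧ ∀ τ : ℝ, linfTrunc τ u < ⊤

/-- `x` is the (absolutely continuous) solution of `ẋ = v`, `x(0) = x₀` on `[0, ∞)`; in the uses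
below `v` is the right-hand side of a differential equation evaluated along `x`. -/
def IsSolution {n : ℕ} (x : ℝ → Vec n) (x₀ : Vec n) (v : ℝ → Vec n) : Prop :=
  ∀ t : ℝ, 0 ≤ t → IntervalIntegrable v volume 0 t ∧ x t = x₀ + ∫ τ in (0 : ℝ)..t, v τ

/-! ### Scheduling parameters -/

/-- The bounds of the box `Θ` of parameters and of the box `Θ_d` of parameter rates. -/
structure ParamBox (s : ℕ) where
  lo : Vec s
  hi : Vec s
  rateLo : Vec s
  rateHi : Vec s

def ParamBox.Θ {s : ℕ} (S : ParamBox s) : Set (Vec s) :=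
  {v | ∀ i, S.lo i ≤ v i ∧ v i ≤ S.hi i}

def ParamBox.Θd {s : ℕ} (S : ParamBox s) : Set (Vec s) :=
  {v | ∀ i, S.rateLo i ≤ v i ∧ v i ≤ S.rateHi i}

/-- Parameter trajectories: `θ(t) ∈ Θ` and `θ̇(t) ∈ Θ_d` for all `t ≥ 0`. -/
def ParamBox.Admissible {s : ℕ} (S : ParamBox s) (θ : ℝ → Vec s) : Prop :=
  ∀ t : ℝ, 0 ≤ t → θ t ∈ S.Θ ∧ ∃ v ∈ S.Θd, HasDerivWithinAt θ v (Ici 0) t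

/-! ### Input-output mappings -/

/-- A `θ`-dependent input-output mapping, as the relation between a parameter trajectory, an input
signal and an output signal on `[0, ∞)`. -/
abbrev IOMap (s a b : ℕ) := (ℝ → Vec s) → (ℝ → Vec a) → (ℝ → Vec b) → Prop

namespace IOMap

variable {s a b c : ℕ}

/-- The mapping of the system `ẋ = A(θ)x + B(θ)u`, `y = C(θ)x + D(θ)u`, `x(0) = 0`. -/
def stateSpace {k : ℕ} (A : Vec s → Mat k k) (B : Vec s → Mat k a) (C : Vec s → Mat b k)
    (D : Vec s → Mat b a) : IOMap s a b := fun θ u y =>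
  ∃ x : ℝ → Vec k,
    IsSolution x 0 (fun t => A (θ t) *ₑ x t + B (θ t) *ₑ u t) ∧
    ∀ t : ℝ, 0 ≤ t → y t = C (θ t) *ₑ x t + D (θ t) *ₑ u t

/-- Multiplication by the matrix `M(θ(t))`. -/
def gain (M : Vec s → Mat b a) : IOMap s a b := fun θ u y =>
  ∀ t : ℝ, 0 ≤ t → y t = M (θ t) *ₑ u t

/-- The identity mapping. -/
def ident : IOMap s a a := gain fun _ => 1

/-- `G ∘ H`: first `H`, then `G`. -/
def comp (G : IOMap s b c) (H : IOMap s a b) : IOMap s a c := fun θ u y =>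
  ∃ w, H θ u w ∧ G θ w y

def add (G H : IOMap s a b) : IOMap s a b := fun θ u y =>
  ∃ y₁ y₂, G θ u y₁ ∧ H θ u y₂ ∧ ∀ t : ℝ, 0 ≤ t → y t = y₁ t + y₂ t

def sub (G H : IOMap s a b) : IOMap s a b := fun θ u y =>
  ∃ y₁ y₂, G θ u y₁ ∧ H θ u y₂ ∧ ∀ t : ℝ, 0 ≤ t → y t = y₁ t - y₂ t

/-- The peak-to-peak gain: the supremum of `‖y‖_∞` over zero initial state, inputs with
`‖u‖_∞ ≤ 1` and admissible `θ`. For a mapping that does not depend on `θ` it is the `L₁` norm. -/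
noncomputable def ppg (S : ParamBox s) (G : IOMap s a b) : ℝ≥0∞ :=
  ⨆ (θ : ℝ → Vec s) (_ : S.Admissible θ) (u : ℝ → Vec a) (_ : IsSignal u ∧ linfNorm u ≤ 1)
    (y : ℝ → Vec b) (_ : G θ u y), linfNorm y

/-- `γ` is a bound on the peak-to-peak gain of `G`. -/
def IsPPGBound (S : ParamBox s) (G : IOMap s a b) (γ : ℝ) : Prop :=
  0 < γ ∧ ∀ θ, S.Admissible θ → ∀ u, IsSignal u → ∀ y, G θ u y →
    ∀ τ : ℝ, 0 ≤ τ → linfTrunc τ y ≤ ENNReal.ofReal γ * linfTrunc τ u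

end IOMap

/-! ### Parameter-dependent Lyapunov functions -/

/-- `⟨X⟩ = X + Xᵀ`. -/
def symm {k : ℕ} (X : Mat k k) : Mat k k := X + Xᵀ

/-- `P(θ)` is symmetric positive definite on `Θ`, differentiable on `Θ`, `μ > 0`, and
`⟨Aᵀ(θ)P(θ)⟩ + Ṗ(θ) ≤ -μ P(θ)` for all `(θ, θ̇) ∈ Θ × Θ_d`, where `Ṗ(θ)` is the derivative of `P`
at `θ` in the direction `θ̇`. -/
def IsLyapunov {s k : ℕ} (S : ParamBox s) (A P : Vec s → Mat k k) (μ : ℝ) : Prop :=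
  0 < μ ∧ (∀ θ ∈ S.Θ, (P θ).PosDef) ∧
  ∃ dP : Vec s → Vec s →L[ℝ] Mat k k,
    ∀ θ ∈ S.Θ, HasFDerivWithinAt P (dP θ) S.Θ θ ∧
      ∀ v ∈ S.Θd, (-(μ • P θ) - (symm ((A θ)ᵀ * P θ) + dP θ v)).PosSemidef

/-- `max_{θ ∈ Θ} λ_max(P(θ))`. -/
noncomputable def lamMax {s k : ℕ} (Θ : Set (Vec s)) (P : Vec s → Mat k k) : ℝ :=
  sSup {l : ℝ | ∃ θ ∈ Θ, l ∈ spectrum ℝ (P θ)}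

/-- `min_{θ ∈ Θ} λ_min(P(θ))`. -/
noncomputable def lamMin {s k : ℕ} (Θ : Set (Vec s)) (P : Vec s → Mat k k) : ℝ :=
  sInf {l : ℝ | ∃ θ ∈ Θ, l ∈ spectrum ℝ (P θ)}

/-- `β_Θ(t, μ, P, B)` as a function of `e = exp(-μ t)`; thus `e = 0` is the case `t = ∞`. -/
noncomputable def beta {s k a : ℕ} (Θ : Set (Vec s)) (e μ : ℝ) (P : Vec s → Mat k k)
    (B : Vec s → Mat k a) : ℝ :=
  √(√(lamMax Θ P / lamMin Θ P) * (1 - e)) * (2 / (μ * lamMin Θ P)) *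
    maxNorm Θ (fun θ => P θ * B θ)

/-! ### The uncertain plant and the controller -/

/-- The data of the uncertain LPV plant, of the controller and of the known bounds. Dimensions:
state `n`, input `m`, output `p`, unmatched directions `q` (`= n - m`), parameter `s`,
feedforward state `h`. -/
structure System (n m p q s h : ℕ) where
  /-- the parameter boxes `Θ`, `Θ_d` -/
  S : ParamBox s
  /-- the bound `b_θ̇` on the parameter rate -/
  bθ : ℝ
  A : Vec s → Mat n n
  B : Vec s → Mat n m
  C : Vec s → Mat p n
  /-- baseline feedback gain -/
  Kx : Vec s → Mat m n
  /-- feedforward gain for the reference signal -/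
  Kr : Vec s → Mat m p
  /-- unmatched input matrix `B_u` -/
  Bu : Vec s → Mat n q
  /-- the unknown input gain `ω` -/
  ω : Mat m m
  /-- the vertices of the polytope `Ω` -/
  verts : Finset (Mat m m)
  /-- the unknown nonlinearity `f(t, x)` -/
  f : ℝ → Vec n → Vec n
  /-- bound on `‖f(t, 0)‖` -/
  bf0 : ℝ
  /-- Lipschitz constant `L_f^δ` of `f(t, ·)` on the ball of radius `δ` -/
  Lf : ℝ → ℝ
  /-- Lipschitz constant of `f(·, x)` -/
  lf : ℝ
  LB : ℝ
  LBdag : ℝ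
  LKx : ℝ
  x₀ : Vec n
  /-- the known bound on `‖x₀‖` -/
  ρ₀ : ℝ
  /-- the reference signal -/
  r : ℝ → Vec p
  /-- the filter gain `K` -/
  K : Mat m m
  /-- state-space matrices of the feedforward mapping `H̄(θ)` -/
  AH : Vec s → Mat h h
  BH : Vec s → Mat h q
  CH : Vec s → Mat m h
  DH : Vec s → Mat m q
  /-- predictor gain -/
  a : ℝ
  /-- estimation sampling time -/
  T : ℝ
  /-- initial state of the predictor -/
  xhat₀ : Vec n

namespace System

variable {n m p q s h : ℕ} (Q : System n m p q s h)

/-- The polytope `Ω` of input gains. -/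
def Ω : Set (Mat m m) := convexHull ℝ (Q.verts : Set (Mat m m))

/-- `A_m(θ) = A(θ) + B(θ)K_x(θ)`. -/
def Am (θ : Vec s) : Mat n n := Q.A θ + Q.B θ * Q.Kx θ

/-- `B̄(θ) = [B(θ), B_u(θ)]`. -/
def Bbar (θ : Vec s) : Matrix (Fin n) (Fin m ⊕ Fin q) ℝ := Matrix.fromCols (Q.B θ) (Q.Bu θ)

/-! #### Mappings -/

/-- The low-pass filter with transfer matrix `wK(sI + wK)⁻¹`, for an input gain `w`. -/
def filterOf (w : Mat m m) : IOMap s m m :=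
  IOMap.stateSpace (fun _ => -(w * Q.K)) (fun _ => 1) (fun _ => w * Q.K) (fun _ => 0)

/-- The filter `𝒞` for the true input gain. -/
def filter : IOMap s m m := Q.filterOf Q.ω

/-- `ω⁻¹𝒞`. -/
noncomputable def invFilter : IOMap s m m := (IOMap.gain fun _ => Q.ω⁻¹).comp Q.filter

/-- `H_xm(θ)`. -/
def Hxm : IOMap s m n := IOMap.stateSpace Q.Am Q.B (fun _ => 1) (fun _ => 0)

/-- `H_m(θ)`. -/
def Hm : IOMap s m p := IOMap.stateSpace Q.Am Q.B Q.C (fun _ => 0)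

/-- `H_xum(θ)`. -/
def Hxum : IOMap s q n := IOMap.stateSpace Q.Am Q.Bu (fun _ => 1) (fun _ => 0)

/-- `H̄(θ)`. -/
def Hbar : IOMap s q m := IOMap.stateSpace Q.AH Q.BH Q.CH Q.DH

/-- `G_xm(θ) = H_xm(θ)(I - 𝒞)`. -/
def Gxm : IOMap s m n := Q.Hxm.comp (IOMap.ident.sub Q.filter)

/-- `G_xum(θ) = H_xum(θ) - H_xm(θ)𝒞H̄(θ)`. -/
def Gxum : IOMap s q n := Q.Hxum.sub (Q.Hxm.comp (Q.filter.comp Q.Hbar))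

/-- `G_m(θ) = C(θ)G_xm(θ)`. -/
def Gm : IOMap s m p := (IOMap.gain Q.C).comp Q.Gxm

/-- `G_um(θ) = C(θ)G_xum(θ)`. -/
def Gum : IOMap s q p := (IOMap.gain Q.C).comp Q.Gxum

/-- `H_xm(θ)𝒞K_r(θ)`. -/
def HxmCKr : IOMap s p n := Q.Hxm.comp (Q.filter.comp (IOMap.gain Q.Kr))

/-- `(𝒞 - I)K_r(θ)`. -/
def CIKr : IOMap s p m := (Q.filter.sub IOMap.ident).comp (IOMap.gain Q.Kr)

/-- `H_xm(θ)(𝒞 - I)K_r(θ)`. -/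
def HxmCIKr : IOMap s p n := Q.Hxm.comp Q.CIKr

/-- `H_m(θ)(𝒞 - I)K_r(θ)`. -/
def HmCIKr : IOMap s p p := Q.Hm.comp Q.CIKr

/-- `ω⁻¹𝒞H̄(θ)`. -/
noncomputable def invFilterHbar : IOMap s q m := Q.invFilter.comp Q.Hbar

/-- `(ω⁻¹𝒞 - I)K_r(θ)`. -/
noncomputable def invFilterIKr : IOMap s p m :=
  (Q.invFilter.sub IOMap.ident).comp (IOMap.gain Q.Kr)

/-- `F(θ) = 𝒞(B†(θ) + H̄(θ)B_u†(θ))`. -/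
noncomputable def F : IOMap s n m :=
  Q.filter.comp ((IOMap.gain fun θ => pinv (Q.B θ)).add
    (Q.Hbar.comp (IOMap.gain fun θ => pinv (Q.Bu θ))))

/-! #### Assumptions -/

/-- The standing assumptions on plant, uncertainty, reference signal and controller. -/
structure Assumptions : Prop where
  rate_bound : ∀ v ∈ Q.S.Θd, ‖v‖ ≤ Q.bθ
  /-- the parameter-dependent matrices depend continuously on the parameter -/
  cont_A : ContinuousOn Q.A Q.S.Θ
  cont_C : ContinuousOn Q.C Q.S.Θ
  cont_Kr : ContinuousOn Q.Kr Q.S.Θ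
  cont_Bu : ContinuousOn Q.Bu Q.S.Θ
  cont_AH : ContinuousOn Q.AH Q.S.Θ
  cont_BH : ContinuousOn Q.BH Q.S.Θ
  cont_CH : ContinuousOn Q.CH Q.S.Θ
  cont_DH : ContinuousOn Q.DH Q.S.Θ
  /-- `ω` is strictly row-diagonally dominant and lies in `Ω`, as does the identity -/
  ω_dominant : ∀ i, ∑ j ∈ Finset.univ.erase i, |Q.ω i j| < |Q.ω i i|
  ω_mem : Q.ω ∈ Q.Ω
  one_mem : (1 : Mat m m) ∈ Q.Ω
  /-- full column rank and Lipschitz dependence on the parameter -/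
  B_rank : ∀ θ ∈ Q.S.Θ, (Q.B θ).rank = m
  LB_pos : 0 < Q.LB
  LBdag_pos : 0 < Q.LBdag
  LKx_pos : 0 < Q.LKx
  B_lip : ∀ θ₁ ∈ Q.S.Θ, ∀ θ₂ ∈ Q.S.Θ, ‖Q.B θ₁ - Q.B θ₂‖ ≤ Q.LB * ‖θ₁ - θ₂‖
  Bdag_lip : ∀ θ₁ ∈ Q.S.Θ, ∀ θ₂ ∈ Q.S.Θ,
    ‖pinv (Q.B θ₁) - pinv (Q.B θ₂)‖ ≤ Q.LBdag * ‖θ₁ - θ₂‖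
  Kx_lip : ∀ θ₁ ∈ Q.S.Θ, ∀ θ₂ ∈ Q.S.Θ, ‖Q.Kx θ₁ - Q.Kx θ₂‖ ≤ Q.LKx * ‖θ₁ - θ₂‖
  /-- `B_u` completes `B` to an invertible matrix by columns orthogonal to those of `B` -/
  dim_eq : m + q = n
  Bbar_rank : ∀ θ ∈ Q.S.Θ, (Q.Bbar θ).rank = n
  B_Bu_orth : ∀ θ ∈ Q.S.Θ, (Q.B θ)ᵀ * Q.Bu θ = 0
  /-- the nonlinearity -/
  f_zero : ∀ t : ℝ, 0 ≤ t → ‖Q.f t 0‖ ≤ Q.bf0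
  Lf_pos : ∀ δ : ℝ, 0 < δ → 0 < Q.Lf δ
  f_lip : ∀ δ : ℝ, 0 < δ → ∀ t : ℝ, 0 ≤ t → ∀ x₁ x₂ : Vec n, ‖x₁‖ ≤ δ → ‖x₂‖ ≤ δ →
    ‖Q.f t x₁ - Q.f t x₂‖ ≤ Q.Lf δ * ‖x₁ - x₂‖
  lf_pos : 0 < Q.lf
  f_rate : ∀ (x : Vec n) (t₁ t₂ : ℝ), 0 ≤ t₁ → 0 ≤ t₂ →
    ‖Q.f t₁ x - Q.f t₂ x‖ ≤ Q.lf * |t₁ - t₂|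
  /-- initial state, reference signal, predictor gain and sampling time -/
  ρ₀_pos : 0 < Q.ρ₀
  x₀_bound : ‖Q.x₀‖ ≤ Q.ρ₀
  r_meas : Measurable Q.r
  r_bdd : linfNorm Q.r < ⊤
  a_pos : 0 < Q.a
  T_pos : 0 < Q.T
  /-- for every input gain in `Ω` the filter has DC gain `I` and is bounded-input
  bounded-output stable -/
  filter_dc : ∀ w ∈ Q.Ω, IsUnit (w * Q.K).det
  filter_stable : ∀ w ∈ Q.Ω, IOMap.ppg Q.S (Q.filterOf w) < ⊤

/-! #### Closed loops -/

/-- The ideal closed loop. -/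
structure IsIdeal (θ : ℝ → Vec s) (x : ℝ → Vec n) (u : ℝ → Vec m) (y : ℝ → Vec p) : Prop where
  state : IsSolution x Q.x₀ fun t => Q.Am (θ t) *ₑ x t + Q.B (θ t) *ₑ u t
  input : ∀ t : ℝ, 0 ≤ t → u t = Q.Kr (θ t) *ₑ Q.r t
  output : ∀ t : ℝ, 0 ≤ t → y t = Q.C (θ t) *ₑ x t

/-- The adaptive closed loop: plant state `x`, adaptive input `u`, output `y`, predictor state
`xhat`, uncertainty estimate `sig`, its matched and unmatched components `sigM`, `sigU`, and the
feedforward signal `eta = H̄(θ) sigU`. -/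
structure IsAdaptive (θ : ℝ → Vec s) (x : ℝ → Vec n) (u : ℝ → Vec m) (y : ℝ → Vec p)
    (xhat sig : ℝ → Vec n) (sigM : ℝ → Vec m) (sigU : ℝ → Vec q) (eta : ℝ → Vec m) : Prop where
  /-- the plant with total input `K_x(θ)x + u` -/
  plant : IsSolution x Q.x₀ fun t =>
    Q.A (θ t) *ₑ x t + Q.B (θ t) *ₑ Q.ω *ₑ (Q.Kx (θ t) *ₑ x t + u t) + Q.f t (x t)
  output : ∀ t : ℝ, 0 ≤ t → y t = Q.C (θ t) *ₑ x t
  /-- state predictor -/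
  predictor : IsSolution xhat Q.xhat₀ fun t =>
    Q.Am (θ t) *ₑ x t + Q.B (θ t) *ₑ u t + sig t - Q.a • (xhat t - x t)
  /-- piecewise-constant estimation law -/
  adapt : ∀ (i : ℕ) (t : ℝ), t ∈ Ico (i * Q.T) ((i + 1) * Q.T) →
    sig t = -(Q.a / (Real.exp (Q.a * Q.T) - 1)) • (xhat (i * Q.T) - x (i * Q.T))
  /-- `[sigM; sigU] = B̄⁻¹(θ) σ̂_c`, with `σ̂_c = 0` on `[0, T)` and `σ̂_c = sig` on `[T, ∞)` -/
  matched : ∀ t : ℝ, 0 ≤ t → ∀ j,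
    sigM t j = (pinv (Q.Bbar (θ t)) *ₑ (if t < Q.T then 0 else sig t)) (Sum.inl j)
  unmatched : ∀ t : ℝ, 0 ≤ t → ∀ j,
    sigU t j = (pinv (Q.Bbar (θ t)) *ₑ (if t < Q.T then 0 else sig t)) (Sum.inr j)
  feedforward : Q.Hbar θ sigU eta
  /-- the control law, with zero initial state -/
  control : IsSolution u 0 fun t =>
    -(Q.K *ₑ (u t + sigM t + eta t - Q.Kr (θ t) *ₑ Q.r t))

/-! #### Constants depending on the data only -/

noncomputable def bAm : ℝ := maxNorm Q.S.Θ Q.Am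
noncomputable def bB : ℝ := maxNorm Q.S.Θ Q.B
noncomputable def bBdag : ℝ := maxNorm Q.S.Θ fun θ => pinv (Q.B θ)
noncomputable def bBudag : ℝ := maxNorm Q.S.Θ fun θ => pinv (Q.Bu θ)
noncomputable def bBbarInv : ℝ := maxNorm Q.S.Θ fun θ => pinv (Q.Bbar θ)
noncomputable def bC : ℝ := maxNorm Q.S.Θ Q.C
noncomputable def bKx : ℝ := maxNorm Q.S.Θ Q.Kx
noncomputable def bKr : ℝ := maxNorm Q.S.Θ Q.Kr

/-- `max_{w ∈ Ω} ‖w - I‖`. -/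
noncomputable def dΩ : ℝ := maxNorm Q.Ω fun w => w - 1

/-- `max_{w ∈ Ω} ‖w‖`. -/
noncomputable def bΩ : ℝ := maxNorm Q.Ω fun w => w

/-- `‖r‖_∞`. -/
noncomputable def rNorm : ℝ := (linfNorm Q.r).toReal

/-- `‖ω⁻¹𝒞‖` in the `L₁` norm. -/
noncomputable def l1InvFilter : ℝ := (IOMap.ppg Q.S Q.invFilter).toReal

noncomputable def bf1 : ℝ := Q.bBdag * Q.bf0
noncomputable def bf2 : ℝ := Q.bBudag * Q.bf0

/-- `L_{f₁}^δ`. -/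
noncomputable def Lf1 (δ : ℝ) : ℝ :=
  Q.Lf δ * Q.bBdag +
    maxNorm (Q.Ω ×ˢ Q.S.Θ) fun z : Mat m m × Vec s => (z.1 - 1) * Q.Kx z.2

/-- `L_{f₂}^δ`. -/
noncomputable def Lf2 (δ : ℝ) : ℝ := Q.Lf δ * Q.bBudag

/-- Lipschitz constant in `x`, on the ball of radius `δ`, of
`f̄(t, x) = f(t, x) + B(θ)(ω - I)K_x(θ)x`. -/
noncomputable def Lfbar (δ : ℝ) : ℝ :=
  Q.Lf δ + maxNorm Q.S.Θ (fun θ => Q.B θ * Q.Kx θ) * Q.dΩ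

/-- Lipschitz constant in `t` of `f̄(t, x)` for `‖x‖ ≤ δ`. -/
noncomputable def lfbar (δ : ℝ) : ℝ :=
  Q.lf + Q.dΩ * (Q.LB * Q.bKx + Q.bB * Q.LKx) * δ * Q.bθ

end System

/-! ### Analysis constants -/

/-- Numbers chosen as bounds on the peak-to-peak gains of the mappings named by the fields. -/
structure Gains where
  Hxm : ℝ
  Hbar : ℝ
  Gxm : ℝ
  Gxum : ℝ
  Gm : ℝ
  Gum : ℝ
  HxmCKr : ℝ
  HxmCIKr : ℝ
  HmCIKr : ℝ
  invFilterHbar : ℝ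
  invFilterIKr : ℝ

/-- Each number is a bound on the peak-to-peak gain of the corresponding mapping. -/
structure Gains.Valid {n m p q s h : ℕ} (g : Gains) (Q : System n m p q s h) : Prop where
  Hxm : IOMap.IsPPGBound Q.S Q.Hxm g.Hxm
  Hbar : IOMap.IsPPGBound Q.S Q.Hbar g.Hbar
  Gxm : IOMap.IsPPGBound Q.S Q.Gxm g.Gxm
  Gxum : IOMap.IsPPGBound Q.S Q.Gxum g.Gxum
  Gm : IOMap.IsPPGBound Q.S Q.Gm g.Gm
  Gum : IOMap.IsPPGBound Q.S Q.Gum g.Gum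
  HxmCKr : IOMap.IsPPGBound Q.S Q.HxmCKr g.HxmCKr
  HxmCIKr : IOMap.IsPPGBound Q.S Q.HxmCIKr g.HxmCIKr
  HmCIKr : IOMap.IsPPGBound Q.S Q.HmCIKr g.HmCIKr
  invFilterHbar : IOMap.IsPPGBound Q.S Q.invFilterHbar g.invFilterHbar
  invFilterIKr : IOMap.IsPPGBound Q.S Q.invFilterIKr g.invFilterIKr

/-- A strictly proper state-space realization of `F(θ)` with a Lyapunov matrix and decay rate. -/
structure FReal (n m s k : ℕ) where
  A : Vec s → Mat k k
  B : Vec s → Mat k n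
  C : Vec s → Mat m k
  P : Vec s → Mat k k
  μ : ℝ

/-- The realization is continuous in the parameter, its outputs are those of `F(θ)`, and `P`, `μ`
satisfy the Lyapunov inequality. -/
structure FReal.Valid {n m p q s h k : ℕ} (R : FReal n m s k) (Q : System n m p q s h) :
    Prop where
  cont_A : ContinuousOn R.A Q.S.Θ
  cont_B : ContinuousOn R.B Q.S.Θ
  cont_C : ContinuousOn R.C Q.S.Θ
  realizes : ∀ θ, Q.S.Admissible θ → ∀ v, IsSignal v → ∀ y,
    IOMap.stateSpace R.A R.B R.C (fun _ => 0) θ v y → Q.F θ v y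
  lyapunov : IsLyapunov Q.S R.A R.P R.μ

namespace System

variable {n m p q s h k : ℕ} (Q : System n m p q s h) (g : Gains) (R : FReal n m s k)
  (P : Vec s → Mat n n) (ρr γ₁ γbar ρ ρu : ℝ)

/-- `ρ_in = ρ₀ √(λ_max(P) / λ_min(P))`. -/
noncomputable def ρin : ℝ := Q.ρ₀ * √(lamMax Q.S.Θ P / lamMin Q.S.Θ P)

/-- The stability condition, with `ρ = ρ_r + γ₁`. -/
def StabilityCondition : Prop :=
  g.Gxm * (Q.Lf1 (ρr + γ₁) * ρr + Q.bf1) + g.Gxum * (Q.Lf2 (ρr + γ₁) * ρr + Q.bf2)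
    < ρr - g.HxmCKr * Q.rNorm - Q.ρin P

/-- The constraint linking `γ̄₀` and `γ₁`. -/
def GammaConstraint : Prop :=
  g.Hxm / (1 - g.Gxm * Q.Lf1 (ρr + γ₁) - g.Gxum * Q.Lf2 (ρr + γ₁)) * γbar < γ₁

/-- `ρ_ur`, the bound on the input of the reference system. -/
noncomputable def ρur : ℝ :=
  Q.l1InvFilter * (Q.bKr * Q.rNorm + Q.Lf1 ρr * ρr + Q.bf1 +
    g.Hbar * (Q.Lf2 ρr * ρr + Q.bf2))

/-- `γ₂`. -/
noncomputable def γ₂ : ℝ :=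
  (Q.l1InvFilter * Q.Lf1 (ρr + γ₁) + g.invFilterHbar * Q.Lf2 (ρr + γ₁)) * γ₁ +
    ‖Q.ω⁻¹‖ * γbar

/-- `b_σ(ρ, ρ_u)`. -/
noncomputable def bσ : ℝ :=
  Q.bB * Q.dΩ * (ρu + Q.bKx * ρ) + Q.Lf ρ * ρ + Q.bf0

/-- `b_ẋ(ρ, ρ_u)`. -/
noncomputable def bxdot : ℝ :=
  Q.bAm * ρ + Q.bB * ρu * Q.bΩ + Q.Lf ρ * ρ + Q.bf0 + Q.bB * Q.dΩ * Q.bKx * ρ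

/-- `b_{σ̂_c}(ρ, ρ_u)`. -/
noncomputable def bσc : ℝ := Real.exp (-(Q.a * Q.T)) * √n * Q.bσ ρ ρu

/-- `b_{u̇}(ρ, ρ_u)`. -/
noncomputable def budot : ℝ :=
  ‖Q.K‖ * (ρu + (1 + g.Hbar) * Q.bBbarInv * Q.bσc ρ ρu + Q.bKr * Q.rNorm)

/-- `b_{σ̃}(ρ, ρ_u)`. -/
noncomputable def bσtilde : ℝ :=
  2 * √n * Q.T * (‖Q.ω - 1‖ * (Q.bB * Q.budot g ρ ρu + Q.LB * Q.bθ * ρu)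
      + Q.lfbar ρ + Q.Lfbar ρ * Q.bxdot ρ ρu)
    + (1 - Real.exp (-(Q.a * Q.T))) * √n * Q.bσ ρ ρu

/-- `γ₀(T, ρ, ρ_u)`. -/
noncomputable def γ₀ : ℝ :=
  maxNorm Q.S.Θ R.C *
    (√(lamMax Q.S.Θ R.P / lamMin Q.S.Θ R.P) *
        beta Q.S.Θ (Real.exp (-(R.μ * Q.T))) R.μ R.P R.B * Q.bσ ρ ρu
      + beta Q.S.Θ 0 R.μ R.P R.B * Q.bσtilde g ρ ρu)

/-- The constraint `γ₀(T, ρ, ρ_u) < γ̄₀` on the sampling time, with `ρ = ρ_r + γ₁` and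
`ρ_u = ρ_ur + γ₂`. -/
def SamplingConstraint : Prop :=
  Q.γ₀ g R (ρr + γ₁) (Q.ρur g ρr + Q.γ₂ g ρr γ₁ γbar) < γbar

noncomputable def α₁ : ℝ :=
  g.Gxm * (Q.Lf1 ρr * ρr + Q.bf1) + g.Gxum * (Q.Lf2 ρr * ρr + Q.bf2) +
    g.HxmCIKr * Q.rNorm

noncomputable def α₂ : ℝ :=
  Q.l1InvFilter * (Q.Lf1 ρr * ρr + Q.bf1) + g.invFilterHbar * (Q.Lf2 ρr * ρr + Q.bf2) +
    g.invFilterIKr * Q.rNorm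

noncomputable def α₃ : ℝ :=
  g.Gm * (Q.Lf1 ρr * ρr + Q.bf1) + g.Gum * (Q.Lf2 ρr * ρr + Q.bf2) +
    g.HmCIKr * Q.rNorm

end System

end LPV

namespace LPV

open Set MeasureTheory Filter Topology
open scoped ENNReal Matrix Matrix.Norms.L2Operator

/-! ### The matrix-vector product -/

section Act

variable {ι κ l : Type} [Fintype ι] [Fintype κ] [Fintype l] [DecidableEq κ]
  [DecidableEq l]

/-! The lumped uncertainty `σ = B(ω - I)(K_x x + u) + f(t, x)` is the only unknown in the equation
of the prediction error `x̂ - x`. On each sampling interval the constant correction is tuned so that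
it cancels the error present at the start, and at the end only a weighted integral of `σ` is left.
Hence the next estimate is `exp(-aT)` times an exponentially weighted average of `σ` over the
previous interval (`estimate_eq_wavg`, `IsAdaptive.estimate_eq`), and the initial predictor error
never reaches the control law. While `x` and `u` stay in balls of radius `ρ` and `ρ_u`, both are
Lipschitz in time, so the averages follow `σ` with an error of order `T`.

Because `B` and `B_u` are orthogonal, `B̄⁻¹` stacks `B†` and `B_u†`. The matched estimate contains
`(ω - I)u`, which turns the `u` of the control law into `ωu`; the law thus becomes the filter `𝒞` of
the true gain, and `ωu` is the filtered reference minus the filtered uncertainties minus the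
response of `F` to the estimation error. Inserted in the plant, this writes the state as a sum of
linear responses: to the initial state, to the reference, through `G_xm` and `G_xum` to the matched
and unmatched uncertainties, and through `H_xm` to the estimation error (`exists_decomposition`,
`Decomposition.isSolution_sub`).

No nonlinear reference system is needed. The nonlinearity is split at the radial projection of the
state to the ball of radius `ρ_r`. The projected part is bounded in terms of `ρ_r`, whatever the
state does, and yields the `α_i`; the remainder is at most a Lipschitz constant times `γ₁` and goes
into the deviation terms.

The constant `max ‖B K_x‖ d_Ω` in `L_f̄` need not bound `‖B(ω - I)K_x‖`, since `ω - I` stands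
between the two factors. Therefore the state in the matched term `(ω - I)K_x x` is replaced by its
sampled average, which satisfies the same norm bound. The error of this replacement is kept out of
`F` and enters the plant directly as `averagingError`. For constant parameters `F B` is the filter,
whose DC gain is `I`, so the gain of `F` is bounded below: `‖v‖` is at most the gain times `‖B v‖`
(`norm_le_gain_mul`). With `v = K_x(x - average)` this makes `max ‖B K_x‖ d_Ω` the right constant
after all, and the response of `F` and the averaging error are together at most `γ₀`
(`Decomposition.norm_yF_add_averagingError_le`).

All these bounds presuppose the balls `ρ` and `ρ_u`. The stability condition, the constraint on
`γ̄₀` and `γ₀ < γ̄₀` make them strict, so a continuity argument (`le_of_bootstrap`) shows that the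
balls are never left (`norm_closedLoop_le`). Comparing the decomposition with the ideal system then
gives the theorem. -/

theorem act_apply (M : Matrix ι κ ℝ) (v : EuclideanSpace ℝ κ) (i : ι) :
    (M *ₑ v) i = ∑ j, M i j * v j := by
  simp [act, Matrix.mulVec, dotProduct, Matrix.toLpLin_apply]

theorem act_add (M : Matrix ι κ ℝ) (v w : EuclideanSpace ℝ κ) :
    M *ₑ (v + w) = M *ₑ v + M *ₑ w := map_add _ _ _

theorem act_sub (M : Matrix ι κ ℝ) (v w : EuclideanSpace ℝ κ) :
    M *ₑ (v - w) = M *ₑ v - M *ₑ w := map_sub _ _ _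

theorem act_neg (M : Matrix ι κ ℝ) (v : EuclideanSpace ℝ κ) :
    M *ₑ (-v) = -(M *ₑ v) := map_neg _ _

theorem act_smul (M : Matrix ι κ ℝ) (c : ℝ) (v : EuclideanSpace ℝ κ) :
    M *ₑ (c • v) = c • (M *ₑ v) := map_smul _ _ _

theorem act_zero (M : Matrix ι κ ℝ) : M *ₑ (0 : EuclideanSpace ℝ κ) = 0 := map_zero _

theorem add_act (M N : Matrix ι κ ℝ) (v : EuclideanSpace ℝ κ) :
    (M + N) *ₑ v = M *ₑ v + N *ₑ v := by simp [act]

theorem sub_act (M N : Matrix ι κ ℝ) (v : EuclideanSpace ℝ κ) :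
    (M - N) *ₑ v = M *ₑ v - N *ₑ v := by simp [act]

theorem neg_act (M : Matrix ι κ ℝ) (v : EuclideanSpace ℝ κ) :
    (-M) *ₑ v = -(M *ₑ v) := by simp [act]

theorem smul_act (c : ℝ) (M : Matrix ι κ ℝ) (v : EuclideanSpace ℝ κ) :
    (c • M) *ₑ v = c • (M *ₑ v) := by simp [act]

theorem zero_act (v : EuclideanSpace ℝ κ) : (0 : Matrix ι κ ℝ) *ₑ v = 0 := by simp [act]

theorem one_act (v : EuclideanSpace ℝ κ) : (1 : Matrix κ κ ℝ) *ₑ v = v := by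
  simp [act]

theorem mul_act (M : Matrix ι κ ℝ) (N : Matrix κ l ℝ) (v : EuclideanSpace ℝ l) :
    (M * N) *ₑ v = M *ₑ N *ₑ v := by
  simp [act, Matrix.toLpLin_apply]

theorem norm_act_le (M : Matrix ι κ ℝ) (v : EuclideanSpace ℝ κ) :
    ‖M *ₑ v‖ ≤ ‖M‖ * ‖v‖ := by
  have := Matrix.l2_opNorm_mulVec M v
  simpa [act, Matrix.toLpLin_apply] using this

theorem norm_act_le_of_le {M : Matrix ι κ ℝ} {v : EuclideanSpace ℝ κ} {a b : ℝ}
    (hM : ‖M‖ ≤ a) (hv : ‖v‖ ≤ b) : ‖M *ₑ v‖ ≤ a * b :=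
  (norm_act_le M v).trans (mul_le_mul hM hv (norm_nonneg _) ((norm_nonneg _).trans hM))

theorem inner_act_left [DecidableEq ι] (M : Matrix ι κ ℝ) (v : EuclideanSpace ℝ κ) (w : EuclideanSpace ℝ ι) :
    inner ℝ (M *ₑ v) w = inner ℝ v (Mᵀ *ₑ w) := by
  simp only [PiLp.inner_apply, act_apply, Matrix.transpose_apply, RCLike.inner_apply, conj_trivial]
  simp only [Finset.mul_sum, Finset.sum_mul]
  rw [Finset.sum_comm]
  exact Finset.sum_congr rfl fun j _ => Finset.sum_congr rfl fun i _ => by ring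

/-- The matrix-vector product as a continuous bilinear map. -/
noncomputable def actL : Matrix ι κ ℝ →L[ℝ] EuclideanSpace ℝ κ →L[ℝ] EuclideanSpace ℝ ι :=
  LinearMap.mkContinuous₂
    (LinearMap.mk₂ ℝ (fun (M : Matrix ι κ ℝ) (v : EuclideanSpace ℝ κ) => M *ₑ v)
      add_act smul_act act_add fun c M v => act_smul M c v) 1
    fun M v => by simpa using norm_act_le M v

theorem _root_.ContinuousOn.act {α : Type*} [TopologicalSpace α] {s : Set α}
    {M : α → Matrix ι κ ℝ} {v : α → EuclideanSpace ℝ κ} (hM : ContinuousOn M s)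
    (hv : ContinuousOn v s) : ContinuousOn (fun a => M a *ₑ v a) s :=
  ((actL (ι := ι) (κ := κ)).continuous.comp_continuousOn hM).clm_apply hv

theorem _root_.Continuous.act {α : Type*} [TopologicalSpace α]
    {M : α → Matrix ι κ ℝ} {v : α → EuclideanSpace ℝ κ} (hM : Continuous M)
    (hv : Continuous v) : Continuous fun a => M a *ₑ v a :=
  ((actL (ι := ι) (κ := κ)).continuous.comp hM).clm_apply hv

theorem actL_apply (M : Matrix ι κ ℝ) (v : EuclideanSpace ℝ κ) : actL M v = M *ₑ v := rfl

theorem hasDerivWithinAt_act {M : ℝ → Matrix ι κ ℝ} {v : ℝ → EuclideanSpace ℝ κ}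
    {M' : Matrix ι κ ℝ} {v' : EuclideanSpace ℝ κ} {s : Set ℝ} {t : ℝ}
    (hM : HasDerivWithinAt M M' s t) (hv : HasDerivWithinAt v v' s t) :
    HasDerivWithinAt (fun t => M t *ₑ v t) (M t *ₑ v' + M' *ₑ v t) s t := by
  have h := (actL (ι := ι) (κ := κ)).hasFDerivWithinAt_of_bilinear hM.hasFDerivWithinAt
    hv.hasFDerivWithinAt
  simpa [actL_apply] using h.hasDerivWithinAt

end Act

theorem _root_.ContinuousOn.mat_mul {α ι κ l : Type*} [TopologicalSpace α] [Fintype κ]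
    {s : Set α}
    {M : α → Matrix ι κ ℝ} {N : α → Matrix κ l ℝ} (hM : ContinuousOn M s)
    (hN : ContinuousOn N s) : ContinuousOn (fun a => M a * N a) s := by
  rw [continuousOn_iff_continuous_domRestrict] at hM hN ⊢
  exact hM.matrix_mul hN

/-! ### Maxima of norms -/

theorem maxNorm_nonneg {α β : Type} [SeminormedAddGroup β] (S : Set α) (F : α → β) :
    0 ≤ maxNorm S F :=
  Real.sSup_nonneg (by rintro _ ⟨a, -, rfl⟩; exact norm_nonneg _)

theorem norm_le_maxNorm {α β : Type} [TopologicalSpace α] [SeminormedAddGroup β] {S : Set α}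
    {F : α → β} (hS : IsCompact S) (hF : ContinuousOn F S) {a : α} (ha : a ∈ S) :
    ‖F a‖ ≤ maxNorm S F :=
  le_csSup (hS.bddAbove_image hF.norm) ⟨a, ha, rfl⟩

/-! ### Solutions of differential equations in integral form -/

namespace IsSolution

variable {n : ℕ} {x x' : ℝ → Vec n} {x₀ x₀' : Vec n} {v v' : ℝ → Vec n}

theorem congr (h : IsSolution x x₀ v) (hx : ∀ t, 0 ≤ t → x' t = x t)
    (hv : ∀ t, 0 ≤ t → v' t = v t) : IsSolution x' x₀ v' := by
  intro t ht
  have hE : EqOn v v' (uIcc 0 t) := fun s hs => by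
    rw [uIcc_of_le ht] at hs
    exact (hv s hs.1).symm
  refine ⟨(h t ht).1.congr (hE.mono uIoc_subset_uIcc), ?_⟩
  rw [hx t ht, (h t ht).2, intervalIntegral.integral_congr hE]

theorem add (h : IsSolution x x₀ v) (h' : IsSolution x' x₀' v') :
    IsSolution (fun t => x t + x' t) (x₀ + x₀') (fun t => v t + v' t) := by
  intro t ht
  refine ⟨(h t ht).1.add (h' t ht).1, ?_⟩
  beta_reduce
  rw [(h t ht).2, (h' t ht).2, intervalIntegral.integral_add (h t ht).1 (h' t ht).1]
  abel

theorem map {k : ℕ} (h : IsSolution x x₀ v) (M : Mat k n) :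
    IsSolution (fun t => M *ₑ x t) (M *ₑ x₀) (fun t => M *ₑ v t) := by
  intro t ht
  refine ⟨⟨(actL M).integrable_comp (h t ht).1.1, (actL M).integrable_comp (h t ht).1.2⟩, ?_⟩
  beta_reduce
  rw [(h t ht).2, act_add]
  congr 1
  exact ((actL M).intervalIntegral_comp_comm (h t ht).1).symm

theorem neg (h : IsSolution x x₀ v) :
    IsSolution (fun t => -x t) (-x₀) (fun t => -v t) := by
  intro t ht
  refine ⟨(h t ht).1.neg, ?_⟩
  beta_reduce
  rw [(h t ht).2, intervalIntegral.integral_neg, neg_add]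

theorem sub (h : IsSolution x x₀ v) (h' : IsSolution x' x₀' v') :
    IsSolution (fun t => x t - x' t) (x₀ - x₀') (fun t => v t - v' t) := by
  simpa only [sub_eq_add_neg] using h.add h'.neg

theorem initial (h : IsSolution x x₀ v) : x 0 = x₀ := by
  simpa using (h 0 le_rfl).2

theorem integral_eq (h : IsSolution x x₀ v) {a b : ℝ} (ha : 0 ≤ a) (hb : 0 ≤ b) :
    x b - x a = ∫ t in a..b, v t := by
  rw [(h a ha).2, (h b hb).2, add_sub_add_left_eq_sub,
    intervalIntegral.integral_interval_sub_left (h b hb).1 (h a ha).1]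

theorem continuousOn (h : IsSolution x x₀ v) : ContinuousOn x (Ici 0) := by
  intro t ht
  have ht : 0 ≤ t := ht
  have ht1 : (0 : ℝ) ≤ t + 1 := by linarith
  have hc : ContinuousOn x (Icc 0 (t + 1)) := by
    have := intervalIntegral.continuousOn_primitive_interval' (h (t + 1) ht1).1
      (left_mem_uIcc)
    rw [uIcc_of_le ht1] at this
    refine ((continuousOn_const (c := x₀)).add this).congr fun s hs => (h s hs.1).2
  refine (hc t ⟨ht, by linarith⟩).mono_of_mem_nhdsWithin ?_
  filter_upwards [self_mem_nhdsWithin, mem_nhdsWithin_of_mem_nhds (Iio_mem_nhds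
    (lt_add_one t))] with s h1 h2 using ⟨h1, le_of_lt h2⟩

theorem norm_sub_le (h : IsSolution x x₀ v) {τ M : ℝ} (hv : ∀ t ∈ Icc 0 τ, ‖v t‖ ≤ M)
    {a b : ℝ} (ha : a ∈ Icc 0 τ) (hb : b ∈ Icc 0 τ) : ‖x b - x a‖ ≤ M * |b - a| := by
  rw [h.integral_eq ha.1 hb.1]
  refine intervalIntegral.norm_integral_le_of_norm_le_const fun t ht => hv t ?_
  exact uIcc_subset_Icc ha hb (uIoc_subset_uIcc ht)

/-- Sampling makes the right-hand sides only right-continuous, so the fundamental theorem of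
calculus is used from the right. -/
theorem hasDerivWithinAt (h : IsSolution x x₀ v) {t : ℝ} (ht : 0 ≤ t)
    (hv : ContinuousWithinAt v (Ioi t) t) : HasDerivWithinAt x (v t) (Ici t) t := by
  have hm : StronglyMeasurableAtFilter v (𝓝[>] t) := by
    refine ⟨Ioc 0 (t + 1), ?_, ?_⟩
    · filter_upwards [self_mem_nhdsWithin, mem_nhdsWithin_of_mem_nhds (Iio_mem_nhds
        (lt_add_one t))] with s h1 h2 using ⟨ht.trans_lt h1, le_of_lt h2⟩
    · exact (h (t + 1) (by linarith)).1.1.aestronglyMeasurable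
  have h1 := intervalIntegral.integral_hasDerivWithinAt_right (h t ht).1 (s := Ici t)
    (t := Ioi t) hm hv
  refine (h1.const_add x₀).congr (fun s hs => (h s (ht.trans hs)).2) (h t ht).2

end IsSolution

/-! ### Parameter boxes and trajectories -/

theorem ParamBox.isCompact {s : ℕ} (S : ParamBox s) : IsCompact S.Θ := by
  have h : S.Θ = (EuclideanSpace.equiv (Fin s) ℝ) ⁻¹' (Icc S.lo.ofLp S.hi.ofLp) := by
    ext v
    simp only [ParamBox.Θ, mem_ofPred_eq, mem_preimage, mem_Icc, Pi.le_def]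
    exact ⟨fun h => ⟨fun i => (h i).1, fun i => (h i).2⟩, fun h i => ⟨h.1 i, h.2 i⟩⟩
  rw [h]
  exact (EuclideanSpace.equiv (Fin s) ℝ).toHomeomorph.isCompact_preimage.2 isCompact_Icc

theorem ParamBox.Admissible.continuousOn {s : ℕ} {S : ParamBox s} {θ : ℝ → Vec s}
    (hθ : S.Admissible θ) : ContinuousOn θ (Ici 0) := fun t ht => by
  obtain ⟨-, v, -, hv⟩ := hθ t ht
  exact hv.continuousWithinAt

theorem ParamBox.Admissible.norm_sub_le {s : ℕ} {S : ParamBox s} {θ : ℝ → Vec s}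
    (hθ : S.Admissible θ) {b : ℝ} (hb : ∀ v ∈ S.Θd, ‖v‖ ≤ b) {t₁ t₂ : ℝ} (h₁ : 0 ≤ t₁)
    (h₂ : 0 ≤ t₂) : ‖θ t₂ - θ t₁‖ ≤ b * |t₂ - t₁| := by
  choose! v hv using fun t ht => (hθ t ht).2
  exact (convex_Ici (0 : ℝ)).norm_image_sub_le_of_norm_hasDerivWithin_le
    (fun t ht => (hv t ht).2) (fun t ht => hb _ (hv t ht).1) h₁ h₂

/-- The derivative of a bounded parameter trajectory cannot stay away from zero. -/
theorem ParamBox.Admissible.zero_mem {s : ℕ} {S : ParamBox s} {θ : ℝ → Vec s}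
    (hθ : S.Admissible θ) : (0 : Vec s) ∈ S.Θd := by
  choose! v hv using fun t ht => (hθ t ht).2
  intro i
  have hd : ∀ t, 0 ≤ t → HasDerivWithinAt (fun t => θ t i) (v t i) (Ici 0) t := fun t ht =>
    ((EuclideanSpace.proj i : Vec s →L[ℝ] ℝ).hasFDerivAt.comp_hasDerivWithinAt t (hv t ht).2)
  have hc : ContinuousOn (fun t => θ t i) (Ici 0) := fun t ht => (hd t ht).continuousWithinAt
  have hin : ∀ t ∈ interior (Ici (0 : ℝ)), DifferentiableAt ℝ (fun t => θ t i) t ∧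
      deriv (fun t => θ t i) t = v t i := by
    intro t ht
    have h1 := (hd t (interior_subset ht)).hasDerivAt (mem_interior_iff_mem_nhds.1 ht)
    exact ⟨h1.differentiableAt, h1.deriv⟩
  have hD : DifferentiableOn ℝ (fun t => θ t i) (interior (Ici (0 : ℝ))) := fun t ht =>
    (hin t ht).1.differentiableWithinAt
  have hb : ∀ t : ℝ, 0 ≤ t → S.lo i ≤ θ t i ∧ θ t i ≤ S.hi i := fun t ht => (hθ t ht).1 i
  constructor
  · by_contra! hlo
    simp only [PiLp.zero_apply] at hlo
    -- A time after which a rate of at least `S.rateLo i` has moved the component by one more than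
    -- the width of the box.
    set T : ℝ := (S.hi i - S.lo i + 1) / S.rateLo i
    have hlh := (hb 0 le_rfl).1.trans (hb 0 le_rfl).2
    have hT : 0 ≤ T := div_nonneg (by linarith) hlo.le
    have := (convex_Ici (0 : ℝ)).mul_sub_le_image_sub_of_le_deriv hc hD (C := S.rateLo i)
      (fun t ht => by
        rw [(hin t ht).2]; exact ((hv t (interior_subset ht)).1 i).1) 0 self_mem_Ici T hT hT
    have h2 : S.rateLo i * (T - 0) = S.hi i - S.lo i + 1 := by
      simp only [T]; field_simp; ring
    have := hb 0 le_rfl; have := hb T hT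
    linarith
  · by_contra! hhi
    simp only [PiLp.zero_apply] at hhi
    set T : ℝ := (S.hi i - S.lo i + 1) / (-S.rateHi i)
    have hlh := (hb 0 le_rfl).1.trans (hb 0 le_rfl).2
    have hT : 0 ≤ T := div_nonneg (by linarith) (by linarith)
    have := (convex_Ici (0 : ℝ)).image_sub_le_mul_sub_of_deriv_le hc hD (C := S.rateHi i)
      (fun t ht => by
        rw [(hin t ht).2]; exact ((hv t (interior_subset ht)).1 i).2) 0 self_mem_Ici T hT hT
    have h2 : S.rateHi i * (T - 0) = -(S.hi i - S.lo i + 1) := by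
      have : S.rateHi i ≠ 0 := hhi.ne
      simp only [T]; field_simp; ring
    have := hb 0 le_rfl; have := hb T hT
    linarith

theorem ParamBox.admissible_const {s : ℕ} {S : ParamBox s} (h0 : (0 : Vec s) ∈ S.Θd)
    {θ₀ : Vec s} (h : θ₀ ∈ S.Θ) : S.Admissible fun _ => θ₀ := fun _ _ =>
  ⟨h, 0, h0, hasDerivWithinAt_const _ _ _⟩

/-! ### Eigenvalue bounds -/

section Eigen

variable {s k : ℕ} {Θ : Set (Vec s)} {P : Vec s → Mat k k}

theorem inner_act_nonneg {M : Mat k k} (hM : M.PosSemidef) (v : Vec k) :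
    0 ≤ inner ℝ v (M *ₑ v) := by
  have h := (Matrix.isPositive_toEuclideanLin_iff.2 hM).2 v
  rw [real_inner_comm]
  exact h

theorem inner_act_pos {M : Mat k k} (hM : M.PosDef) {v : Vec k} (hv : v ≠ 0) :
    0 < inner ℝ v (M *ₑ v) := by
  have h := (Matrix.posDef_iff_dotProduct_mulVec.1 hM).2 (x := v.ofLp)
    (fun h => hv (by ext i; simpa using congrFun h i))
  rw [EuclideanSpace.inner_eq_star_dotProduct, dotProduct_comm]
  simpa [act, Matrix.toLpLin_apply] using h

theorem exists_unit_eigenvector {M : Mat k k} {l : ℝ} (hl : l ∈ spectrum ℝ M) :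
    ∃ v : Vec k, ‖v‖ = 1 ∧ M *ₑ v = l • v := by
  rw [← Matrix.spectrum_toLpLin 2, ← Module.End.hasEigenvalue_iff_mem_spectrum] at hl
  obtain ⟨v, hv⟩ := hl.exists_hasEigenvector
  have hv0 : ‖v‖ ≠ 0 := norm_ne_zero_iff.2 hv.2
  refine ⟨‖v‖⁻¹ • v, by rw [norm_smul, norm_inv, norm_norm, inv_mul_cancel₀ hv0], ?_⟩
  rw [act_smul, show M *ₑ v = l • v from hv.apply_eq_smul, smul_comm]

theorem mem_spectrum_abs_le {M : Mat k k} {l : ℝ} (hl : l ∈ spectrum ℝ M) : |l| ≤ ‖M‖ := by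
  obtain ⟨v, hv, h⟩ := exists_unit_eigenvector hl
  have := norm_act_le M v
  rwa [h, norm_smul, hv, mul_one, mul_one, Real.norm_eq_abs] at this

theorem spectrum_nonempty_of_hermitian (hk : 0 < k) {M : Mat k k} (hM : M.IsHermitian) :
    (spectrum ℝ M).Nonempty :=
  ⟨hM.eigenvalues ⟨0, hk⟩, hM.eigenvalues_mem_spectrum_real _⟩

/-- Shifting `M` by `c` shifts the spectrum, so `M - c` is positive semidefinite. -/
theorem le_inner_act_of_le_spectrum {M : Mat k k} (hM : M.IsHermitian) {c : ℝ}
    (h : ∀ l ∈ spectrum ℝ M, c ≤ l) (v : Vec k) : c * ‖v‖ ^ 2 ≤ inner ℝ v (M *ₑ v) := by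
  have hp : (M - algebraMap ℝ (Mat k k) c).PosSemidef := by
    refine Matrix.posSemidef_iff_isHermitian_and_spectrum_nonneg.2 ⟨hM.sub ?_, ?_⟩
    · rw [Algebra.algebraMap_eq_smul_one]
      simp [Matrix.IsHermitian]
    · rw [← spectrum.sub_singleton_eq]
      rintro _ ⟨l, hl, _, rfl, rfl⟩
      simpa using h l hl
  have := inner_act_nonneg hp v
  rw [sub_act, inner_sub_right, Algebra.algebraMap_eq_smul_one, smul_act, one_act,
    inner_smul_right, real_inner_self_eq_norm_sq] at this
  linarith

theorem inner_act_le_of_spectrum_le {M : Mat k k} (hM : M.IsHermitian) {c : ℝ}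
    (h : ∀ l ∈ spectrum ℝ M, l ≤ c) (v : Vec k) : inner ℝ v (M *ₑ v) ≤ c * ‖v‖ ^ 2 := by
  have := le_inner_act_of_le_spectrum (c := -c) hM.neg (fun l hl => by
    rw [← spectrum.neg_eq, Set.mem_neg] at hl
    linarith [h _ hl]) v
  rw [neg_act, inner_neg_right] at this
  linarith

theorem bddAbove_spectrum (hΘ : IsCompact Θ) (hP : ContinuousOn P Θ) :
    BddAbove {l : ℝ | ∃ θ ∈ Θ, l ∈ spectrum ℝ (P θ)} := by
  refine ⟨maxNorm Θ P, ?_⟩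
  rintro l ⟨θ, hθ, hl⟩
  exact (le_abs_self l).trans ((mem_spectrum_abs_le hl).trans (norm_le_maxNorm hΘ hP hθ))

theorem bddBelow_spectrum (hΘ : IsCompact Θ) (hP : ContinuousOn P Θ) :
    BddBelow {l : ℝ | ∃ θ ∈ Θ, l ∈ spectrum ℝ (P θ)} := by
  refine ⟨-maxNorm Θ P, ?_⟩
  rintro l ⟨θ, hθ, hl⟩
  exact neg_le.1 ((neg_le_abs l).trans
    ((mem_spectrum_abs_le hl).trans (norm_le_maxNorm hΘ hP hθ)))

theorem lamMin_mul_le (hΘ : IsCompact Θ) (hP : ContinuousOn P Θ) {θ : Vec s} (hθ : θ ∈ Θ)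
    (hpos : (P θ).PosDef) (v : Vec k) : lamMin Θ P * ‖v‖ ^ 2 ≤ inner ℝ v (P θ *ₑ v) :=
  le_inner_act_of_le_spectrum hpos.1
    (fun _ hl => csInf_le (bddBelow_spectrum hΘ hP) ⟨θ, hθ, hl⟩) v

theorem le_lamMax_mul (hΘ : IsCompact Θ) (hP : ContinuousOn P Θ) {θ : Vec s} (hθ : θ ∈ Θ)
    (hpos : (P θ).PosDef) (v : Vec k) : inner ℝ v (P θ *ₑ v) ≤ lamMax Θ P * ‖v‖ ^ 2 :=
  inner_act_le_of_spectrum_le hpos.1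
    (fun _ hl => le_csSup (bddAbove_spectrum hΘ hP) ⟨θ, hθ, hl⟩) v

/-- The quadratic form attains a positive minimum on the compact product of `Θ` and the unit sphere,
and every eigenvalue is its value at a unit eigenvector. For `k = 0` there are no eigenvalues and
`lamMin` takes the default value `0`, hence `0 < k`. -/
theorem lamMin_pos (hk : 0 < k) (hΘ : IsCompact Θ) (hne : Θ.Nonempty) (hP : ContinuousOn P Θ)
    (hpos : ∀ θ ∈ Θ, (P θ).PosDef) : 0 < lamMin Θ P := by
  obtain ⟨θ₀, hθ₀⟩ := hne
  obtain ⟨l₀, hl₀⟩ := spectrum_nonempty_of_hermitian hk (hpos θ₀ hθ₀).1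
  obtain ⟨v₀, hv₀, -⟩ := exists_unit_eigenvector hl₀
  have hcomp : IsCompact (Θ ×ˢ Metric.sphere (0 : Vec k) 1) := hΘ.prod (isCompact_sphere _ _)
  have hcont : ContinuousOn (fun z : Vec s × Vec k => inner ℝ z.2 (P z.1 *ₑ z.2))
      (Θ ×ˢ Metric.sphere (0 : Vec k) 1) := by
    refine continuousOn_snd.inner (𝕜 := ℝ) ?_
    exact (hP.comp continuousOn_fst fun z hz => hz.1).act continuousOn_snd
  obtain ⟨⟨θ₁, v₁⟩, ⟨hθ₁, hv₁⟩, hmin⟩ :=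
    hcomp.exists_isMinOn ⟨(θ₀, v₀), hθ₀, by simpa using hv₀⟩ hcont
  have hv1 : v₁ ≠ 0 := by
    rintro rfl
    simp at hv₁
  have hc := inner_act_pos (hpos θ₁ hθ₁) hv1
  refine hc.trans_le (le_csInf ⟨l₀, θ₀, hθ₀, hl₀⟩ ?_)
  rintro l ⟨θ, hθ, hl⟩
  obtain ⟨v, hv, h⟩ := exists_unit_eigenvector hl
  have h1 := hmin (show (θ, v) ∈ _ from ⟨hθ, by simpa using hv⟩)
  simp only [mem_ofPred_eq, h, inner_smul_right, real_inner_self_eq_norm_sq, hv] at h1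
  simpa using h1

theorem lamMin_le_lamMax (hk : 0 < k) (hΘ : IsCompact Θ) (hne : Θ.Nonempty)
    (hP : ContinuousOn P Θ) (hpos : ∀ θ ∈ Θ, (P θ).PosDef) : lamMin Θ P ≤ lamMax Θ P := by
  obtain ⟨θ₀, hθ₀⟩ := hne
  obtain ⟨l₀, hl₀⟩ := spectrum_nonempty_of_hermitian hk (hpos θ₀ hθ₀).1
  exact (csInf_le (bddBelow_spectrum hΘ hP) ⟨θ₀, hθ₀, hl₀⟩).trans
    (le_csSup (bddAbove_spectrum hΘ hP) ⟨θ₀, hθ₀, hl₀⟩)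

theorem lamMin_nonneg (hpos : ∀ θ ∈ Θ, (P θ).PosDef) : 0 ≤ lamMin Θ P := by
  refine Real.sInf_nonneg ?_
  rintro l ⟨θ, hθ, hl⟩
  obtain ⟨v, hv, h⟩ := exists_unit_eigenvector hl
  have := inner_act_nonneg (hpos θ hθ).posSemidef v
  rw [h, inner_smul_right, real_inner_self_eq_norm_sq, hv] at this
  simpa using this

end Eigen

/-! ### Decay estimates from a parameter-dependent Lyapunov function -/

namespace IsLyapunov

variable {s k : ℕ} {S : ParamBox s} {A P : Vec s → Mat k k} {μ : ℝ} {θ : ℝ → Vec s}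

theorem continuousOn (h : IsLyapunov S A P μ) : ContinuousOn P S.Θ := by
  obtain ⟨-, -, dP, hdP⟩ := h
  exact fun θ hθ => (hdP θ hθ).1.continuousWithinAt

/-- Along a trajectory of `ẋ = A(θ)x + w` the quadratic form `xᵀP(θ)x` has a right derivative
bounded by `-μ xᵀP(θ)x + 2 xᵀP(θ)w`. -/
theorem exists_deriv_quad (h : IsLyapunov S A P μ) (hθ : S.Admissible θ) {t : ℝ} (ht : 0 ≤ t)
    {x : ℝ → Vec k} {w : Vec k} (hx : HasDerivWithinAt x (A (θ t) *ₑ x t + w) (Ici t) t) :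
    ∃ d : ℝ, HasDerivWithinAt (fun t => inner ℝ (x t) (P (θ t) *ₑ x t)) d (Ici t) t ∧
      d ≤ -μ * inner ℝ (x t) (P (θ t) *ₑ x t) + 2 * inner ℝ (x t) (P (θ t) *ₑ w) := by
  obtain ⟨-, hpos, dP, hdP⟩ := h
  obtain ⟨hm, v, hv, hd⟩ := hθ t ht
  obtain ⟨hP, hL⟩ := hdP _ hm
  have hPθ : HasDerivWithinAt (fun t => P (θ t)) (dP (θ t) v) (Ici t) t :=
    (hP.comp_hasDerivWithinAt t hd (fun r hr => (hθ r hr).1)).mono (Ici_subset_Ici.2 ht)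
  have hq := hx.inner ℝ (hasDerivWithinAt_act hPθ hx)
  refine ⟨_, hq, ?_⟩
  have hsym : (P (θ t))ᵀ = P (θ t) := by
    have := (hpos _ hm).1
    rwa [Matrix.IsHermitian, Matrix.conjTranspose_eq_transpose_of_trivial] at this
  have hn := inner_act_nonneg (hL v hv) (x t)
  have e1 : ∀ z : Vec k, inner ℝ z (P (θ t) *ₑ x t) = inner ℝ (x t) (P (θ t) *ₑ z) := fun z => by
    rw [real_inner_comm, inner_act_left, hsym]
  simp only [symm, sub_act, add_act, neg_act, smul_act, inner_sub_right, inner_add_right,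
    inner_neg_right, inner_smul_right, Matrix.transpose_mul, Matrix.transpose_transpose, hsym,
    mul_act] at hn
  have e2 : inner ℝ (x t) ((A (θ t))ᵀ *ₑ P (θ t) *ₑ x t) =
      inner ℝ (x t) (P (θ t) *ₑ A (θ t) *ₑ x t) := by
    rw [← inner_act_left, e1]
  rw [inner_add_right, e1, act_add, inner_add_right]
  linarith

/-- Decay of `√(xᵀP(θ)x)` along `ẋ = A(θ)x + w`. -/
theorem quad_le (h : IsLyapunov S A P μ) (hk : 0 < k) (hθ : S.Admissible θ) {t₀ t₁ : ℝ}
    (ht₀ : 0 ≤ t₀) {x w : ℝ → Vec k} (hxc : ContinuousOn x (Icc t₀ t₁))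
    (hx : ∀ t ∈ Ico t₀ t₁, HasDerivWithinAt x (A (θ t) *ₑ x t + w t) (Ici t) t)
    {c : ℝ} (hc : 0 ≤ c) (hw : ∀ t ∈ Ico t₀ t₁, ‖P (θ t) *ₑ w t‖ ≤ c) {W₀ : ℝ} (hW₀ : 0 ≤ W₀)
    (h₀ : inner ℝ (x t₀) (P (θ t₀) *ₑ x t₀) ≤ W₀ ^ 2) {t : ℝ} (ht : t ∈ Icc t₀ t₁) :
    inner ℝ (x t) (P (θ t) *ₑ x t) ≤ (Real.exp (-(μ / 2 * (t - t₀))) * W₀ +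
      2 / μ * (1 - Real.exp (-(μ / 2 * (t - t₀)))) * (c / √(lamMin S.Θ P))) ^ 2 := by
  have hμ := h.1
  have hΘ := S.isCompact
  have hPc := h.continuousOn
  have hne : S.Θ.Nonempty := ⟨_, (hθ 0 le_rfl).1⟩
  have hl := lamMin_pos hk hΘ hne hPc h.2.1
  set d := c / √(lamMin S.Θ P) with hd
  have hd0 : 0 ≤ d := by positivity
  -- `W ε` solves `W' = -(μ/2) W + (d + ε)`, the equation that dominates `√(xᵀPx)`. The surplus `ε`
  -- keeps `W ε` positive and makes the comparison strict; the limit `ε → 0` gives the claim.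
  let W : ℝ → ℝ → ℝ := fun ε t => Real.exp (-(μ / 2 * (t - t₀))) * (W₀ + ε) +
      2 / μ * (1 - Real.exp (-(μ / 2 * (t - t₀)))) * (d + ε)
  suffices hε : ∀ ε, 0 < ε → inner ℝ (x t) (P (θ t) *ₑ x t) ≤ (W ε t) ^ 2 by
    have hlim : Tendsto (fun ε => (W ε t) ^ 2) (𝓝[>] 0) (𝓝 ((W 0 t) ^ 2)) := by
      refine Tendsto.mono_left ?_ nhdsWithin_le_nhds
      have : Continuous fun ε => (W ε t) ^ 2 := by fun_prop
      exact this.tendsto 0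
    have := ge_of_tendsto hlim (eventually_nhdsWithin_of_forall hε)
    simpa [W] using this
  intro ε hε
  have hdW : ∀ t, HasDerivAt (W ε) (-(μ / 2) * W ε t + (d + ε)) t := by
    intro t
    have h1 : HasDerivAt (fun t => Real.exp (-(μ / 2 * (t - t₀))))
        (Real.exp (-(μ / 2 * (t - t₀))) * (-(μ / 2))) t := by
      have : HasDerivAt (fun t => -(μ / 2 * (t - t₀))) (-(μ / 2)) t := by
        have h0 := ((hasDerivAt_id t).sub_const t₀).const_mul (-(μ / 2))
        simp only [mul_one, id, neg_mul] at h0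
        exact h0
      exact this.exp
    have h2 := (h1.mul_const (W₀ + ε)).add (((h1.const_sub 1).const_mul (2 / μ)).mul_const (d + ε))
    refine h2.congr_deriv ?_
    simp only [W]
    field_simp
    ring
  have hWpos : ∀ t ∈ Icc t₀ t₁, 0 < W ε t := by
    intro t ht
    have h1 : Real.exp (-(μ / 2 * (t - t₀))) ≤ 1 := by
      rw [Real.exp_le_one_iff, neg_nonpos]
      exact mul_nonneg (by positivity) (sub_nonneg.2 ht.1)
    have h2 : 0 ≤ 1 - Real.exp (-(μ / 2 * (t - t₀))) := by linarith
    simp only [W]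
    positivity
  have hxq : ∀ t ∈ Ico t₀ t₁, ∃ D : ℝ,
      HasDerivWithinAt (fun t => inner ℝ (x t) (P (θ t) *ₑ x t)) D (Ici t) t ∧
      D ≤ -μ * inner ℝ (x t) (P (θ t) *ₑ x t) + 2 * inner ℝ (x t) (P (θ t) *ₑ w t) :=
    fun t ht => h.exists_deriv_quad hθ (ht₀.trans ht.1) (hx t ht)
  choose! D hD using hxq
  have hθc : ContinuousOn (fun t => P (θ t)) (Icc t₀ t₁) :=
    hPc.comp (hθ.continuousOn.mono fun t ht => ht₀.trans ht.1) fun t ht => (hθ t (ht₀.trans ht.1)).1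
  refine image_le_of_deriv_right_lt_deriv_boundary' (hxc.inner (𝕜 := ℝ) (hθc.act hxc))
    (fun t ht => (hD t ht).1) (B := fun t => W ε t ^ 2)
    (B' := fun t => 2 * W ε t * (-(μ / 2) * W ε t + (d + ε))) ?_ ?_ ?_ ?_ ht
  · refine h₀.trans ?_
    simp only [W, sub_self, mul_zero, neg_zero, Real.exp_zero, one_mul, zero_mul, add_zero]
    gcongr
    linarith
  · exact fun t _ => ((hdW t).continuousAt.pow 2).continuousWithinAt
  · intro t _
    have := (hdW t).pow 2
    simp only [Nat.cast_ofNat, Nat.add_one_sub_one, pow_one] at this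
    exact this.hasDerivWithinAt
  -- Strictness is needed only where the two curves touch. There `√λ_min ‖x‖ ≤ W`, so the forcing
  -- contributes at most `2 W d`, and `ε` supplies the gap.
  · intro t ht hEq
    have hEq : inner ℝ (x t) (P (θ t) *ₑ x t) = W ε t ^ 2 := hEq
    have hp := hWpos t (Ico_subset_Icc_self ht)
    have hm := (hθ t (ht₀.trans ht.1)).1
    have h1 := lamMin_mul_le hΘ hPc hm (h.2.1 _ hm) (x t)
    have h2 : √(lamMin S.Θ P) * ‖x t‖ ≤ W ε t := by
      refine abs_le_of_sq_le_sq' ?_ hp.le |>.2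
      rw [mul_pow, Real.sq_sqrt hl.le]
      linarith
    have h3 : inner ℝ (x t) (P (θ t) *ₑ w t) ≤ ‖x t‖ * c :=
      (real_inner_le_norm _ _).trans (mul_le_mul_of_nonneg_left (hw t ht) (norm_nonneg _))
    have h4 : ‖x t‖ * c ≤ W ε t * d := by
      have hs : 0 < √(lamMin S.Θ P) := Real.sqrt_pos.2 hl
      calc ‖x t‖ * c = (√(lamMin S.Θ P) * ‖x t‖) * d := by rw [hd]; field_simp
        _ ≤ W ε t * d := mul_le_mul_of_nonneg_right h2 hd0
    have h5 := (hD t ht).2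
    rw [hEq] at h5
    nlinarith [mul_pos hp hε]

/-- The state of `ẋ = A(θ)x + w` in terms of an earlier state and of a bound on `P(θ)w`. -/
theorem norm_le (h : IsLyapunov S A P μ) (hθ : S.Admissible θ) {t₀ t₁ : ℝ}
    (ht₀ : 0 ≤ t₀) {x w : ℝ → Vec k} (hxc : ContinuousOn x (Icc t₀ t₁))
    (hx : ∀ t ∈ Ico t₀ t₁, HasDerivWithinAt x (A (θ t) *ₑ x t + w t) (Ici t) t)
    {c : ℝ} (hc : 0 ≤ c) (hw : ∀ t ∈ Ico t₀ t₁, ‖P (θ t) *ₑ w t‖ ≤ c)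
    {t : ℝ} (ht : t ∈ Icc t₀ t₁) :
    ‖x t‖ ≤ √(lamMax S.Θ P / lamMin S.Θ P) * ‖x t₀‖ +
      2 / (μ * lamMin S.Θ P) * √(1 - Real.exp (-(μ * (t - t₀)))) * c := by
  have hμ := h.1
  have hn := lamMin_nonneg h.2.1
  rcases Nat.eq_zero_or_pos k with rfl | hk
  · rw [Subsingleton.elim (x t) 0, norm_zero]
    positivity
  have hΘ := S.isCompact
  have hPc := h.continuousOn
  have hne : S.Θ.Nonempty := ⟨_, (hθ 0 le_rfl).1⟩
  have hl := lamMin_pos hk hΘ hne hPc h.2.1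
  have hlm := lamMin_le_lamMax hk hΘ hne hPc h.2.1
  have hm₀ := (hθ t₀ ht₀).1
  have hm := (hθ t (ht₀.trans ht.1)).1
  have hq := h.quad_le hk hθ ht₀ hxc hx hc hw (W₀ := √(lamMax S.Θ P) * ‖x t₀‖) (by positivity)
    (by rw [mul_pow, Real.sq_sqrt (hl.le.trans hlm)]
        exact le_lamMax_mul hΘ hPc hm₀ (h.2.1 _ hm₀) _) ht
  set e := Real.exp (-(μ / 2 * (t - t₀))) with he
  have he0 : 0 < e := Real.exp_pos _
  have he1 : e ≤ 1 := by
    rw [he, Real.exp_le_one_iff, neg_nonpos]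
    exact mul_nonneg (by positivity) (sub_nonneg.2 ht.1)
  have hee : Real.exp (-(μ * (t - t₀))) = e ^ 2 := by
    rw [he, ← Real.exp_nat_mul]; congr 1; push_cast; ring
  rw [hee]
  -- As `0 ≤ e ≤ 1`, `(1 - e)² ≤ 1 - e²`; this gives up sharpness for the square root that occurs in
  -- `beta`.
  have hsq : 1 - e ≤ √(1 - e ^ 2) := Real.le_sqrt_of_sq_le (by nlinarith)
  have hlow := (lamMin_mul_le hΘ hPc hm (h.2.1 _ hm) (x t)).trans hq
  have hs : 0 < √(lamMin S.Θ P) := Real.sqrt_pos.2 hl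
  have h1 : √(lamMin S.Θ P) * ‖x t‖ ≤ e * (√(lamMax S.Θ P) * ‖x t₀‖) +
      2 / μ * (1 - e) * (c / √(lamMin S.Θ P)) := by
    refine abs_le_of_sq_le_sq' ?_ ?_ |>.2
    · rw [mul_pow, Real.sq_sqrt hl.le]; exact hlow
    · have : 0 ≤ 1 - e := by linarith
      positivity
  have h2 : e * (√(lamMax S.Θ P) * ‖x t₀‖) ≤ √(lamMax S.Θ P) * ‖x t₀‖ :=
    mul_le_of_le_one_left (by positivity) he1
  have h3 : 2 / μ * (1 - e) * (c / √(lamMin S.Θ P)) ≤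
      2 / μ * √(1 - e ^ 2) * (c / √(lamMin S.Θ P)) := by gcongr
  have h4 : ‖x t‖ ≤ (√(lamMax S.Θ P) * ‖x t₀‖ + 2 / μ * √(1 - e ^ 2) *
      (c / √(lamMin S.Θ P))) / √(lamMin S.Θ P) := by
    rw [le_div_iff₀ hs, mul_comm]; linarith
  refine h4.trans (le_of_eq ?_)
  rw [Real.sqrt_div (hl.le.trans hlm)]
  have hl' : lamMin S.Θ P = √(lamMin S.Θ P) * √(lamMin S.Θ P) :=
    (Real.mul_self_sqrt hl.le).symm
  set r := √(lamMin S.Θ P)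
  rw [hl']
  field_simp

end IsLyapunov

theorem one_le_sqrt_lam_ratio {s k : ℕ} {S : ParamBox s} {A P : Vec s → Mat k k} {μ : ℝ}
    (h : IsLyapunov S A P μ) (hne : S.Θ.Nonempty) (hk : 0 < k) :
    1 ≤ √(lamMax S.Θ P / lamMin S.Θ P) := by
  have hl := lamMin_pos hk S.isCompact hne h.continuousOn h.2.1
  rw [Real.one_le_sqrt, one_le_div hl]
  exact lamMin_le_lamMax hk S.isCompact hne h.continuousOn h.2.1

theorem beta_nonneg {s k a : ℕ} {S : ParamBox s} {A P : Vec s → Mat k k} {μ : ℝ}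
    (h : IsLyapunov S A P μ) (e : ℝ) (B : Vec s → Mat k a) : 0 ≤ beta S.Θ e μ P B := by
  have := h.1
  have := lamMin_nonneg h.2.1
  have := maxNorm_nonneg S.Θ (fun θ => P θ * B θ)
  unfold beta
  positivity

/-- The response of `ẋ = A(θ)x + B(θ)v` to an input bounded by `b` on `[t₀, t₁)`. -/
theorem IsLyapunov.norm_le_beta {s k a : ℕ} {S : ParamBox s} {A P : Vec s → Mat k k} {μ : ℝ}
    {B : Vec s → Mat k a} {θ : ℝ → Vec s}
    (h : IsLyapunov S A P μ) (hB : ContinuousOn B S.Θ) (hθ : S.Admissible θ) {t₀ t₁ : ℝ}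
    (ht₀ : 0 ≤ t₀) {x : ℝ → Vec k} {v : ℝ → Vec a} (hxc : ContinuousOn x (Icc t₀ t₁))
    (hx : ∀ t ∈ Ico t₀ t₁, HasDerivWithinAt x (A (θ t) *ₑ x t + B (θ t) *ₑ v t) (Ici t) t)
    {b : ℝ} (hb : 0 ≤ b) (hv : ∀ t ∈ Ico t₀ t₁, ‖v t‖ ≤ b) {e : ℝ}
    {t : ℝ} (ht : t ∈ Icc t₀ t₁) (he : e ≤ Real.exp (-(μ * (t - t₀)))) :
    ‖x t‖ ≤ √(lamMax S.Θ P / lamMin S.Θ P) * ‖x t₀‖ + beta S.Θ e μ P B * b := by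
  have hμ := h.1
  have hn := lamMin_nonneg h.2.1
  have hβ := beta_nonneg h e B
  rcases Nat.eq_zero_or_pos k with rfl | hk
  · rw [Subsingleton.elim (x t) 0, norm_zero]
    positivity
  have hM := maxNorm_nonneg S.Θ (fun θ => P θ * B θ)
  have hne : S.Θ.Nonempty := ⟨_, (hθ 0 le_rfl).1⟩
  have h1 := h.norm_le hθ ht₀ hxc hx (c := maxNorm S.Θ (fun θ => P θ * B θ) * b) (by positivity)
    (fun r hr => by
      rw [← mul_act]
      refine norm_act_le_of_le ?_ (hv r hr)
      refine norm_le_maxNorm (F := fun θ => P θ * B θ) S.isCompact ?_ (hθ r (ht₀.trans hr.1)).1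
      exact h.continuousOn.mat_mul hB) ht
  refine h1.trans (add_le_add le_rfl ?_)
  have hE1 : Real.exp (-(μ * (t - t₀))) ≤ 1 := by
    rw [Real.exp_le_one_iff, neg_nonpos]
    exact mul_nonneg hμ.le (sub_nonneg.2 ht.1)
  -- `beta` has an additional factor at least one under its root, and `e` may be smaller than the
  -- true exponential; both only enlarge the bound.
  have hr := one_le_sqrt_lam_ratio h hne hk
  have h2 : √(1 - Real.exp (-(μ * (t - t₀)))) ≤
      √(√(lamMax S.Θ P / lamMin S.Θ P) * (1 - e)) := by
    refine Real.sqrt_le_sqrt ?_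
    nlinarith
  unfold beta
  calc 2 / (μ * lamMin S.Θ P) * √(1 - Real.exp (-(μ * (t - t₀)))) *
        (maxNorm S.Θ (fun θ => P θ * B θ) * b)
      ≤ 2 / (μ * lamMin S.Θ P) * √(√(lamMax S.Θ P / lamMin S.Θ P) * (1 - e)) *
        (maxNorm S.Θ (fun θ => P θ * B θ) * b) := by gcongr
    _ = _ := by ring

/-! ### Existence and uniqueness for linear equations -/

theorem integral_exp_mul_le {Λ t : ℝ} (hΛ : 0 < Λ) :
    ∫ s in (0 : ℝ)..t, Real.exp (Λ * s) ≤ Real.exp (Λ * t) / Λ := by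
  rw [intervalIntegral.integral_comp_mul_left (fun s => Real.exp s) hΛ.ne', integral_exp]
  simp only [mul_zero, Real.exp_zero, smul_eq_mul]
  rw [inv_mul_eq_div]
  gcongr
  linarith

/-- Global existence for `ẋ = A(t)x + b(t)`, `x(0) = 0`, with `A` continuous and bounded and `b`
locally integrable. -/
theorem exists_isSolution {k : ℕ} {A : ℝ → Mat k k} (hA : Continuous A) {M : ℝ}
    (hM : ∀ t, ‖A t‖ ≤ M) {b : ℝ → Vec k} (hb : ∀ t, 0 ≤ t → IntervalIntegrable b volume 0 t) :
    ∃ x : ℝ → Vec k, IsSolution x 0 fun t => A t *ₑ x t + b t := by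
  have hM0 : 0 ≤ M := (norm_nonneg _).trans (hM 0)
  -- Chosen with `M / Λ ≤ 1/2`, which becomes the contraction constant.
  set Λ : ℝ := 2 * (M + 1) with hΛ
  have hΛ0 : 0 < Λ := by positivity
  have hp : Continuous fun t : ℝ => max t 0 := by fun_prop
  have hcc : ∀ {E : Type} [NormedAddCommGroup E] {g : ℝ → E}, ContinuousOn g (Ici 0) →
      Continuous fun t => g (max t 0) := fun {E _ g} hg =>
    continuousOn_univ.1 (hg.comp hp.continuousOn fun t _ => le_max_right t 0)
  have hprim : ∀ {E : Type} [NormedAddCommGroup E] [NormedSpace ℝ E] {g : ℝ → E},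
      (∀ t, 0 ≤ t → IntervalIntegrable g volume 0 t) →
      ContinuousOn (fun t => ∫ s in (0 : ℝ)..t, g s) (Ici 0) := by
    intro E _ _ g hg t ht
    have ht : 0 ≤ t := ht
    have ht1 : (0 : ℝ) ≤ t + 1 := by linarith
    have := intervalIntegral.continuousOn_primitive_interval' (hg (t + 1) ht1) left_mem_uIcc
    rw [uIcc_of_le ht1] at this
    refine (this t ⟨ht, by linarith⟩).mono_of_mem_nhdsWithin ?_
    filter_upwards [self_mem_nhdsWithin, mem_nhdsWithin_of_mem_nhds (Iio_mem_nhds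
      (lt_add_one t))] with s h1 h2 using ⟨h1, le_of_lt h2⟩
  set w : ℝ → Vec k := fun t => ∫ s in (0 : ℝ)..t, b s with hw
  set W : ℝ → ℝ := fun t => ∫ s in (0 : ℝ)..t, ‖b s‖ with hW
  have hWc : Continuous fun t => W (max t 0) := hcc (hprim fun t ht => (hb t ht).norm)
  have hwc : Continuous fun t => w (max t 0) := hcc (hprim hb)
  have hW0 : ∀ t, 0 ≤ t → 0 ≤ W t := fun t ht =>
    intervalIntegral.integral_nonneg ht fun _ _ => norm_nonneg _
  have hWmono : ∀ s t, 0 ≤ s → s ≤ t → W s ≤ W t := fun s t hs hst => by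
    have : W t - W s = ∫ r in s..t, ‖b r‖ :=
      intervalIntegral.integral_interval_sub_left (hb t (hs.trans hst)).norm (hb s hs).norm
    have h2 : 0 ≤ ∫ r in s..t, ‖b r‖ :=
      intervalIntegral.integral_nonneg hst fun _ _ => norm_nonneg _
    linarith
  have hwW : ∀ t, 0 ≤ t → ‖w t‖ ≤ W t := fun t ht =>
    intervalIntegral.norm_integral_le_integral_norm ht
  -- The weight in `x = Φ z` with `z` bounded: the exponential makes the Picard operator a
  -- contraction on the whole half-line at once, and `1 + W` absorbs the growth of the primitive of
  -- `b`.
  set Φ : ℝ → ℝ := fun t => Real.exp (Λ * max t 0) * (1 + W (max t 0)) with hΦ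
  have hΦc : Continuous Φ := by
    have : Continuous fun t : ℝ => Real.exp (Λ * max t 0) := by fun_prop
    exact this.mul (continuous_const.add hWc)
  have hWΦ : ∀ t, W (max t 0) + 1 ≤ Φ t := fun t => by
    have h1 : 1 ≤ Real.exp (Λ * max t 0) := Real.one_le_exp (by positivity)
    have h2 := hW0 (max t 0) (le_max_right _ _)
    simp only [hΦ]; nlinarith
  have hΦpos : ∀ t, 0 < Φ t := fun t => by
    have := hWΦ t
    have := hW0 (max t 0) (le_max_right _ _)
    linarith
  have hIΦ : ∀ t, 0 ≤ t → ∫ s in (0 : ℝ)..t, Φ s ≤ Φ t / Λ := fun t ht => by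
    have h1 : ∫ s in (0 : ℝ)..t, Φ s ≤ ∫ s in (0 : ℝ)..t, Real.exp (Λ * s) * (1 + W t) := by
      refine intervalIntegral.integral_mono_on ht (hΦc.intervalIntegrable _ _)
        (Continuous.intervalIntegrable (by fun_prop) _ _) fun s hs => ?_
      simp only [hΦ, max_eq_left hs.1]
      gcongr
      exact hWmono s t hs.1 hs.2
    refine h1.trans ?_
    rw [intervalIntegral.integral_mul_const]
    have h2 := integral_exp_mul_le (t := t) hΛ0
    have h3 := hW0 t ht
    calc (∫ s in (0 : ℝ)..t, Real.exp (Λ * s)) * (1 + W t)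
        ≤ Real.exp (Λ * t) / Λ * (1 + W t) := by gcongr
      _ = Φ t / Λ := by simp only [hΦ, max_eq_left ht]; ring
  have hint : ∀ z : BoundedContinuousFunction ℝ (Vec k),
      Continuous fun s => A s *ₑ (Φ s • z s) := fun z => hA.act (hΦc.smul z.continuous)
  have hIb : ∀ z : BoundedContinuousFunction ℝ (Vec k), ∀ t, 0 ≤ t →
      ‖∫ s in (0 : ℝ)..t, A s *ₑ (Φ s • z s)‖ ≤ Φ t * (‖z‖ / 2) := fun z t ht => by
    have h1 : ‖∫ s in (0 : ℝ)..t, A s *ₑ (Φ s • z s)‖ ≤ ∫ s in (0 : ℝ)..t, Φ s * (M * ‖z‖) := by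
      refine intervalIntegral.norm_integral_le_of_norm_le ht (ae_of_all _ fun s _ => ?_)
        ((hΦc.mul continuous_const).intervalIntegrable _ _)
      refine (norm_act_le_of_le (hM s) (b := Φ s * ‖z‖) ?_).trans (le_of_eq (by ring))
      rw [norm_smul, Real.norm_of_nonneg (hΦpos s).le]
      exact mul_le_mul_of_nonneg_left (z.norm_coe_le_norm s) (hΦpos s).le
    refine h1.trans ?_
    rw [intervalIntegral.integral_mul_const]
    have h2 := hIΦ t ht
    have h3 : M / Λ ≤ 1 / 2 := by
      rw [div_le_iff₀ hΛ0]; linarith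
    calc (∫ s in (0 : ℝ)..t, Φ s) * (M * ‖z‖) ≤ Φ t / Λ * (M * ‖z‖) := by gcongr
      _ = Φ t * (M / Λ * ‖z‖) := by ring
      _ ≤ Φ t * (1 / 2 * ‖z‖) := by have := (hΦpos t).le; gcongr
      _ = _ := by ring
  have hΦp : ∀ t, Φ (max t 0) = Φ t := fun t => by simp [hΦ]
  let T : BoundedContinuousFunction ℝ (Vec k) → BoundedContinuousFunction ℝ (Vec k) := fun z =>
    BoundedContinuousFunction.ofNormedAddCommGroup
      (fun t => (Φ t)⁻¹ • (w (max t 0) + ∫ s in (0 : ℝ)..(max t 0), A s *ₑ (Φ s • z s)))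
      ((hΦc.inv₀ fun t => (hΦpos t).ne').smul
        (hwc.add ((intervalIntegral.continuous_primitive
          (fun a b => (hint z).intervalIntegrable a b) 0).comp hp)))
      (1 + ‖z‖ / 2) (fun t => by
        have h0 : (0 : ℝ) ≤ max t 0 := le_max_right _ _
        rw [norm_smul, norm_inv, Real.norm_of_nonneg (hΦpos t).le, inv_mul_le_iff₀ (hΦpos t)]
        have h1 := hIb z _ h0
        rw [hΦp] at h1
        have h2 := hwW _ h0
        have h3 := hWΦ t
        calc _ ≤ _ := norm_add_le _ _
          _ ≤ Φ t + Φ t * (‖z‖ / 2) := by linarith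
          _ = _ := by ring)
  have hT : ContractingWith (1 / 2) T := by
    refine ⟨by rw [← NNReal.coe_lt_coe]; norm_num, LipschitzWith.of_dist_le_mul fun z z' => ?_⟩
    have h0 : 0 ≤ ‖z - z'‖ := norm_nonneg _
    rw [dist_eq_norm, dist_eq_norm, BoundedContinuousFunction.norm_le (by positivity)]
    intro t
    have ht0 : (0 : ℝ) ≤ max t 0 := le_max_right _ _
    have h1 : (T z - T z') t = (Φ t)⁻¹ •
        ∫ s in (0 : ℝ)..(max t 0), A s *ₑ (Φ s • (z - z') s) := by
      simp only [T, BoundedContinuousFunction.sub_apply,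
        BoundedContinuousFunction.coe_ofNormedAddCommGroup, ← smul_sub, add_sub_add_left_eq_sub]
      rw [← intervalIntegral.integral_sub ((hint z).intervalIntegrable _ _)
        ((hint z').intervalIntegrable _ _)]
      simp only [smul_sub, act_sub]
    rw [h1, norm_smul, norm_inv, Real.norm_of_nonneg (hΦpos t).le, inv_mul_le_iff₀ (hΦpos t)]
    have h2 := hIb (z - z') _ ht0
    rw [hΦp] at h2
    refine h2.trans (le_of_eq ?_)
    push_cast
    ring
  set z := ContractingWith.fixedPoint T hT with hz
  have hfix : T z = z := hT.fixedPoint_isFixedPt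
  refine ⟨fun t => Φ t • z t, fun t ht => ⟨((hint z).intervalIntegrable _ _).add (hb t ht), ?_⟩⟩
  have h1 : z t = (Φ t)⁻¹ • (w t + ∫ s in (0 : ℝ)..t, A s *ₑ (Φ s • z s)) := by
    conv_lhs => rw [← hfix]
    simp only [T, BoundedContinuousFunction.coe_ofNormedAddCommGroup, max_eq_left ht]
  beta_reduce
  rw [intervalIntegral.integral_add ((hint z).intervalIntegrable _ _) (hb t ht)]
  conv_lhs => rw [h1]
  rw [smul_inv_smul₀ (hΦpos t).ne', zero_add, add_comm]

/-- A solution of `ẋ = Ax + b`, `x(0) = 0` vanishes as long as `b` does. -/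
theorem IsSolution.eq_zero {k : ℕ} {A : Mat k k} {x b : ℝ → Vec k}
    (h : IsSolution x 0 fun t => A *ₑ x t + b t) {τ : ℝ} (hb : ∀ t ∈ Icc 0 τ, b t = 0)
    {t : ℝ} (ht : t ∈ Icc 0 τ) : x t = 0 := by
  have hc : ContinuousOn x (Icc 0 τ) := h.continuousOn.mono fun s hs => hs.1
  have hd : ∀ s ∈ Ico 0 τ, HasDerivWithinAt x (A *ₑ x s) (Ici s) s := by
    intro s hs
    have hcv : ContinuousWithinAt (fun t => A *ₑ x t + b t) (Ioi s) s := by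
      have h1 : ContinuousWithinAt (fun t => A *ₑ x t) (Ioi s) s :=
        ((continuousOn_const.act h.continuousOn) s hs.1).mono fun r hr => hs.1.trans (le_of_lt hr)
      refine h1.congr_of_eventuallyEq ?_ ?_
      · filter_upwards [self_mem_nhdsWithin, mem_nhdsWithin_of_mem_nhds (Iio_mem_nhds hs.2)] with
          r h1 h2
        rw [hb r ⟨hs.1.trans (le_of_lt h1), le_of_lt h2⟩, add_zero]
      · rw [hb s (Ico_subset_Icc_self hs), add_zero]
    have := h.hasDerivWithinAt hs.1 hcv
    rwa [hb s (Ico_subset_Icc_self hs), add_zero] at this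
  have := norm_le_gronwallBound_of_norm_deriv_right_le (δ := 0) (K := ‖A‖) (ε := 0) hc hd
    (by rw [h.initial, norm_zero]) (fun s _ => by simpa using norm_act_le A (x s)) t ht
  rw [gronwallBound_ε0_δ0] at this
  exact norm_le_zero_iff.1 this

/-! ### Signals -/

section Signals

variable {n k : ℕ}

theorem linfTrunc_le_iff {τ c : ℝ} (hc : 0 ≤ c) {x : ℝ → Vec n} :
    linfTrunc τ x ≤ ENNReal.ofReal c ↔ ∀ t ∈ Icc 0 τ, ‖x t‖ ≤ c := by
  simp only [linfTrunc, iSup_le_iff]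
  refine forall₂_congr fun t _ => ?_
  rw [← ofReal_norm, ENNReal.ofReal_le_ofReal_iff hc]

theorem linfNorm_le_iff {c : ℝ} (hc : 0 ≤ c) {x : ℝ → Vec n} :
    linfNorm x ≤ ENNReal.ofReal c ↔ ∀ t, 0 ≤ t → ‖x t‖ ≤ c := by
  simp only [linfNorm, iSup_le_iff]
  refine forall₂_congr fun t _ => ?_
  rw [← ofReal_norm, ENNReal.ofReal_le_ofReal_iff hc]

theorem isSignal_iff {u : ℝ → Vec n} :
    IsSignal u ↔ Measurable u ∧ ∀ τ : ℝ, ∃ M, ∀ t ∈ Icc 0 τ, ‖u t‖ ≤ M := by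
  refine and_congr_right fun _ => forall_congr' fun τ => ⟨fun h => ?_, ?_⟩
  · refine ⟨(linfTrunc τ u).toReal, (linfTrunc_le_iff ENNReal.toReal_nonneg).1 ?_⟩
    rw [ENNReal.ofReal_toReal h.ne]
  · rintro ⟨M, hM⟩
    refine lt_of_le_of_lt ((linfTrunc_le_iff (le_max_right M 0)).2
      fun t ht => (hM t ht).trans (le_max_left _ _)) ENNReal.ofReal_lt_top

theorem _root_.Continuous.isSignal {u : ℝ → Vec n} (hu : Continuous u) : IsSignal u :=
  isSignal_iff.2 ⟨hu.measurable, fun _ => isCompact_Icc.exists_bound_of_continuousOn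
    hu.continuousOn⟩

namespace IsSignal

variable {u v : ℝ → Vec n}

theorem add (hu : IsSignal u) (hv : IsSignal v) : IsSignal fun t => u t + v t := by
  rw [isSignal_iff] at hu hv ⊢
  refine ⟨hu.1.add hv.1, fun τ => ?_⟩
  obtain ⟨M, hM⟩ := hu.2 τ
  obtain ⟨N, hN⟩ := hv.2 τ
  exact ⟨M + N, fun t ht => (norm_add_le _ _).trans (add_le_add (hM t ht) (hN t ht))⟩

theorem neg (hu : IsSignal u) : IsSignal fun t => -u t := by
  rw [isSignal_iff] at hu ⊢
  refine ⟨hu.1.neg, fun τ => ?_⟩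
  obtain ⟨M, hM⟩ := hu.2 τ
  exact ⟨M, fun t ht => by rw [norm_neg]; exact hM t ht⟩

theorem sub (hu : IsSignal u) (hv : IsSignal v) : IsSignal fun t => u t - v t := by
  simpa only [sub_eq_add_neg] using hu.add hv.neg

theorem act {M : ℝ → Mat k n} (hM : Continuous M) (hu : IsSignal u) :
    IsSignal fun t => M t *ₑ u t := by
  rw [isSignal_iff] at hu ⊢
  constructor
  · have h0 : Continuous fun t => actL (M t) := actL.continuous.comp hM
    have h1 : Continuous fun z : ℝ × Vec n => actL (M z.1) z.2 :=
      (h0.comp continuous_fst).clm_apply continuous_snd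
    have h2 : Measurable fun t => (t, u t) := measurable_id.prodMk hu.1
    exact h1.measurable.comp h2
  · intro τ
    obtain ⟨a, ha⟩ := hu.2 τ
    obtain ⟨b, hb⟩ := isCompact_Icc.exists_bound_of_continuousOn (s := Icc 0 τ) hM.continuousOn
    exact ⟨b * a, fun t ht => norm_act_le_of_le (hb t ht) (ha t ht)⟩

theorem intervalIntegrable (hu : IsSignal u) {t : ℝ} (ht : 0 ≤ t) :
    IntervalIntegrable u volume 0 t := by
  rw [isSignal_iff] at hu
  obtain ⟨M, hM⟩ := hu.2 t
  rw [intervalIntegrable_iff_integrableOn_Ioc_of_le ht]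
  refine Measure.integrableOn_of_bounded (M := M) (by simp) hu.1.aestronglyMeasurable ?_
  filter_upwards [ae_restrict_mem measurableSet_Ioc] with s hs
  exact hM s (Ioc_subset_Icc_self hs)

end IsSignal

/-- The signal `u` on `[0, ∞)`, continued to negative times by its initial value. -/
def clip {α : Type} (u : ℝ → α) : ℝ → α := fun t => u (max t 0)

theorem clip_of_nonneg {α : Type} (u : ℝ → α) {t : ℝ} (ht : 0 ≤ t) : clip u t = u t := by
  rw [clip, max_eq_left ht]

theorem clip_clip {α : Type} (u : ℝ → α) : clip (clip u) = clip u := by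
  ext t; simp [clip]

theorem _root_.ContinuousOn.clip {α : Type} [TopologicalSpace α] {u : ℝ → α}
    (hu : ContinuousOn u (Ici 0)) : Continuous (clip u) :=
  continuousOn_univ.1 (hu.comp (by fun_prop) fun t _ => le_max_right t 0)

theorem IsSignal.clip {u : ℝ → Vec n} (hu : IsSignal u) : IsSignal (clip u) := by
  rw [isSignal_iff] at hu ⊢
  refine ⟨hu.1.comp (by fun_prop), fun τ => ?_⟩
  obtain ⟨M, hM⟩ := hu.2 τ
  exact ⟨M, fun t ht => by rw [clip_of_nonneg _ ht.1]; exact hM t ht⟩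

end Signals

/-! ### State-space mappings -/

namespace IOMap

variable {s a b k : ℕ} {A : Vec s → Mat k k} {B : Vec s → Mat k a} {C : Vec s → Mat b k}
  {D : Vec s → Mat b a} {θ : ℝ → Vec s} {u u' : ℝ → Vec a} {y y' : ℝ → Vec b}

theorem stateSpace_congr (h : stateSpace A B C D θ u y) (hu : ∀ t, 0 ≤ t → u' t = u t)
    (hy : ∀ t, 0 ≤ t → y' t = y t) : stateSpace A B C D θ u' y' := by
  obtain ⟨x, hx, hxy⟩ := h
  exact ⟨x, hx.congr (fun _ _ => rfl) fun t ht => by rw [hu t ht],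
    fun t ht => by rw [hy t ht, hu t ht, hxy t ht]⟩

theorem stateSpace_add (h : stateSpace A B C D θ u y) (h' : stateSpace A B C D θ u' y') :
    stateSpace A B C D θ (fun t => u t + u' t) (fun t => y t + y' t) := by
  obtain ⟨x, hx, hxy⟩ := h
  obtain ⟨x', hx', hxy'⟩ := h'
  refine ⟨fun t => x t + x' t, ?_, fun t ht => ?_⟩
  · rw [← add_zero (0 : Vec k)]
    refine (hx.add hx').congr (fun _ _ => rfl) fun t _ => ?_
    simp only [act_add]; abel
  · beta_reduce
    rw [hxy t ht, hxy' t ht]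
    simp only [act_add]; abel

theorem stateSpace_sub (h : stateSpace A B C D θ u y) (h' : stateSpace A B C D θ u' y') :
    stateSpace A B C D θ (fun t => u t - u' t) (fun t => y t - y' t) := by
  obtain ⟨x, hx, hxy⟩ := h
  obtain ⟨x', hx', hxy'⟩ := h'
  refine ⟨fun t => x t - x' t, ?_, fun t ht => ?_⟩
  · rw [← sub_zero (0 : Vec k)]
    refine (hx.sub hx').congr (fun _ _ => rfl) fun t _ => ?_
    simp only [act_sub]; abel
  · beta_reduce
    rw [hxy t ht, hxy' t ht]
    simp only [act_sub]; abel

/-- A mapping constrains its output at times `t ≥ 0` only; clipping discards the arbitrary values at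
negative times, which could spoil measurability. -/
theorem isSignal_clip_output {S : ParamBox s} (hC : ContinuousOn C S.Θ) (hD : ContinuousOn D S.Θ)
    (hθc : Continuous θ) (hθ : ∀ t, θ t ∈ S.Θ) (hu : IsSignal u)
    (h : stateSpace A B C D θ u y) : IsSignal (clip y) := by
  obtain ⟨x, hx, hxy⟩ := h
  have hp : Continuous fun t : ℝ => max t 0 := by fun_prop
  have h1 : clip y = fun t => C (θ (max t 0)) *ₑ clip x t + D (θ (max t 0)) *ₑ clip u t := by
    ext1 t
    exact hxy _ (le_max_right t 0)
  rw [h1]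
  exact (IsSignal.act (hC.comp_continuous (hθc.comp hp) fun t => hθ _)
    hx.continuousOn.clip.isSignal).add
    (IsSignal.act (hD.comp_continuous (hθc.comp hp) fun t => hθ _) hu.clip)

theorem exists_stateSpace {S : ParamBox s} (hA : ContinuousOn A S.Θ) (hB : ContinuousOn B S.Θ)
    (hC : ContinuousOn C S.Θ) (hD : ContinuousOn D S.Θ)
    (hθc : Continuous θ) (hθ : ∀ t, θ t ∈ S.Θ) (hu : IsSignal u) :
    ∃ y, IsSignal y ∧ stateSpace A B C D θ u y := by
  obtain ⟨x, hx⟩ := exists_isSolution (hA.comp_continuous hθc hθ) (M := maxNorm S.Θ A)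
    (fun t => norm_le_maxNorm S.isCompact hA (hθ t))
    (b := fun t => B (θ t) *ₑ u t)
    fun t ht => (IsSignal.act (hB.comp_continuous hθc hθ) hu).intervalIntegrable ht
  have h : stateSpace A B C D θ u (fun t => C (θ t) *ₑ x t + D (θ t) *ₑ u t) :=
    ⟨x, hx, fun _ _ => rfl⟩
  exact ⟨_, isSignal_clip_output hC hD hθc hθ hu h,
    stateSpace_congr h (fun _ _ => rfl) fun t ht => clip_of_nonneg _ ht⟩

theorem IsPPGBound.norm_le {S : ParamBox s} {G : IOMap s a b} {γ : ℝ} (h : IsPPGBound S G γ)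
    (hθ : S.Admissible θ) (hu : IsSignal u) (hy : G θ u y) {τ c : ℝ} (hc : 0 ≤ c)
    (huc : ∀ t ∈ Icc 0 τ, ‖u t‖ ≤ c) {t : ℝ} (ht : t ∈ Icc 0 τ) : ‖y t‖ ≤ γ * c := by
  have h1 := h.2 θ hθ u hu y hy τ (ht.1.trans ht.2)
  have h2 : linfTrunc τ y ≤ ENNReal.ofReal (γ * c) := by
    refine h1.trans ?_
    rw [ENNReal.ofReal_mul h.1.le]
    gcongr
    exact (linfTrunc_le_iff hc).2 huc
  exact (linfTrunc_le_iff (mul_nonneg h.1.le hc)).1 h2 t ht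

theorem linfNorm_le_ppg {S : ParamBox s} {G : IOMap s a b} (hθ : S.Admissible θ)
    (hu : IsSignal u) (hu1 : linfNorm u ≤ 1) (hy : G θ u y) : linfNorm y ≤ ppg S G :=
  le_iSup_of_le θ <| le_iSup_of_le hθ <| le_iSup_of_le u <| le_iSup_of_le ⟨hu, hu1⟩ <|
    le_iSup_of_le y <| le_iSup_of_le hy le_rfl

end IOMap

namespace System

variable {n m p q s h : ℕ} {Q : System n m p q s h}

/-- Finiteness matters because `l1InvFilter` is a `toReal`, which would be `0` at `⊤`. -/
theorem ppg_invFilter_lt_top (hQ : Q.Assumptions) : IOMap.ppg Q.S Q.invFilter < ⊤ := by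
  refine lt_of_le_of_lt ?_ (ENNReal.mul_lt_top (a := ‖Q.ω⁻¹‖ₑ) enorm_lt_top
    (hQ.filter_stable _ hQ.ω_mem))
  refine iSup_le fun θ => iSup_le fun hθ => iSup_le fun u => iSup_le fun hu => iSup_le fun y =>
    iSup_le fun hy => ?_
  obtain ⟨w, hw, hwy⟩ := hy
  have h1 := IOMap.linfNorm_le_ppg hθ hu.1 hu.2 hw
  refine iSup₂_le fun t ht => ?_
  rw [hwy t ht]
  calc ‖Q.ω⁻¹ *ₑ w t‖ₑ ≤ ‖Q.ω⁻¹‖ₑ * ‖w t‖ₑ := by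
        rw [← ofReal_norm, ← ofReal_norm, ← ofReal_norm, ← ENNReal.ofReal_mul (norm_nonneg _)]
        exact ENNReal.ofReal_le_ofReal (norm_act_le _ _)
    _ ≤ _ := by
        gcongr
        exact (le_iSup₂ (f := fun t (_ : t ∈ Ici (0 : ℝ)) => ‖w t‖ₑ) t ht).trans h1

theorem l1InvFilter_nonneg : 0 ≤ Q.l1InvFilter := ENNReal.toReal_nonneg

/-- The `L₁` norm of `ω⁻¹𝒞` bounds its gain on every interval `[0, τ]`. -/
theorem norm_le_l1InvFilter (hQ : Q.Assumptions) {θ : ℝ → Vec s} (hθ : Q.S.Admissible θ)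
    {d y : ℝ → Vec m} (hd : IsSignal d) (hy : Q.invFilter θ d y) {τ c : ℝ} (hc : 0 ≤ c)
    (hdc : ∀ t ∈ Icc 0 τ, ‖d t‖ ≤ c) {t : ℝ} (ht : t ∈ Icc 0 τ) :
    ‖y t‖ ≤ Q.l1InvFilter * c := by
  -- The input will be divided by the bound, so `c = 0` has to be reached as a limit.
  suffices H : ∀ c' : ℝ, 0 < c' → (∀ t ∈ Icc 0 τ, ‖d t‖ ≤ c') → ‖y t‖ ≤ Q.l1InvFilter * c' by
    have hlim : Tendsto (fun ε => Q.l1InvFilter * (c + ε)) (𝓝[>] 0)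
        (𝓝 (Q.l1InvFilter * (c + 0))) := by
      refine Tendsto.mono_left ?_ nhdsWithin_le_nhds
      exact Continuous.tendsto (by fun_prop) 0
    rw [add_zero] at hlim
    refine ge_of_tendsto hlim (eventually_nhdsWithin_of_forall fun ε (hε : 0 < ε) => ?_)
    exact H _ (by positivity) fun t ht => (hdc t ht).trans (by linarith)
  intro c hc hdc
  obtain ⟨w, ⟨ξ, hξ, hξw⟩, hwy⟩ := hy
  -- The input cut off after `τ` and scaled to size one competes in the supremum over the whole
  -- half-line.
  set d' : ℝ → Vec m := fun t => (Icc 0 τ).indicator (fun t => c⁻¹ • d t) t with hd'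
  have hd'1 : ∀ t, ‖d' t‖ ≤ 1 := by
    intro t
    by_cases h : t ∈ Icc 0 τ
    · rw [hd']
      simp only [indicator_of_mem h, norm_smul, norm_inv, Real.norm_of_nonneg hc.le]
      rw [inv_mul_le_iff₀ hc, mul_one]
      exact hdc t h
    · simp [hd', indicator_of_notMem h]
  have hd's : IsSignal d' := isSignal_iff.2
    ⟨(hd.1.const_smul c⁻¹).indicator measurableSet_Icc, fun τ => ⟨1, fun t _ => hd'1 t⟩⟩
  obtain ⟨ξ', hξ'⟩ := exists_isSolution (A := fun _ : ℝ => -(Q.ω * Q.K)) continuous_const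
    (fun _ => le_rfl) (b := fun t => (1 : Mat m m) *ₑ d' t) fun t ht =>
      (hd's.act continuous_const).intervalIntegrable ht
  set y' : ℝ → Vec m := fun t => Q.ω⁻¹ *ₑ (Q.ω * Q.K) *ₑ ξ' t with hy'
  have hinv : Q.invFilter θ d' y' :=
    ⟨fun t => (Q.ω * Q.K) *ₑ ξ' t, ⟨ξ', hξ', fun t _ => by simp [zero_act]⟩, fun t _ => rfl⟩
  have h1 := IOMap.linfNorm_le_ppg hθ hd's
    (by rw [← ENNReal.ofReal_one]; exact (linfNorm_le_iff zero_le_one).2 fun t _ => hd'1 t) hinv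
  rw [← ENNReal.ofReal_toReal (ppg_invFilter_lt_top hQ).ne] at h1
  have h2 := (linfNorm_le_iff (l1InvFilter_nonneg (Q := Q))).1 h1 t ht.1
  -- Causality: up to `τ` the two filter states have proportional inputs, so they are proportional
  -- themselves.
  have h3 : ξ t - c • ξ' t = 0 := by
    have hs := hξ.sub (hξ'.map (c • (1 : Mat m m)))
    rw [act_zero, sub_zero] at hs
    have := (hs.congr (x' := fun t => ξ t - c • ξ' t)
      (v' := fun t => (-(Q.ω * Q.K)) *ₑ (ξ t - c • ξ' t) + (d t - c • d' t))
      (fun t _ => by rw [smul_act, one_act]) fun t _ => by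
        simp only [smul_act, one_act, act_sub, act_smul, smul_add]; abel).eq_zero (τ := τ)
      (fun t ht => by
        simp only [hd', indicator_of_mem ht, smul_inv_smul₀ hc.ne', sub_self]) ht
    exact this
  have h4 : y t = c • y' t := by
    rw [hwy t ht.1, hξw t ht.1, zero_act, add_zero, sub_eq_zero.1 h3, hy']
    simp only [act_smul]
  rw [h4, norm_smul, Real.norm_of_nonneg hc.le, mul_comm]
  exact mul_le_mul_of_nonneg_right h2 hc.le

end System

/-! ### Pseudo-inverses -/

theorem isUnit_of_rank_eq_card {ι : Type} [Fintype ι] [DecidableEq ι] {M : Matrix ι ι ℝ}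
    (h : M.rank = Fintype.card ι) : IsUnit M := by
  rw [← Matrix.mulVec_surjective_iff_isUnit]
  have : M.mulVecLin.range = ⊤ := Submodule.eq_top_of_finrank_eq (by
    rw [Module.finrank_fintype_fun_eq_card]; exact h)
  exact LinearMap.range_eq_top.1 this

theorem isUnit_transpose_mul_self {ι κ : Type} [Fintype ι] [Fintype κ] [DecidableEq κ]
    {M : Matrix ι κ ℝ} (h : M.rank = Fintype.card κ) : IsUnit (Mᵀ * M) :=
  isUnit_of_rank_eq_card (by rw [Matrix.rank_transpose_mul_self, h])

theorem pinv_mul_self {ι κ : Type} [Fintype ι] [Fintype κ] [DecidableEq κ]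
    {M : Matrix ι κ ℝ} (h : IsUnit (Mᵀ * M)) : pinv M * M = 1 := by
  rw [pinv, Matrix.mul_assoc, Matrix.nonsing_inv_mul _ ((Matrix.isUnit_iff_isUnit_det _).1 h)]

theorem continuousOn_pinv {α ι κ : Type} [TopologicalSpace α] [Fintype ι] [Fintype κ]
    [DecidableEq κ] {S : Set α} {M : α → Matrix ι κ ℝ} (hM : ContinuousOn M S)
    (h : ∀ a ∈ S, IsUnit ((M a)ᵀ * M a)) : ContinuousOn (fun a => pinv (M a)) S := by
  rw [continuousOn_iff_continuous_domRestrict] at hM ⊢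
  have hT := hM.matrix_transpose
  have hG := hT.matrix_mul hM
  have hI : Continuous fun a : S => ((M a)ᵀ * M a)⁻¹ := by
    simp only [Matrix.inv_def, Ring.inverse_eq_inv']
    refine (hG.matrix_det.inv₀ fun a => ?_).smul hG.matrix_adjugate
    exact ((Matrix.isUnit_iff_isUnit_det _).1 (h a a.2)).ne_zero
  exact hI.matrix_mul hT

theorem norm_le_of_inl {m q : ℕ} {v : Vec m} {w : EuclideanSpace ℝ (Fin m ⊕ Fin q)}
    (h : ∀ j, v j = w (Sum.inl j)) : ‖v‖ ≤ ‖w‖ := by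
  refine abs_le_of_sq_le_sq' ?_ (norm_nonneg _) |>.2
  rw [EuclideanSpace.norm_sq_eq, EuclideanSpace.norm_sq_eq, Fintype.sum_sum_type]
  simp only [h]
  exact le_add_of_nonneg_right (Finset.sum_nonneg fun _ _ => by positivity)

theorem norm_le_of_inr {m q : ℕ} {v : Vec q} {w : EuclideanSpace ℝ (Fin m ⊕ Fin q)}
    (h : ∀ j, v j = w (Sum.inr j)) : ‖v‖ ≤ ‖w‖ := by
  refine abs_le_of_sq_le_sq' ?_ (norm_nonneg _) |>.2
  rw [EuclideanSpace.norm_sq_eq, EuclideanSpace.norm_sq_eq, Fintype.sum_sum_type]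
  simp only [h]
  exact le_add_of_nonneg_left (Finset.sum_nonneg fun _ _ => by positivity)

theorem continuousOn_of_lipschitz {s : ℕ} {a b : ℕ} {S : Set (Vec s)} {M : Vec s → Mat a b}
    {L : ℝ} (hM : ∀ θ₁ ∈ S, ∀ θ₂ ∈ S, ‖M θ₁ - M θ₂‖ ≤ L * ‖θ₁ - θ₂‖) :
    ContinuousOn M S := by
  refine (LipschitzOnWith.of_dist_le_mul (K := L.toNNReal) fun x hx y hy => ?_).continuousOn
  rw [dist_eq_norm, dist_eq_norm]
  refine (hM x hx y hy).trans ?_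
  gcongr
  exact Real.le_coe_toNNReal L

namespace System

variable {n m p q s h : ℕ} {Q : System n m p q s h}

namespace Assumptions

/-- Orthogonality of `B` and `B_u` makes the Gram matrix of `B̄` block diagonal. Full rank of both
blocks and the block form of `B̄⁻¹` follow from this. -/
theorem transpose_Bbar_mul (hQ : Q.Assumptions) {θ : Vec s} (hθ : θ ∈ Q.S.Θ) :
    (Q.Bbar θ)ᵀ * Q.Bbar θ =
      Matrix.fromBlocks ((Q.B θ)ᵀ * Q.B θ) 0 0 ((Q.Bu θ)ᵀ * Q.Bu θ) := by
  have h1 := hQ.B_Bu_orth θ hθ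
  have h2 : (Q.Bu θ)ᵀ * Q.B θ = 0 := by
    have := congrArg Matrix.transpose h1
    simpa using this
  rw [Bbar, Matrix.transpose_fromCols, Matrix.fromRows_mul_fromCols, h1, h2]

theorem isUnit_Bbar (hQ : Q.Assumptions) {θ : Vec s} (hθ : θ ∈ Q.S.Θ) :
    IsUnit ((Q.Bbar θ)ᵀ * Q.Bbar θ) :=
  isUnit_transpose_mul_self (by rw [hQ.Bbar_rank θ hθ]; simp [hQ.dim_eq])

theorem isUnit_B_Bu (hQ : Q.Assumptions) {θ : Vec s} (hθ : θ ∈ Q.S.Θ) :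
    IsUnit ((Q.B θ)ᵀ * Q.B θ) ∧ IsUnit ((Q.Bu θ)ᵀ * Q.Bu θ) := by
  have h1 := hQ.isUnit_Bbar hθ
  rw [hQ.transpose_Bbar_mul hθ, Matrix.isUnit_iff_isUnit_det, Matrix.det_fromBlocks_zero₂₁,
    IsUnit.mul_iff] at h1
  rwa [Matrix.isUnit_iff_isUnit_det, Matrix.isUnit_iff_isUnit_det]

theorem pinv_B_mul (hQ : Q.Assumptions) {θ : Vec s} (hθ : θ ∈ Q.S.Θ) :
    pinv (Q.B θ) * Q.B θ = 1 := pinv_mul_self (hQ.isUnit_B_Bu hθ).1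

theorem pinv_Bu_mul_B (hQ : Q.Assumptions) {θ : Vec s} (hθ : θ ∈ Q.S.Θ) :
    pinv (Q.Bu θ) * Q.B θ = 0 := by
  have h2 : (Q.Bu θ)ᵀ * Q.B θ = 0 := by
    have := congrArg Matrix.transpose (hQ.B_Bu_orth θ hθ)
    simpa using this
  rw [pinv, Matrix.mul_assoc, h2, Matrix.mul_zero]

theorem pinv_Bbar (hQ : Q.Assumptions) {θ : Vec s} (hθ : θ ∈ Q.S.Θ) :
    pinv (Q.Bbar θ) = Matrix.fromRows (pinv (Q.B θ)) (pinv (Q.Bu θ)) := by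
  obtain ⟨h1, h2⟩ := hQ.isUnit_B_Bu hθ
  have hinv : ((Q.Bbar θ)ᵀ * Q.Bbar θ)⁻¹ = Matrix.fromBlocks ((Q.B θ)ᵀ * Q.B θ)⁻¹ 0 0
      ((Q.Bu θ)ᵀ * Q.Bu θ)⁻¹ := by
    refine Matrix.inv_eq_right_inv ?_
    rw [hQ.transpose_Bbar_mul hθ, Matrix.fromBlocks_multiply]
    simp [Matrix.mul_nonsing_inv _ ((Matrix.isUnit_iff_isUnit_det _).1 h1),
      Matrix.mul_nonsing_inv _ ((Matrix.isUnit_iff_isUnit_det _).1 h2)]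
  rw [pinv, hinv, Bbar, Matrix.transpose_fromCols, Matrix.fromBlocks_mul_fromRows]
  simp [pinv]

/-- `B̄` is square because `m + q = n`, so its left inverse is a right inverse. Read in blocks, this
splits every vector into a matched and an unmatched part. -/
theorem B_pinv_add (hQ : Q.Assumptions) {θ : Vec s} (hθ : θ ∈ Q.S.Θ) :
    Q.B θ * pinv (Q.B θ) + Q.Bu θ * pinv (Q.Bu θ) = 1 := by
  have h1 := pinv_mul_self (hQ.isUnit_Bbar hθ)
  have h2 := (Matrix.mul_eq_one_comm_of_card_eq _ _ _ (by simp [hQ.dim_eq])).1 h1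
  rwa [hQ.pinv_Bbar hθ, Bbar, Matrix.fromCols_mul_fromRows] at h2

theorem pinv_Bbar_inl (hQ : Q.Assumptions) {θ : Vec s} (hθ : θ ∈ Q.S.Θ) (v : Vec n) (j : Fin m) :
    (pinv (Q.Bbar θ) *ₑ v) (Sum.inl j) = (pinv (Q.B θ) *ₑ v) j := by
  rw [act_apply, act_apply, hQ.pinv_Bbar hθ]
  rfl

theorem pinv_Bbar_inr (hQ : Q.Assumptions) {θ : Vec s} (hθ : θ ∈ Q.S.Θ) (v : Vec n) (j : Fin q) :
    (pinv (Q.Bbar θ) *ₑ v) (Sum.inr j) = (pinv (Q.Bu θ) *ₑ v) j := by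
  rw [act_apply, act_apply, hQ.pinv_Bbar hθ]
  rfl

/-! #### Continuity and compactness -/

theorem cont_B (hQ : Q.Assumptions) : ContinuousOn Q.B Q.S.Θ := continuousOn_of_lipschitz hQ.B_lip

theorem cont_Kx (hQ : Q.Assumptions) : ContinuousOn Q.Kx Q.S.Θ :=
  continuousOn_of_lipschitz hQ.Kx_lip

theorem cont_Am (hQ : Q.Assumptions) : ContinuousOn Q.Am Q.S.Θ :=
  hQ.cont_A.add (hQ.cont_B.mat_mul hQ.cont_Kx)

theorem cont_pinv_B (hQ : Q.Assumptions) : ContinuousOn (fun θ => pinv (Q.B θ)) Q.S.Θ :=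
  continuousOn_of_lipschitz hQ.Bdag_lip

theorem cont_pinv_Bu (hQ : Q.Assumptions) : ContinuousOn (fun θ => pinv (Q.Bu θ)) Q.S.Θ :=
  continuousOn_pinv hQ.cont_Bu fun _ hθ => (hQ.isUnit_B_Bu hθ).2

theorem cont_pinv_Bbar (hQ : Q.Assumptions) : ContinuousOn (fun θ => pinv (Q.Bbar θ)) Q.S.Θ := by
  refine continuousOn_pinv ?_ fun _ hθ => hQ.isUnit_Bbar hθ
  have hB := hQ.cont_B
  have hBu := hQ.cont_Bu
  rw [continuousOn_iff_continuous_domRestrict] at hB hBu ⊢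
  refine continuous_matrix fun i j => ?_
  rcases j with j | j
  · exact hB.matrix_elem i j
  · exact hBu.matrix_elem i j

theorem isCompact_Ω : IsCompact Q.Ω := Q.verts.finite_toSet.isCompact_convexHull ℝ

theorem norm_ω_le (hQ : Q.Assumptions) : ‖Q.ω‖ ≤ Q.bΩ :=
  norm_le_maxNorm (F := fun w : Mat m m => w) isCompact_Ω continuousOn_id hQ.ω_mem

theorem norm_ω_sub_le (hQ : Q.Assumptions) : ‖Q.ω - 1‖ ≤ Q.dΩ :=
  norm_le_maxNorm (F := fun w : Mat m m => w - 1) isCompact_Ω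
    (continuousOn_id.sub continuousOn_const) hQ.ω_mem

theorem norm_E_le (hQ : Q.Assumptions) {θ : Vec s} (hθ : θ ∈ Q.S.Θ) :
    ‖(Q.ω - 1) * Q.Kx θ‖ ≤
      maxNorm (Q.Ω ×ˢ Q.S.Θ) fun z : Mat m m × Vec s => (z.1 - 1) * Q.Kx z.2 := by
  refine norm_le_maxNorm (F := fun z : Mat m m × Vec s => (z.1 - 1) * Q.Kx z.2)
    (isCompact_Ω.prod Q.S.isCompact) ?_ (a := (Q.ω, θ)) ⟨hQ.ω_mem, hθ⟩
  exact (continuousOn_fst.sub continuousOn_const).mat_mul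
    (hQ.cont_Kx.comp continuousOn_snd fun z hz => hz.2)

theorem bf0_nonneg (hQ : Q.Assumptions) : 0 ≤ Q.bf0 :=
  (norm_nonneg _).trans (hQ.f_zero 0 le_rfl)

theorem norm_r_le (hQ : Q.Assumptions) {t : ℝ} (ht : 0 ≤ t) : ‖Q.r t‖ ≤ Q.rNorm := by
  refine (linfNorm_le_iff ENNReal.toReal_nonneg).1 ?_ t ht
  rw [ENNReal.ofReal_toReal hQ.r_bdd.ne]

theorem isSignal_r (hQ : Q.Assumptions) : IsSignal Q.r :=
  isSignal_iff.2 ⟨hQ.r_meas, fun _ => ⟨Q.rNorm, fun _ ht => hQ.norm_r_le ht.1⟩⟩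

end Assumptions

end System

/-! ### Exponentially weighted averages and the estimation law -/

/-- The average of `g` over `[α, β]` with weight proportional to `exp (a t)`. -/
noncomputable def wavg {n : ℕ} (a α β : ℝ) (g : ℝ → Vec n) : Vec n :=
  (a / (Real.exp (a * β) - Real.exp (a * α))) • ∫ t in α..β, Real.exp (a * t) • g t

section Average

variable {n k : ℕ} {a α β : ℝ} {g g' : ℝ → Vec n}

theorem integral_exp_smul_const (ha : 0 < a) (c : Vec n) :
    ∫ t in α..β, Real.exp (a * t) • c = ((Real.exp (a * β) - Real.exp (a * α)) / a) • c := by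
  rw [intervalIntegral.integral_smul_const,
    intervalIntegral.integral_comp_mul_left (fun s => Real.exp s) ha.ne', integral_exp,
    smul_eq_mul, inv_mul_eq_div]

theorem exp_sub_exp_pos (ha : 0 < a) (hαβ : α < β) :
    0 < Real.exp (a * β) - Real.exp (a * α) :=
  sub_pos.2 (Real.exp_lt_exp.2 (mul_lt_mul_of_pos_left hαβ ha))

theorem intervalIntegrable_exp_smul (hαβ : α ≤ β) (hg : ContinuousOn g (Icc α β)) :
    IntervalIntegrable (fun t => Real.exp (a * t) • g t) volume α β := by
  refine ContinuousOn.intervalIntegrable ?_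
  rw [uIcc_of_le hαβ]
  have hexp : ContinuousOn (fun t : ℝ => Real.exp (a * t)) (Icc α β) := by fun_prop
  exact hexp.smul hg

theorem wavg_sub (hαβ : α ≤ β) (hg : ContinuousOn g (Icc α β)) (hg' : ContinuousOn g' (Icc α β)) :
    wavg a α β (fun t => g t - g' t) = wavg a α β g - wavg a α β g' := by
  simp only [wavg, smul_sub]
  rw [intervalIntegral.integral_sub (intervalIntegrable_exp_smul hαβ hg)
    (intervalIntegrable_exp_smul hαβ hg'), smul_sub]

theorem wavg_act (M : Mat k n) (hαβ : α ≤ β) (hg : ContinuousOn g (Icc α β)) :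
    wavg a α β (fun t => M *ₑ g t) = M *ₑ wavg a α β g := by
  rw [wavg, wavg, act_smul]
  congr 1
  simp only [← act_smul M]
  exact (actL M).intervalIntegral_comp_comm (intervalIntegrable_exp_smul hαβ hg)

/-- The weights have total mass one, so the average of the constant `c` is `c`, and averaging does
not increase a bound on `g - c`. -/
theorem norm_wavg_sub_le (ha : 0 < a) (hαβ : α < β) (hg : ContinuousOn g (Icc α β)) {c : Vec n}
    {M : ℝ} (hM : ∀ t ∈ Icc α β, ‖g t - c‖ ≤ M) : ‖wavg a α β g - c‖ ≤ M := by
  have hE := exp_sub_exp_pos ha hαβ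
  have hc : wavg a α β (fun _ => c) = c := by
    rw [wavg, integral_exp_smul_const ha, smul_smul, div_mul_div_cancel₀ hE.ne', div_self ha.ne',
      one_smul]
  have h1 : wavg a α β g - c = wavg a α β fun t => g t - c := by
    rw [wavg_sub hαβ.le hg continuousOn_const, hc]
  rw [h1, wavg, norm_smul, Real.norm_of_nonneg (div_nonneg ha.le hE.le)]
  have h2 : ‖∫ t in α..β, Real.exp (a * t) • (g t - c)‖ ≤ ∫ t in α..β, Real.exp (a * t) * M := by
    refine intervalIntegral.norm_integral_le_of_norm_le hαβ.le (ae_of_all _ fun t ht => ?_)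
      (Continuous.intervalIntegrable (by fun_prop) _ _)
    rw [norm_smul, Real.norm_of_nonneg (Real.exp_pos _).le]
    exact mul_le_mul_of_nonneg_left (hM t (Ioc_subset_Icc_self ht)) (Real.exp_pos _).le
  rw [intervalIntegral.integral_mul_const, intervalIntegral.integral_comp_mul_left
    (fun s => Real.exp s) ha.ne', integral_exp, smul_eq_mul, inv_mul_eq_div] at h2
  calc _ ≤ a / (Real.exp (a * β) - Real.exp (a * α)) *
        ((Real.exp (a * β) - Real.exp (a * α)) / a * M) := by gcongr
    _ = M := by field_simp

/-- The piecewise-constant estimation law: over one sampling interval the contribution of the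
initial prediction error is cancelled, and the next estimate is an average of the uncertainty. -/
theorem estimate_eq_wavg (ha : 0 < a) (hα : 0 ≤ α) (hαβ : α < β) {e sig σ : ℝ → Vec n}
    {e₀ : Vec n} (he : IsSolution e e₀ fun t => sig t - a • e t - σ t)
    (hσ : ContinuousOn σ (Ici 0))
    (hsig : ∀ t ∈ Ico α β, sig t = -(a / (Real.exp (a * (β - α)) - 1)) • e α) :
    -(a / (Real.exp (a * (β - α)) - 1)) • e β =
      Real.exp (-(a * (β - α))) • wavg a α β σ := by
  set s₀ := -(a / (Real.exp (a * (β - α)) - 1)) • e α with hs₀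
  have hsub : Icc α β ⊆ Ici 0 := fun t ht => hα.trans ht.1
  have hec := he.continuousOn.mono hsub
  have hσc := hσ.mono hsub
  have hd : ∀ t ∈ Ioo α β, HasDerivWithinAt (fun t => Real.exp (a * t) • e t)
      (Real.exp (a * t) • (s₀ - σ t)) (Ioi t) t := by
    intro t ht
    have ht0 : 0 ≤ t := hα.trans ht.1.le
    have hcv : ContinuousWithinAt (fun t => sig t - a • e t - σ t) (Ioi t) t := by
      have hI : Ioi t ⊆ Ici 0 := fun r hr => ht0.trans (le_of_lt hr)
      have h1 : ContinuousWithinAt (fun t => s₀ - a • e t - σ t) (Ioi t) t :=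
        (continuousWithinAt_const.sub (((he.continuousOn t ht0).mono hI).const_smul a)).sub
          ((hσ t ht0).mono hI)
      refine h1.congr_of_eventuallyEq ?_ (by rw [hsig t (Ioo_subset_Ico_self ht)])
      filter_upwards [self_mem_nhdsWithin, mem_nhdsWithin_of_mem_nhds (Iio_mem_nhds ht.2)] with
        r h1 h2
      rw [hsig r ⟨ht.1.le.trans (le_of_lt h1), h2⟩]
    have h2 := (he.hasDerivWithinAt ht0 hcv).mono Ioi_subset_Ici_self
    rw [hsig t (Ioo_subset_Ico_self ht)] at h2
    have h3 : HasDerivWithinAt (fun t => Real.exp (a * t)) (Real.exp (a * t) * a) (Ioi t) t := by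
      have h0 := ((hasDerivAt_id t).const_mul a).exp
      simp only [mul_one, id] at h0
      exact h0.hasDerivWithinAt
    refine (h3.smul h2).congr_deriv ?_
    simp only [smul_sub, smul_smul]
    module
  have hint : IntervalIntegrable (fun t => Real.exp (a * t) • (s₀ - σ t)) volume α β :=
    intervalIntegrable_exp_smul hαβ.le (continuousOn_const.sub hσc)
  have hexp : ContinuousOn (fun t : ℝ => Real.exp (a * t)) (Icc α β) := by fun_prop
  have key := intervalIntegral.integral_eq_sub_of_hasDeriv_right_of_le hαβ.le
    (hexp.smul hec) hd hint
  simp only [smul_sub] at key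
  rw [intervalIntegral.integral_sub (intervalIntegrable_exp_smul hαβ.le continuousOn_const)
    (intervalIntegrable_exp_smul hαβ.le hσc), integral_exp_smul_const ha] at key
  have hEβ : Real.exp (a * β) = Real.exp (a * α) * Real.exp (a * (β - α)) := by
    rw [← Real.exp_add]; congr 1; ring
  have hE1 : Real.exp (a * (β - α)) - 1 ≠ 0 := by
    have : 1 < Real.exp (a * (β - α)) := Real.one_lt_exp_iff.2 (mul_pos ha (sub_pos.2 hαβ))
    linarith
  -- The gain of the estimation law is the one for which the constant estimate, integrated against
  -- `exp (a t)`, cancels the initial term `exp (a α) e(α)`; only the integral of `σ` survives.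
  have hs : ((Real.exp (a * β) - Real.exp (a * α)) / a) • s₀ = -(Real.exp (a * α) • e α) := by
    rw [hs₀, smul_smul, ← neg_smul, hEβ]
    congr 1
    field_simp
  rw [hs] at key
  have hβ : ∫ t in α..β, Real.exp (a * t) • σ t = -(Real.exp (a * β) • e β) := by
    have h0 : ∀ A B C : Vec n, -A - B = C - A → B = -C := fun A B C h => by
      have : B = -A - (-A - B) := by abel
      rw [this, h]; abel
    exact h0 _ _ _ key
  rw [wavg, hβ, Real.exp_neg, smul_neg, smul_neg, smul_smul, smul_smul, neg_smul, hEβ]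
  congr 2
  have := Real.exp_pos (a * α)
  have := Real.exp_pos (a * (β - α))
  rw [show Real.exp (a * α) * Real.exp (a * (β - α)) - Real.exp (a * α) =
    Real.exp (a * α) * (Real.exp (a * (β - α)) - 1) by ring]
  field_simp

end Average

/-! ### Sampled averages as signals -/

/-- The average of `g` over the last complete sampling interval before `t ≥ T`. -/
noncomputable def held {n : ℕ} (a T : ℝ) (g : ℝ → Vec n) (t : ℝ) : Vec n :=
  wavg a ((⌊t / T⌋₊ - 1) * T) (⌊t / T⌋₊ * T) g

section Held

variable {n : ℕ} {a T : ℝ} {g : ℝ → Vec n}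

theorem floor_bounds (hT : 0 < T) {t : ℝ} (ht : T ≤ t) :
    0 ≤ ((⌊t / T⌋₊ : ℝ) - 1) * T ∧ (⌊t / T⌋₊ : ℝ) * T ≤ t ∧ t < (⌊t / T⌋₊ + 1) * T := by
  have h0 : 0 ≤ t / T := div_nonneg (hT.le.trans ht) hT.le
  have h1 : (1 : ℝ) ≤ ⌊t / T⌋₊ := by
    exact_mod_cast Nat.le_floor (by rw [Nat.cast_one, one_le_div hT]; exact ht)
  refine ⟨mul_nonneg (by linarith) hT.le, ?_, ?_⟩
  · have := Nat.floor_le h0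
    rwa [le_div_iff₀ hT] at this
  · have := Nat.lt_floor_add_one (t / T)
    rwa [div_lt_iff₀ hT] at this

/-- The averaging interval lies in `[0, t]` and within `2T` of `t`. -/
theorem mem_of_held (hT : 0 < T) {t r : ℝ} (ht : T ≤ t)
    (hr : r ∈ Icc (((⌊t / T⌋₊ : ℝ) - 1) * T) (⌊t / T⌋₊ * T)) :
    r ∈ Icc 0 t ∧ |r - t| ≤ 2 * T := by
  obtain ⟨h1, h2, h3⟩ := floor_bounds hT ht
  refine ⟨⟨h1.trans hr.1, hr.2.trans h2⟩, ?_⟩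
  rw [abs_sub_comm, abs_of_nonneg (by linarith [hr.2])]
  nlinarith [hr.1]

theorem held_lt (hT : 0 < T) (t : ℝ) : ((⌊t / T⌋₊ : ℝ) - 1) * T < ⌊t / T⌋₊ * T := by
  nlinarith

theorem norm_held_sub_le (ha : 0 < a) (hT : 0 < T) (hg : Continuous g) {t : ℝ} (ht : T ≤ t)
    {c : Vec n} {M : ℝ} (hM : ∀ r ∈ Icc 0 t, |r - t| ≤ 2 * T → ‖g r - c‖ ≤ M) :
    ‖held a T g t - c‖ ≤ M :=
  norm_wavg_sub_le ha (held_lt hT t) hg.continuousOn fun r hr =>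
    hM r (mem_of_held hT ht hr).1 (mem_of_held hT ht hr).2

theorem norm_held_le (ha : 0 < a) (hT : 0 < T) (hg : Continuous g) {t : ℝ} (ht : T ≤ t)
    {M : ℝ} (hM : ∀ r ∈ Icc 0 t, ‖g r‖ ≤ M) : ‖held a T g t‖ ≤ M := by
  simpa using norm_held_sub_le (c := 0) ha hT hg ht fun r hr _ => by simpa using hM r hr

theorem measurable_held : Measurable (held a T g) := by
  have h : held a T g = (fun i : ℕ => wavg a (((i : ℝ) - 1) * T) (i * T) g) ∘
      fun t => ⌊t / T⌋₊ := rfl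
  rw [h]
  exact (measurable_from_top).comp (Nat.measurable_floor.comp (measurable_id.div_const T))

theorem eventually_floor_eq (hT : 0 < T) {t : ℝ} (ht : 0 ≤ t) :
    ∀ᶠ r in 𝓝[>] t, ⌊r / T⌋₊ = ⌊t / T⌋₊ := by
  have h0 : 0 ≤ t / T := div_nonneg ht hT.le
  have h1 : t < (⌊t / T⌋₊ + 1) * T := by
    have := Nat.lt_floor_add_one (t / T)
    rwa [div_lt_iff₀ hT] at this
  filter_upwards [self_mem_nhdsWithin, mem_nhdsWithin_of_mem_nhds (Iio_mem_nhds h1)] with r hr hr'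
  have hr : t < r := hr
  refine (Nat.floor_eq_iff (div_nonneg (ht.trans hr.le) hT.le)).2 ⟨?_, ?_⟩
  · exact (Nat.floor_le h0).trans (div_le_div_of_nonneg_right hr.le hT.le)
  · rw [div_lt_iff₀ hT]; exact hr'

/-- Sampled averages are constant just after each time, hence right-continuous; equations driven by
them therefore have right derivatives everywhere. -/
theorem eventually_held_eq (hT : 0 < T) {t : ℝ} (ht : 0 ≤ t) :
    ∀ᶠ r in 𝓝[>] t, held a T g r = held a T g t := by
  filter_upwards [eventually_floor_eq hT ht] with r hr
  rw [held, held, hr]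

theorem eventually_lt_iff (t : ℝ) : ∀ᶠ r in 𝓝[>] t, (r < T ↔ t < T) := by
  rcases lt_or_ge t T with h | h
  · filter_upwards [mem_nhdsWithin_of_mem_nhds (Iio_mem_nhds h)] with r hr
    exact ⟨fun _ => h, fun _ => hr⟩
  · filter_upwards [self_mem_nhdsWithin] with r hr
    exact ⟨fun h' => absurd (h.trans_lt hr) (not_lt.2 (le_of_lt h')),
      fun h' => absurd h' (not_lt.2 h)⟩

end Held

/-- The factor `√n` in the constants is slack: it is at least one unless `n = 0`, and then the
vector is zero. -/
theorem norm_le_sqrt_mul {n : ℕ} {v : Vec n} {c : ℝ} (h : ‖v‖ ≤ c) : ‖v‖ ≤ √n * c := by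
  rcases Nat.eq_zero_or_pos n with rfl | hn
  · rw [Subsingleton.elim v 0]; simp
  · have h1 : (1 : ℝ) ≤ √n := by
      rw [Real.one_le_sqrt]; exact_mod_cast hn
    have h2 : 0 ≤ c := (norm_nonneg _).trans h
    nlinarith

namespace System

variable {n m p q s h : ℕ}

/-! ### Signals of the adaptive loop -/

section Defs

variable (Q : System n m p q s h) (θ : ℝ → Vec s) (x : ℝ → Vec n) (u : ℝ → Vec m)

/-- Signals that are defined and continuous on the whole time axis, with an admissible parameter
trajectory. -/
structure Regular : Prop where
  θ_adm : Q.S.Admissible θ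
  θ_cont : Continuous θ
  θ_mem : ∀ t, θ t ∈ Q.S.Θ
  x_cont : Continuous x
  u_cont : Continuous u

/-- The gain `(ω - I)K_x(θ)` of the matched state-dependent uncertainty. -/
def matchedGain (θ : Vec s) : Mat m n := (Q.ω - 1) * Q.Kx θ

/-- The lumped uncertainty `B(θ)(ω - I)(K_x(θ)x + u) + f(t, x)`. -/
noncomputable def lumped (t : ℝ) : Vec n :=
  Q.B (θ t) *ₑ (Q.ω - 1) *ₑ (Q.Kx (θ t) *ₑ x t + u t) + Q.f (max t 0) (x t)

/-- The estimate of the lumped uncertainty that enters the control law. -/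
noncomputable def estimate (t : ℝ) : Vec n :=
  if t < Q.T then 0 else Real.exp (-(Q.a * Q.T)) • held Q.a Q.T (Q.lumped θ x u) t

/-- The plant state, from time `T` on replaced by its average over the last sampling interval. -/
noncomputable def avgState (t : ℝ) : Vec n := if t < Q.T then x t else held Q.a Q.T x t

/-- The estimation error, without the part due to averaging the state in the matched
state-dependent uncertainty. -/
noncomputable def residual (t : ℝ) : Vec n :=
  Q.estimate θ x u t - Q.lumped θ x u t -
    Q.B (θ t) *ₑ Q.matchedGain (θ t) *ₑ (Q.avgState x t - x t)

/-- The bound on the residual after the first sampling interval. -/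
noncomputable def residualBound (g : Gains) (ρ ρu : ℝ) : ℝ :=
  2 * Q.T * (‖Q.ω - 1‖ * (Q.bB * Q.budot g ρ ρu + Q.LB * Q.bθ * ρu)
      + Q.lfbar ρ + Q.Lf ρ * Q.bxdot ρ ρu)
    + (1 - Real.exp (-(Q.a * Q.T))) * Q.bσ ρ ρu

/-- The part of `L_f̄` with `max ‖B K_x‖ d_Ω` does not serve to bound the residual, in which only
`L_f` occurs. It is set aside here and later spent on `averagingError`. -/
theorem bσtilde_eq (g : Gains) (ρ ρu : ℝ) : Q.bσtilde g ρ ρu = √n * Q.residualBound g ρ ρu +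
    maxNorm Q.S.Θ (fun θ => Q.B θ * Q.Kx θ) * Q.dΩ * (√n * (2 * Q.T * Q.bxdot ρ ρu)) := by
  rw [bσtilde, residualBound, Lfbar]
  ring

end Defs

variable {Q : System n m p q s h} {θ : ℝ → Vec s} {x : ℝ → Vec n} {u : ℝ → Vec m}

theorem bB_nonneg : 0 ≤ Q.bB := maxNorm_nonneg _ _
theorem bKx_nonneg : 0 ≤ Q.bKx := maxNorm_nonneg _ _
theorem bKr_nonneg : 0 ≤ Q.bKr := maxNorm_nonneg _ _
theorem bAm_nonneg : 0 ≤ Q.bAm := maxNorm_nonneg _ _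
theorem dΩ_nonneg : 0 ≤ Q.dΩ := maxNorm_nonneg _ _
theorem bΩ_nonneg : 0 ≤ Q.bΩ := maxNorm_nonneg _ _
theorem bBbarInv_nonneg : 0 ≤ Q.bBbarInv := maxNorm_nonneg _ _
theorem bBdag_nonneg : 0 ≤ Q.bBdag := maxNorm_nonneg _ _
theorem bBudag_nonneg : 0 ≤ Q.bBudag := maxNorm_nonneg _ _
theorem rNorm_nonneg : 0 ≤ Q.rNorm := ENNReal.toReal_nonneg

theorem Assumptions.bθ_nonneg (hQ : Q.Assumptions) (hθ : Q.S.Admissible θ) : 0 ≤ Q.bθ :=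
  (norm_nonneg _).trans (hQ.rate_bound 0 hθ.zero_mem)

theorem Assumptions.norm_f_le (hQ : Q.Assumptions) {δ t : ℝ} (hδ : 0 < δ) (ht : 0 ≤ t)
    {z : Vec n} (hz : ‖z‖ ≤ δ) : ‖Q.f t z‖ ≤ Q.Lf δ * ‖z‖ + Q.bf0 := by
  have h1 := hQ.f_lip δ hδ t ht z 0 hz (by simpa using hδ.le)
  have h2 := hQ.f_zero t ht
  rw [sub_zero] at h1
  calc ‖Q.f t z‖ = ‖(Q.f t z - Q.f t 0) + Q.f t 0‖ := by rw [sub_add_cancel]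
    _ ≤ _ := (norm_add_le _ _).trans (add_le_add h1 h2)

theorem Assumptions.norm_f_le' (hQ : Q.Assumptions) {δ c t : ℝ} (hδ : 0 < δ) (ht : 0 ≤ t)
    {z : Vec n} (hz : ‖z‖ ≤ c) (hc : c ≤ δ) : ‖Q.f t z‖ ≤ Q.Lf δ * c + Q.bf0 := by
  refine (hQ.norm_f_le hδ ht (hz.trans hc)).trans ?_
  have := (hQ.Lf_pos δ hδ).le
  gcongr

/-- Near `t₀` the Lipschitz constant of the ball of radius `‖z t₀‖ + 1` applies to the state, and
`l_f` to time. The truncation `max t 0` keeps to the times at which `f` is controlled. -/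
theorem Assumptions.continuous_f (hQ : Q.Assumptions) {z : ℝ → Vec n} (hz : Continuous z) :
    Continuous fun t => Q.f (max t 0) (z t) := by
  rw [continuous_iff_continuousAt]
  intro t₀
  set δ := ‖z t₀‖ + 1 with hδ
  have hδ0 : 0 < δ := by positivity
  have hev : ∀ᶠ t in 𝓝 t₀, ‖Q.f (max t 0) (z t) - Q.f (max t₀ 0) (z t₀)‖ ≤
      Q.Lf δ * ‖z t - z t₀‖ + Q.lf * |max t 0 - max t₀ 0| := by
    have : ∀ᶠ t in 𝓝 t₀, ‖z t‖ < δ :=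
      (hz.norm.tendsto t₀).eventually (gt_mem_nhds (by simp [hδ]))
    filter_upwards [this] with t ht
    have h1 := hQ.f_lip δ hδ0 (max t 0) (le_max_right _ _) (z t) (z t₀) ht.le (by simp [hδ])
    have h2 := hQ.f_rate (z t₀) (max t 0) (max t₀ 0) (le_max_right _ _) (le_max_right _ _)
    calc _ = ‖(Q.f (max t 0) (z t) - Q.f (max t 0) (z t₀)) +
          (Q.f (max t 0) (z t₀) - Q.f (max t₀ 0) (z t₀))‖ := by rw [sub_add_sub_cancel]
      _ ≤ _ := (norm_add_le _ _).trans (add_le_add h1 h2)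
  rw [ContinuousAt, tendsto_iff_norm_sub_tendsto_zero]
  have hlim : Tendsto (fun t => Q.Lf δ * ‖z t - z t₀‖ + Q.lf * |max t 0 - max t₀ 0|) (𝓝 t₀)
      (𝓝 0) := by
    have : Continuous fun t => Q.Lf δ * ‖z t - z t₀‖ + Q.lf * |max t 0 - max t₀ 0| := by fun_prop
    simpa using this.tendsto t₀
  exact squeeze_zero' (Eventually.of_forall fun _ => norm_nonneg _) hev hlim

/-! ### Measurability and right continuity of the estimate, the averaged state and the residual. -/

namespace Regular

theorem comp {a b : ℕ} {M : Vec s → Mat a b} (hR : Q.Regular θ x u)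
    (hM : ContinuousOn M Q.S.Θ) : Continuous fun t => M (θ t) :=
  hM.comp_continuous hR.θ_cont hR.θ_mem

theorem cont_matchedGain (hQ : Q.Assumptions) : ContinuousOn Q.matchedGain Q.S.Θ :=
  continuousOn_const.mat_mul hQ.cont_Kx

theorem continuous_lumped (hQ : Q.Assumptions) (hR : Q.Regular θ x u) :
    Continuous (Q.lumped θ x u) :=
  ((hR.comp hQ.cont_B).act (continuous_const.act
    (((hR.comp hQ.cont_Kx).act hR.x_cont).add hR.u_cont))).add (hQ.continuous_f hR.x_cont)

theorem measurable_estimate : Measurable (Q.estimate θ x u) :=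
  Measurable.ite measurableSet_Iio measurable_const
    (measurable_held.const_smul (Real.exp (-(Q.a * Q.T))))

theorem measurable_avgState (hR : Q.Regular θ x u) : Measurable (Q.avgState x) :=
  Measurable.ite measurableSet_Iio hR.x_cont.measurable measurable_held

theorem exists_norm_le_of_continuous {k : ℕ} {z : ℝ → Vec k} (hz : Continuous z) (τ : ℝ) :
    ∃ M, 0 ≤ M ∧ ∀ t ∈ Icc 0 τ, ‖z t‖ ≤ M := by
  obtain ⟨M, hM⟩ := isCompact_Icc.exists_bound_of_continuousOn (s := Icc 0 τ) hz.continuousOn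
  exact ⟨max M 0, le_max_right _ _, fun t ht => (hM t ht).trans (le_max_left _ _)⟩

theorem norm_avgState_le (hQ : Q.Assumptions) (hR : Q.Regular θ x u) {τ ρ : ℝ}
    (hx : ∀ t ∈ Icc 0 τ, ‖x t‖ ≤ ρ) {t : ℝ} (ht : t ∈ Icc 0 τ) : ‖Q.avgState x t‖ ≤ ρ := by
  rw [avgState]
  split_ifs with h
  · exact hx t ht
  · exact norm_held_le hQ.a_pos hQ.T_pos hR.x_cont (not_lt.1 h) fun r hr =>
      hx r ⟨hr.1, hr.2.trans ht.2⟩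

theorem norm_estimate_le (hQ : Q.Assumptions) (hR : Q.Regular θ x u) {τ b : ℝ} (hb : 0 ≤ b)
    (hσ : ∀ t ∈ Icc 0 τ, ‖Q.lumped θ x u t‖ ≤ b) {t : ℝ} (ht : t ∈ Icc 0 τ) :
    ‖Q.estimate θ x u t‖ ≤ Real.exp (-(Q.a * Q.T)) * b := by
  rw [estimate]
  split_ifs with h
  · rw [norm_zero]; positivity
  · rw [norm_smul, Real.norm_of_nonneg (Real.exp_pos _).le]
    gcongr
    exact norm_held_le hQ.a_pos hQ.T_pos (continuous_lumped hQ hR) (not_lt.1 h) fun r hr =>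
      hσ r ⟨hr.1, hr.2.trans ht.2⟩

theorem isSignal_estimate (hQ : Q.Assumptions) (hR : Q.Regular θ x u) :
    IsSignal (Q.estimate θ x u) := isSignal_iff.2 ⟨measurable_estimate, fun τ => by
  obtain ⟨M, hM0, hM⟩ := exists_norm_le_of_continuous (continuous_lumped hQ hR) τ
  exact ⟨_, fun t ht => hR.norm_estimate_le hQ hM0 hM ht⟩⟩

theorem isSignal_avgState (hQ : Q.Assumptions) (hR : Q.Regular θ x u) :
    IsSignal (Q.avgState x) := isSignal_iff.2 ⟨hR.measurable_avgState, fun τ => by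
  obtain ⟨M, -, hM⟩ := exists_norm_le_of_continuous hR.x_cont τ
  exact ⟨_, fun t ht => hR.norm_avgState_le hQ hM ht⟩⟩

theorem isSignal_residual (hQ : Q.Assumptions) (hR : Q.Regular θ x u) :
    IsSignal (Q.residual θ x u) :=
  ((hR.isSignal_estimate hQ).sub (continuous_lumped hQ hR).isSignal).sub
    (IsSignal.act (hR.comp hQ.cont_B) (IsSignal.act (hR.comp (cont_matchedGain hQ))
      ((hR.isSignal_avgState hQ).sub hR.x_cont.isSignal)))

theorem continuousWithinAt_avgState (hQ : Q.Assumptions) (hR : Q.Regular θ x u) {t : ℝ}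
    (ht : 0 ≤ t) : ContinuousWithinAt (Q.avgState x) (Ioi t) t := by
  by_cases h : t < Q.T
  · refine (hR.x_cont.continuousWithinAt).congr_of_eventuallyEq ?_ (by rw [avgState, if_pos h])
    filter_upwards [eventually_lt_iff (T := Q.T) t] with r hr
    rw [avgState, if_pos (hr.2 h)]
  · refine (continuousWithinAt_const (b := held Q.a Q.T x t)).congr_of_eventuallyEq ?_
      (by rw [avgState, if_neg h])
    filter_upwards [eventually_lt_iff (T := Q.T) t, eventually_held_eq hQ.T_pos ht] with r hr hr'
    rw [avgState, if_neg (mt hr.1 h), hr']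

theorem continuousWithinAt_estimate (hQ : Q.Assumptions) {t : ℝ}
    (ht : 0 ≤ t) : ContinuousWithinAt (Q.estimate θ x u) (Ioi t) t := by
  refine (continuousWithinAt_const (b := Q.estimate θ x u t)).congr_of_eventuallyEq ?_ rfl
  filter_upwards [eventually_lt_iff (T := Q.T) t, eventually_held_eq hQ.T_pos ht] with r hr hr'
  rw [estimate, estimate, hr']
  simp only [hr]

theorem continuousWithinAt_residual (hQ : Q.Assumptions) (hR : Q.Regular θ x u) {t : ℝ}
    (ht : 0 ≤ t) : ContinuousWithinAt (Q.residual θ x u) (Ioi t) t := by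
  have h1 : ContinuousWithinAt (fun t => (Q.B (θ t) * Q.matchedGain (θ t)) *ₑ
      (Q.avgState x t - x t)) (Ioi t) t := by
    have hM : Continuous fun t => Q.B (θ t) * Q.matchedGain (θ t) :=
      hR.comp (hQ.cont_B.mat_mul (cont_matchedGain hQ))
    have h2 : ContinuousWithinAt (fun t => actL (Q.B (θ t) * Q.matchedGain (θ t))) (Ioi t) t :=
      (actL.continuous.comp hM).continuousWithinAt
    exact h2.clm_apply ((hR.continuousWithinAt_avgState hQ ht).sub hR.x_cont.continuousWithinAt)
  simp only [mul_act] at h1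
  exact ((continuousWithinAt_estimate hQ ht).sub
    (continuous_lumped hQ hR).continuousWithinAt).sub h1

/-! ### Bounds on a bounded part of the trajectory -/

section Bounds

variable {τ ρ ρu : ℝ}

theorem norm_lumped_le (hQ : Q.Assumptions) (hR : Q.Regular θ x u) (hρ : 0 < ρ)
    (hx : ∀ t ∈ Icc 0 τ, ‖x t‖ ≤ ρ) (hu : ∀ t ∈ Icc 0 τ, ‖u t‖ ≤ ρu) {t : ℝ}
    (ht : t ∈ Icc 0 τ) : ‖Q.lumped θ x u t‖ ≤ Q.bσ ρ ρu := by
  have hm := hR.θ_mem t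
  have hc := Q.S.isCompact
  have hK := norm_act_le_of_le (norm_le_maxNorm hc hQ.cont_Kx hm) (hx t ht)
  have h1 := norm_act_le_of_le hQ.norm_ω_sub_le ((norm_add_le _ _).trans
    (add_le_add hK (hu t ht)))
  have h2 := norm_act_le_of_le (norm_le_maxNorm hc hQ.cont_B hm) h1
  have h3 := hQ.norm_f_le' hρ (le_max_right t 0) (hx t ht) le_rfl
  refine (norm_add_le _ _).trans ((add_le_add h2 h3).trans (le_of_eq ?_))
  simp only [bσ, bB, bKx]
  ring

/-- Before the first sample the estimate vanishes and `avgState` is the state itself, so the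
residual is minus the full uncertainty and no smallness in `T` can be expected. -/
theorem norm_residual_le_of_lt (hQ : Q.Assumptions) (hR : Q.Regular θ x u) (hρ : 0 < ρ)
    (hx : ∀ t ∈ Icc 0 τ, ‖x t‖ ≤ ρ) (hu : ∀ t ∈ Icc 0 τ, ‖u t‖ ≤ ρu) {t : ℝ}
    (ht : t ∈ Icc 0 τ) (htT : t < Q.T) : ‖Q.residual θ x u t‖ ≤ Q.bσ ρ ρu := by
  rw [residual, estimate, avgState, if_pos htT, if_pos htT, sub_self, act_zero, act_zero, sub_zero,
    zero_sub, norm_neg]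
  exact norm_lumped_le hQ hR hρ hx hu ht

theorem norm_avgState_sub_le (hQ : Q.Assumptions) (hR : Q.Regular θ x u) {b : ℝ} (hb : 0 ≤ b)
    (hx : ∀ r ∈ Icc 0 τ, ∀ t ∈ Icc 0 τ, ‖x r - x t‖ ≤ b * |r - t|) {t : ℝ}
    (ht : t ∈ Icc 0 τ) : ‖Q.avgState x t - x t‖ ≤ 2 * Q.T * b := by
  have hT := hQ.T_pos
  rw [avgState]
  split_ifs with h
  · rw [sub_self, norm_zero]; positivity
  · refine norm_held_sub_le hQ.a_pos hT hR.x_cont (not_lt.1 h) fun r hr hrt => ?_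
    refine (hx r ⟨hr.1, hr.2.trans ht.2⟩ t ht).trans ?_
    rw [mul_comm (2 * Q.T)]
    gcongr

/-- An average over times within `2T` of `t` differs from the present value by at most `2T` times a
Lipschitz constant. Subtracting the averaged state term removes the motion of `x` inside `B(ω -
I)K_x x`; only the drift of `B` and `K_x` along `θ` remains of that term, and `l_f̄` accounts for
it. The damping factor `exp(-aT)` of the estimate costs the last summand. -/
theorem norm_residual_le (hQ : Q.Assumptions) (hR : Q.Regular θ x u) {g : Gains} (hρ : 0 < ρ)
    (hx : ∀ t ∈ Icc 0 τ, ‖x t‖ ≤ ρ) (hu : ∀ t ∈ Icc 0 τ, ‖u t‖ ≤ ρu)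
    (hx' : ∀ r ∈ Icc 0 τ, ∀ t ∈ Icc 0 τ, ‖x r - x t‖ ≤ Q.bxdot ρ ρu * |r - t|)
    (hu' : ∀ r ∈ Icc 0 τ, ∀ t ∈ Icc 0 τ, ‖u r - u t‖ ≤ Q.budot g ρ ρu * |r - t|)
    (hbx : 0 ≤ Q.bxdot ρ ρu) (hbu : 0 ≤ Q.budot g ρ ρu) {t : ℝ}
    (ht : t ∈ Icc 0 τ) (htT : Q.T ≤ t) : ‖Q.residual θ x u t‖ ≤ Q.residualBound g ρ ρu := by
  have hT := hQ.T_pos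
  have hc := Q.S.isCompact
  have hm := hR.θ_mem t
  have hbθ := hQ.bθ_nonneg hR.θ_adm
  have hρu : 0 ≤ ρu := (norm_nonneg _).trans (hu t ht)
  have hσc := continuous_lumped hQ hR
  -- The gain is frozen at the present time so that it can be pulled out of the average.
  set D₀ : Mat n n := Q.B (θ t) * Q.matchedGain (θ t) with hD₀
  set E := Real.exp (-(Q.a * Q.T)) with hE
  have hE1 : E ≤ 1 := by
    rw [hE, Real.exp_le_one_iff, neg_nonpos]
    exact mul_nonneg hQ.a_pos.le hT.le
  have hDc : Continuous fun r => D₀ *ₑ x r := continuous_const.act hR.x_cont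
  have hheld : held Q.a Q.T (fun r => Q.lumped θ x u r - D₀ *ₑ x r) t =
      held Q.a Q.T (Q.lumped θ x u) t - D₀ *ₑ held Q.a Q.T x t := by
    rw [held, wavg_sub (held_lt hT t).le hσc.continuousOn hDc.continuousOn,
      wavg_act D₀ (held_lt hT t).le hR.x_cont.continuousOn]
    rfl
  have hdec : Q.residual θ x u t =
      (held Q.a Q.T (fun r => Q.lumped θ x u r - D₀ *ₑ x r) t -
        (Q.lumped θ x u t - D₀ *ₑ x t)) - (1 - E) • held Q.a Q.T (Q.lumped θ x u) t := by
    rw [hheld, residual, estimate, avgState, if_neg (not_lt.2 htT), if_neg (not_lt.2 htT),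
      ← mul_act, ← hD₀, act_sub, sub_smul, one_smul]
    abel
  have h1 : ‖held Q.a Q.T (Q.lumped θ x u) t‖ ≤ Q.bσ ρ ρu :=
    norm_held_le hQ.a_pos hT hσc htT fun r hr =>
      norm_lumped_le hQ hR hρ hx hu ⟨hr.1, hr.2.trans ht.2⟩
  have h2 : ‖(1 - E) • held Q.a Q.T (Q.lumped θ x u) t‖ ≤ (1 - E) * Q.bσ ρ ρu := by
    rw [norm_smul, Real.norm_of_nonneg (by linarith)]
    exact mul_le_mul_of_nonneg_left h1 (by linarith)
  have hbB := bB_nonneg (Q := Q)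
  have hdΩ := dΩ_nonneg (Q := Q)
  have hbKx := bKx_nonneg (Q := Q)
  have hLB := hQ.LB_pos.le
  have hLK := hQ.LKx_pos.le
  have hLf := (hQ.Lf_pos ρ hρ).le
  have hlf := hQ.lf_pos.le
  have h3 : ‖held Q.a Q.T (fun r => Q.lumped θ x u r - D₀ *ₑ x r) t -
        (Q.lumped θ x u t - D₀ *ₑ x t)‖ ≤
      2 * Q.T * (‖Q.ω - 1‖ * (Q.bB * Q.budot g ρ ρu + Q.LB * Q.bθ * ρu)
        + Q.lfbar ρ + Q.Lf ρ * Q.bxdot ρ ρu) := by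
    refine norm_held_sub_le hQ.a_pos hT (hσc.sub hDc) htT fun r hr hrt => ?_
    have hrτ : r ∈ Icc 0 τ := ⟨hr.1, hr.2.trans ht.2⟩
    have hmr := hR.θ_mem r
    have hθθ := hR.θ_adm.norm_sub_le hQ.rate_bound ht.1 hrτ.1
    set δ := |r - t| with hδ
    have hδ0 : 0 ≤ δ := abs_nonneg _
    have hBB : ‖Q.B (θ r) - Q.B (θ t)‖ ≤ Q.LB * (Q.bθ * δ) :=
      (hQ.B_lip _ hmr _ hm).trans (mul_le_mul_of_nonneg_left hθθ hLB)
    have hKK : ‖Q.Kx (θ r) - Q.Kx (θ t)‖ ≤ Q.LKx * (Q.bθ * δ) :=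
      (hQ.Kx_lip _ hmr _ hm).trans (mul_le_mul_of_nonneg_left hθθ hLK)
    have hBt : ‖Q.B (θ t)‖ ≤ Q.bB := norm_le_maxNorm hc hQ.cont_B hm
    have hKr : ‖Q.Kx (θ r)‖ ≤ Q.bKx := norm_le_maxNorm hc hQ.cont_Kx hmr
    have e1 := norm_act_le_of_le hBB (norm_act_le_of_le (le_refl ‖Q.ω - 1‖) (hu r hrτ))
    have e2 := norm_act_le_of_le hBt (norm_act_le_of_le (le_refl ‖Q.ω - 1‖) (hu' r hrτ t ht))
    have e3 := hQ.f_rate (x r) r t hr.1 ht.1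
    have e4 := (hQ.f_lip ρ hρ t ht.1 (x r) (x t) (hx r hrτ) (hx t ht)).trans
      (mul_le_mul_of_nonneg_left (hx' r hrτ t ht) hLf)
    have e5 := norm_act_le_of_le hBB (norm_act_le_of_le hQ.norm_ω_sub_le
      (norm_act_le_of_le hKr (hx r hrτ)))
    have e6 := norm_act_le_of_le hBt (norm_act_le_of_le hQ.norm_ω_sub_le
      (norm_act_le_of_le hKK (hx r hrτ)))
    -- One factor changes at a time, and the contribution `D₀ (x r - x t)` has dropped out.
    have hsplit : (Q.lumped θ x u r - D₀ *ₑ x r) - (Q.lumped θ x u t - D₀ *ₑ x t) =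
        (Q.B (θ r) - Q.B (θ t)) *ₑ (Q.ω - 1) *ₑ u r +
        Q.B (θ t) *ₑ (Q.ω - 1) *ₑ (u r - u t) +
        (Q.f r (x r) - Q.f t (x r)) + (Q.f t (x r) - Q.f t (x t)) +
        (Q.B (θ r) - Q.B (θ t)) *ₑ (Q.ω - 1) *ₑ Q.Kx (θ r) *ₑ x r +
        Q.B (θ t) *ₑ (Q.ω - 1) *ₑ (Q.Kx (θ r) - Q.Kx (θ t)) *ₑ x r := by
      simp only [lumped, hD₀, matchedGain, max_eq_left hr.1, max_eq_left ht.1, mul_act]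
      generalize Q.ω - 1 = W
      simp only [act_add, act_sub, sub_act]
      abel
    change ‖(Q.lumped θ x u r - D₀ *ₑ x r) - (Q.lumped θ x u t - D₀ *ₑ x t)‖ ≤ _
    rw [hsplit]
    refine (norm_add_le_of_le (norm_add_le_of_le (norm_add_le_of_le (norm_add_le_of_le
      (norm_add_le_of_le e1 e2) e3) e4) e5) e6).trans ?_
    calc _ = δ * (‖Q.ω - 1‖ * (Q.bB * Q.budot g ρ ρu + Q.LB * Q.bθ * ρu)
          + Q.lfbar ρ + Q.Lf ρ * Q.bxdot ρ ρu) := by rw [lfbar]; ring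
      _ ≤ _ := by
        refine mul_le_mul_of_nonneg_right hrt ?_
        rw [lfbar]
        positivity
  rw [hdec, residualBound]
  exact (norm_sub_le _ _).trans (add_le_add h3 h2)

end Bounds

end Regular

end System

namespace System

variable {n m p q s h k : ℕ} {Q : System n m p q s h} {θ : ℝ → Vec s} {x : ℝ → Vec n}
  {u : ℝ → Vec m} {y : ℝ → Vec p} {xhat sig : ℝ → Vec n} {sigM : ℝ → Vec m} {sigU : ℝ → Vec q}
  {eta : ℝ → Vec m}

/-! ### Consequences of the estimation and control laws -/

namespace IsAdaptive

/-- With `ω = I + (ω - I)` the terms `A_m x + B u` of plant and predictor cancel. -/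
theorem isSolution_error (had : Q.IsAdaptive θ x u y xhat sig sigM sigU eta) :
    IsSolution (fun t => xhat t - x t) (Q.xhat₀ - Q.x₀)
      fun t => sig t - Q.a • (xhat t - x t) - Q.lumped θ x u t := by
  refine (had.predictor.sub had.plant).congr (fun _ _ => rfl) fun t ht => ?_
  simp only [lumped, Am, add_act, sub_act, one_act, act_add, act_sub, mul_act, max_eq_left ht]
  abel

/-- `estimate_eq_wavg`, applied to the last complete sampling interval. On `[0, T)`, where `sig` is
determined by the arbitrary initial predictor error, both sides are zero. -/
theorem estimate_eq (hQ : Q.Assumptions) (hR : Q.Regular θ x u)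
    (had : Q.IsAdaptive θ x u y xhat sig sigM sigU eta) {t : ℝ} :
    (if t < Q.T then 0 else sig t) = Q.estimate θ x u t := by
  rw [estimate]
  split_ifs with h
  · rfl
  have htT := not_lt.1 h
  have hT := hQ.T_pos
  obtain ⟨h1, h2, h3⟩ := floor_bounds hT htT
  -- Since `T ≤ t` the floor is at least one, so a complete interval `[jT, (j+1)T]` precedes `t`.
  obtain ⟨j, hj⟩ : ∃ j : ℕ, ⌊t / Q.T⌋₊ = j + 1 := by
    refine Nat.exists_eq_succ_of_ne_zero fun h0 => ?_
    rw [h0] at h1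
    simp only [Nat.cast_zero, zero_sub] at h1
    linarith
  rw [held]
  rw [hj] at h2 h3 ⊢
  push_cast at h2 h3 ⊢
  rw [add_sub_cancel_right]
  have hl : ((j : ℝ) + 1) * Q.T - j * Q.T = Q.T := by ring
  have key := estimate_eq_wavg (α := j * Q.T) (β := (j + 1) * Q.T) hQ.a_pos (by positivity)
    (by linarith) (isSolution_error had) (hR.continuous_lumped hQ).continuousOn
    (fun r hr => by rw [hl]; exact had.adapt j r hr)
  rw [hl] at key
  rw [← key]
  have := had.adapt (j + 1) t
  push_cast at this
  exact this ⟨h2, h3⟩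

theorem sigM_eq (hQ : Q.Assumptions) (hR : Q.Regular θ x u)
    (had : Q.IsAdaptive θ x u y xhat sig sigM sigU eta) {t : ℝ} (ht : 0 ≤ t) :
    sigM t = pinv (Q.B (θ t)) *ₑ Q.estimate θ x u t := by
  ext j
  rw [had.matched t ht j, had.estimate_eq hQ hR, hQ.pinv_Bbar_inl (hR.θ_mem t)]

theorem sigU_eq (hQ : Q.Assumptions) (hR : Q.Regular θ x u)
    (had : Q.IsAdaptive θ x u y xhat sig sigM sigU eta) {t : ℝ} (ht : 0 ≤ t) :
    sigU t = pinv (Q.Bu (θ t)) *ₑ Q.estimate θ x u t := by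
  ext j
  rw [had.unmatched t ht j, had.estimate_eq hQ hR, hQ.pinv_Bbar_inr (hR.θ_mem t)]

variable {τ ρ ρu : ℝ}

theorem norm_state_sub_le (hQ : Q.Assumptions) (hR : Q.Regular θ x u)
    (had : Q.IsAdaptive θ x u y xhat sig sigM sigU eta) (hρ : 0 < ρ)
    (hx : ∀ t ∈ Icc 0 τ, ‖x t‖ ≤ ρ) (hu : ∀ t ∈ Icc 0 τ, ‖u t‖ ≤ ρu) :
    ∀ r ∈ Icc 0 τ, ∀ t ∈ Icc 0 τ, ‖x r - x t‖ ≤ Q.bxdot ρ ρu * |r - t| := by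
  intro r hr t ht
  refine had.plant.norm_sub_le (fun t ht => ?_) ht hr
  have hm := hR.θ_mem t
  have hc := Q.S.isCompact
  have hB := norm_le_maxNorm hc hQ.cont_B hm
  have e1 := norm_act_le_of_le (norm_le_maxNorm hc hQ.cont_Am hm) (hx t ht)
  have e2 := norm_act_le_of_le hB (norm_act_le_of_le hQ.norm_ω_le (hu t ht))
  have e3 := hQ.norm_f_le' hρ ht.1 (hx t ht) le_rfl
  have e4 := norm_act_le_of_le hB (norm_act_le_of_le hQ.norm_ω_sub_le
    (norm_act_le_of_le (norm_le_maxNorm hc hQ.cont_Kx hm) (hx t ht)))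
  have hsplit : Q.A (θ t) *ₑ x t + Q.B (θ t) *ₑ Q.ω *ₑ (Q.Kx (θ t) *ₑ x t + u t) + Q.f t (x t) =
      Q.Am (θ t) *ₑ x t + Q.B (θ t) *ₑ Q.ω *ₑ u t + Q.f t (x t) +
        Q.B (θ t) *ₑ (Q.ω - 1) *ₑ Q.Kx (θ t) *ₑ x t := by
    simp only [Am, add_act, sub_act, one_act, act_add, act_sub, mul_act]
    abel
  rw [hsplit]
  refine (norm_add_le_of_le (norm_add_le_of_le (norm_add_le_of_le e1 e2) e3) e4).trans
    (le_of_eq ?_)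
  simp only [bxdot, bAm, bB, bKx]
  ring

/-- The right-hand side of the control law is at most `budot`: `sigM` and `sigU` are subvectors of
`B̄⁻¹σ̂_c`, and the gain of `H̄` on truncated intervals controls `eta`. -/
theorem norm_input_sub_le (hQ : Q.Assumptions) {g : Gains} (hg : g.Valid Q)
    (hR : Q.Regular θ x u)
    (had : Q.IsAdaptive θ x u y xhat sig sigM sigU eta) (hρ : 0 < ρ)
    (hx : ∀ t ∈ Icc 0 τ, ‖x t‖ ≤ ρ) (hu : ∀ t ∈ Icc 0 τ, ‖u t‖ ≤ ρu) :
    ∀ r ∈ Icc 0 τ, ∀ t ∈ Icc 0 τ, ‖u r - u t‖ ≤ Q.budot g ρ ρu * |r - t| := by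
  intro r hr t ht
  have hbσ : 0 ≤ Q.bσ ρ ρu := (norm_nonneg _).trans (hR.norm_lumped_le hQ hρ hx hu hr)
  have hest : ∀ t ∈ Icc 0 τ, ‖pinv (Q.Bbar (θ t)) *ₑ (if t < Q.T then 0 else sig t)‖ ≤
      Q.bBbarInv * Q.bσc ρ ρu := by
    intro t ht
    rw [had.estimate_eq hQ hR]
    refine norm_act_le_of_le (norm_le_maxNorm Q.S.isCompact hQ.cont_pinv_Bbar (hR.θ_mem t)) ?_
    refine (norm_le_sqrt_mul (hR.norm_estimate_le hQ hbσ
      (fun t ht => hR.norm_lumped_le hQ hρ hx hu ht) ht)).trans (le_of_eq ?_)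
    rw [bσc]; ring
  have hσc : 0 ≤ Q.bBbarInv * Q.bσc ρ ρu := (norm_nonneg _).trans (hest r hr)
  refine had.control.norm_sub_le (fun t ht => ?_) ht hr
  rw [norm_neg]
  have e1 : ‖sigM t‖ ≤ Q.bBbarInv * Q.bσc ρ ρu :=
    (norm_le_of_inl (had.matched t ht.1)).trans (hest t ht)
  have e2 : ‖eta t‖ ≤ g.Hbar * (Q.bBbarInv * Q.bσc ρ ρu) :=
    hg.Hbar.norm_le hR.θ_adm (IsSignal.act (hR.comp hQ.cont_pinv_Bu) (hR.isSignal_estimate hQ))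
      (IOMap.stateSpace_congr had.feedforward (fun t ht => (had.sigU_eq hQ hR ht).symm)
        fun _ _ => rfl) hσc
      (fun t ht => by
        rw [← had.sigU_eq hQ hR ht.1]
        exact (norm_le_of_inr (had.unmatched t ht.1)).trans (hest t ht)) ht
  have e3 := norm_act_le_of_le (norm_le_maxNorm Q.S.isCompact hQ.cont_Kr (hR.θ_mem t))
    (hQ.norm_r_le ht.1)
  refine norm_act_le_of_le le_rfl ?_
  refine (norm_sub_le_of_le (norm_add_le_of_le (norm_add_le_of_le (hu t ht) e1) e2) e3).trans
    (le_of_eq ?_)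
  rw [bKr]; ring

end IsAdaptive

/-! ### The realization of `F(θ)` -/

/-- The gain of `F(θ)` bounds from below the action of `B(θ)`: for constant parameters
`F(θ)B(θ)` is the filter, which has unit DC gain. -/
theorem norm_le_gain_mul {g : Gains} (hQ : Q.Assumptions) (hg : g.Valid Q) {R : FReal n m s k}
    (hR : R.Valid Q) (h0 : (0 : Vec s) ∈ Q.S.Θd) {θ₀ : Vec s} (hθ₀ : θ₀ ∈ Q.S.Θ) (v : Vec m) :
    ‖v‖ ≤ maxNorm Q.S.Θ R.C * beta Q.S.Θ 0 R.μ R.P R.B * ‖Q.B θ₀ *ₑ v‖ := by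
  have hadm := ParamBox.admissible_const h0 hθ₀
  have hsig : IsSignal fun _ : ℝ => Q.B θ₀ *ₑ v := continuous_const.isSignal
  set γ := maxNorm Q.S.Θ R.C * beta Q.S.Θ 0 R.μ R.P R.B * ‖Q.B θ₀ *ₑ v‖ with hγ
  obtain ⟨xF, hxF⟩ := exists_isSolution (A := fun _ : ℝ => R.A θ₀) continuous_const
    (fun _ => le_rfl) (b := fun _ => R.B θ₀ *ₑ Q.B θ₀ *ₑ v)
    fun t _ => continuous_const.intervalIntegrable _ _
  have hstate : IOMap.stateSpace R.A R.B R.C (fun _ => 0) (fun _ => θ₀) (fun _ => Q.B θ₀ *ₑ v)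
      (fun t => R.C θ₀ *ₑ xF t) := ⟨xF, hxF, fun t _ => by rw [zero_act, add_zero]⟩
  have hbound : ∀ t, 0 ≤ t → ‖R.C θ₀ *ₑ xF t‖ ≤ γ := by
    intro t ht
    have h1 := hR.lyapunov.norm_le_beta hR.cont_B hadm (t₀ := 0) (t₁ := t) (e := 0) le_rfl
      (hxF.continuousOn.mono fun r hr => hr.1)
      (v := fun _ => Q.B θ₀ *ₑ v)
      (fun r hr => hxF.hasDerivWithinAt hr.1 (by
        have h1 : ContinuousOn (fun t => R.A θ₀ *ₑ xF t + R.B θ₀ *ₑ Q.B θ₀ *ₑ v) (Ici 0) :=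
          (continuousOn_const.act hxF.continuousOn).add continuousOn_const
        exact (h1 r hr.1).mono fun r' hr' => hr.1.trans (le_of_lt hr')))
      (norm_nonneg _) (fun _ _ => le_rfl) ⟨ht, le_rfl⟩ (Real.exp_pos _).le
    rw [hxF.initial, norm_zero, mul_zero, zero_add] at h1
    refine (norm_act_le_of_le (norm_le_maxNorm Q.S.isCompact hR.cont_C hθ₀) h1).trans (le_of_eq ?_)
    rw [hγ]; ring
  -- Applied to the constant `B v`, `F` acts as the filter on `v`: `B†B = I`, `B_u†B = 0`, and the
  -- gain bound forces `H̄` to send zero to zero.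
  obtain ⟨w, ⟨y₁, y₂, hy₁, ⟨z, hz, hy₂⟩, hw⟩, ξ, hξ, hξy⟩ := hR.realizes _ hadm _ hsig _ hstate
  have hy₂0 : ∀ t, 0 ≤ t → y₂ t = 0 := by
    intro t ht
    have hz0 : ∀ t, 0 ≤ t → z t = 0 := fun t ht => by
      rw [hz t ht, ← mul_act, hQ.pinv_Bu_mul_B hθ₀, zero_act]
    have h1 := hg.Hbar.norm_le (u := fun _ => 0) hadm continuous_const.isSignal
      (IOMap.stateSpace_congr hy₂ (fun t ht => (hz0 t ht).symm) fun _ _ => rfl) (τ := t) le_rfl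
      (fun _ _ => by rw [norm_zero]) ⟨ht, le_rfl⟩
    rw [mul_zero] at h1
    exact norm_le_zero_iff.1 h1
  have hwv : ∀ t, 0 ≤ t → w t = v := fun t ht => by
    rw [hw t ht, hy₁ t ht, hy₂0 t ht, add_zero, ← mul_act, hQ.pinv_B_mul hθ₀, one_act]
  have hξy' : ∀ t, 0 ≤ t → (Q.ω * Q.K) *ₑ ξ t = R.C θ₀ *ₑ xF t := fun t ht => by
    have h1 : R.C θ₀ *ₑ xF t = (Q.ω * Q.K) *ₑ ξ t + (0 : Mat m m) *ₑ w t := hξy t ht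
    rw [h1, zero_act, add_zero]
  have hdet := hQ.filter_dc _ hQ.ω_mem
  have hξb : ∀ t, 0 ≤ t → ‖ξ t‖ ≤ ‖(Q.ω * Q.K)⁻¹‖ * γ := fun t ht => by
    have : ξ t = (Q.ω * Q.K)⁻¹ *ₑ (Q.ω * Q.K) *ₑ ξ t := by
      rw [← mul_act, Matrix.nonsing_inv_mul _ hdet, one_act]
    rw [this, hξy' t ht]
    exact norm_act_le_of_le le_rfl (hbound t ht)
  -- The DC gain in the time domain: integrating `ξ' = -ωKξ + v` gives `t v = ξ(t) + ∫ ωKξ`, where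
  -- `ξ` is bounded and the integrand is at most `γ`. Division by `t` and `t → ∞` leave `‖v‖ ≤ γ`.
  have hmain : ∀ t, 0 < t → ‖v‖ ≤ γ + ‖(Q.ω * Q.K)⁻¹‖ * γ / t := by
    intro t ht
    have h1 : IsSolution (fun t => ξ t - t • v) 0 fun t => -(R.C θ₀ *ₑ xF t) := by
      have h2 : IsSolution (fun t : ℝ => t • v) 0 fun _ => v := fun t ht =>
        ⟨continuous_const.intervalIntegrable _ _, by simp⟩
      have h3 := hξ.sub h2
      rw [sub_zero] at h3
      refine h3.congr (fun _ _ => rfl) fun t ht => ?_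
      rw [neg_act, hξy' t ht, one_act, hwv t ht, add_sub_cancel_right]
    have h2 := h1.norm_sub_le (τ := t) (M := γ)
      (fun r hr => by rw [norm_neg]; exact hbound r hr.1) (a := 0) (b := t) ⟨le_rfl, ht.le⟩
      ⟨ht.le, le_rfl⟩
    rw [h1.initial, sub_zero, sub_zero, abs_of_pos ht] at h2
    have h3 : t * ‖v‖ ≤ ‖ξ t‖ + γ * t := by
      calc t * ‖v‖ = ‖t • v‖ := by rw [norm_smul, Real.norm_of_nonneg ht.le]
        _ = ‖ξ t - (ξ t - t • v)‖ := by rw [sub_sub_cancel]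
        _ ≤ _ := (norm_sub_le _ _).trans (add_le_add le_rfl h2)
    have h4 := hξb t ht.le
    rw [← sub_le_iff_le_add', le_div_iff₀ ht]
    nlinarith
  have hlim : Tendsto (fun t : ℝ => γ + ‖(Q.ω * Q.K)⁻¹‖ * γ / t) atTop (𝓝 (γ + 0)) :=
    tendsto_const_nhds.add (tendsto_const_nhds.div_atTop tendsto_id)
  rw [add_zero] at hlim
  exact ge_of_tendsto hlim (eventually_atTop.2 ⟨1, fun t ht => hmain t (by linarith)⟩)

/-- The response of the realization of `F(θ)` to the residual. -/
theorem norm_realization_le (hQ : Q.Assumptions) {R : FReal n m s k}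
    (hR : R.Valid Q) (hreg : Q.Regular θ x u) {xF : ℝ → Vec k}
    (hxF : IsSolution xF 0 fun t => R.A (θ t) *ₑ xF t + R.B (θ t) *ₑ Q.residual θ x u t)
    {τ ρ ρu b : ℝ} (hρ : 0 < ρ)
    (hx : ∀ t ∈ Icc 0 τ, ‖x t‖ ≤ ρ) (hu : ∀ t ∈ Icc 0 τ, ‖u t‖ ≤ ρu)
    (hb : 0 ≤ b) (hres : ∀ t ∈ Icc 0 τ, Q.T ≤ t → ‖Q.residual θ x u t‖ ≤ b)
    {t : ℝ} (ht : t ∈ Icc 0 τ) :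
    ‖R.C (θ t) *ₑ xF t‖ ≤ maxNorm Q.S.Θ R.C * (√(lamMax Q.S.Θ R.P / lamMin Q.S.Θ R.P) *
        beta Q.S.Θ (Real.exp (-(R.μ * Q.T))) R.μ R.P R.B * Q.bσ ρ ρu
      + beta Q.S.Θ 0 R.μ R.P R.B * b) := by
  refine norm_act_le_of_le (norm_le_maxNorm Q.S.isCompact hR.cont_C (hreg.θ_mem t)) ?_
  have hT := hQ.T_pos
  have hμ := hR.lyapunov.1
  have hadm := hreg.θ_adm
  have hbσ : 0 ≤ Q.bσ ρ ρu := (norm_nonneg _).trans (hreg.norm_lumped_le hQ hρ hx hu ht)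
  have hβT := beta_nonneg hR.lyapunov (Real.exp (-(R.μ * Q.T))) R.B
  have hβ0 := beta_nonneg hR.lyapunov 0 R.B
  rcases Nat.eq_zero_or_pos k with rfl | hk
  · rw [Subsingleton.elim (xF t) 0, norm_zero]; positivity
  have hne : Q.S.Θ.Nonempty := ⟨_, hreg.θ_mem 0⟩
  have hl1 := one_le_sqrt_lam_ratio hR.lyapunov hne hk
  have hder : ∀ r, 0 ≤ r → HasDerivWithinAt xF
      (R.A (θ r) *ₑ xF r + R.B (θ r) *ₑ Q.residual θ x u r) (Ici r) r := by
    intro r hr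
    refine hxF.hasDerivWithinAt hr ?_
    have h1 : ContinuousWithinAt (fun t => R.A (θ t) *ₑ xF t) (Ioi r) r :=
      (((hreg.comp hR.cont_A).continuousOn.act hxF.continuousOn) r hr).mono
        fun r' hr' => hr.trans (le_of_lt hr')
    have h2 : ContinuousWithinAt (fun t => actL (R.B (θ t))) (Ioi r) r :=
      (actL.continuous.comp (hreg.comp hR.cont_B)).continuousWithinAt
    exact h1.add (h2.clm_apply (hreg.continuousWithinAt_residual hQ hr))
  -- Up to time `T` the state starts from zero and the residual is only known to be at most `bσ`;
  -- this is the term with `β(T)` in `γ₀`.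
  have hfirst : ∀ r ∈ Icc 0 τ, r ≤ Q.T →
      ‖xF r‖ ≤ beta Q.S.Θ (Real.exp (-(R.μ * Q.T))) R.μ R.P R.B * Q.bσ ρ ρu := by
    intro r hr hrT
    have h1 := hR.lyapunov.norm_le_beta hR.cont_B hadm (t₀ := 0) (t₁ := r)
      (e := Real.exp (-(R.μ * Q.T))) le_rfl (hxF.continuousOn.mono fun r hr => hr.1)
      (fun r' hr' => hder r' hr'.1) hbσ
      (fun r' hr' => hreg.norm_residual_le_of_lt hQ hρ hx hu
        ⟨hr'.1, hr'.2.le.trans hr.2⟩ (hr'.2.trans_le hrT)) ⟨hr.1, le_rfl⟩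
      (Real.exp_le_exp.2 (by
        rw [sub_zero, neg_le_neg_iff]
        exact mul_le_mul_of_nonneg_left hrT hμ.le))
    rwa [hxF.initial, norm_zero, mul_zero, zero_add] at h1
  rcases le_total t Q.T with htT | htT
  · have h1 := hfirst t ht htT
    have h2 : 0 ≤ beta Q.S.Θ 0 R.μ R.P R.B * b := by positivity
    have h3 : 0 ≤ beta Q.S.Θ (Real.exp (-(R.μ * Q.T))) R.μ R.P R.B * Q.bσ ρ ρu := by positivity
    rw [mul_assoc]
    nlinarith
  -- From `T` on the small bound holds, and the state reached at `T` acts as an initial state; this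
  -- is the source of the factor `√(λ_max/λ_min)` in front of `β(T)`.
  · have h1 := hfirst Q.T ⟨hT.le, htT.trans ht.2⟩ le_rfl
    have h2 := hR.lyapunov.norm_le_beta hR.cont_B hadm (t₀ := Q.T) (t₁ := t) (e := 0) hT.le
      (hxF.continuousOn.mono fun r hr => hT.le.trans hr.1)
      (fun r hr => hder r (hT.le.trans hr.1)) hb
      (fun r hr => hres r ⟨hT.le.trans hr.1, hr.2.le.trans ht.2⟩ hr.1) ⟨htT, le_rfl⟩
      (Real.exp_pos _).le
    refine h2.trans (add_le_add ?_ le_rfl)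
    rw [mul_assoc]
    exact mul_le_mul_of_nonneg_left h1 (Real.sqrt_nonneg _)

end System

/-! ### Projection to a ball -/

/-- The radial projection to the ball of radius `r > 0`. -/
noncomputable def ballProj {n : ℕ} (r : ℝ) (z : Vec n) : Vec n := (r / max r ‖z‖) • z

section BallProj

variable {n : ℕ} {r : ℝ}

theorem continuous_ballProj (hr : 0 < r) : Continuous (ballProj r : Vec n → Vec n) := by
  have h : ∀ z : Vec n, max r ‖z‖ ≠ 0 := fun z => (hr.trans_le (le_max_left _ _)).ne'
  exact (continuous_const.div (continuous_const.max continuous_norm) h).smul continuous_id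

theorem norm_ballProj_le (hr : 0 < r) (z : Vec n) : ‖ballProj r z‖ ≤ r := by
  have h : 0 < max r ‖z‖ := hr.trans_le (le_max_left _ _)
  rw [ballProj, norm_smul, Real.norm_of_nonneg (by positivity), div_mul_eq_mul_div, div_le_iff₀ h]
  exact mul_le_mul_of_nonneg_left (le_max_right _ _) hr.le

/-- Outside the ball the projection shortens a vector by exactly the excess of its norm over `r`. -/
theorem norm_sub_ballProj_le (hr : 0 < r) {d : ℝ} (hd : 0 ≤ d) {z : Vec n} (hz : ‖z‖ ≤ r + d) :
    ‖z - ballProj r z‖ ≤ d := by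
  rcases le_total ‖z‖ r with h | h
  · rw [ballProj, max_eq_left h, div_self hr.ne', one_smul, sub_self, norm_zero]
    exact hd
  · have hz0 : 0 < ‖z‖ := hr.trans_le h
    have h1 : z - ballProj r z = (1 - r / ‖z‖) • z := by
      rw [ballProj, max_eq_right h, sub_smul, one_smul]
    have h2 : 0 ≤ 1 - r / ‖z‖ := by
      rw [sub_nonneg, div_le_one hz0]; exact h
    rw [h1, norm_smul, Real.norm_of_nonneg h2, sub_mul, one_mul, div_mul_cancel₀ _ hz0.ne']
    linarith

end BallProj

namespace System

variable {n m p q s h k : ℕ}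

/-! ### Decomposition of the closed loop -/

section Defs

variable (Q : System n m p q s h) (θ : ℝ → Vec s) (x : ℝ → Vec n) (ρr : ℝ)

/-- The nonlinearity along the projected state. -/
noncomputable def fProj (t : ℝ) : Vec n := Q.f (max t 0) (ballProj ρr (x t))

/-- The remaining part of the nonlinearity. -/
noncomputable def fRem (t : ℝ) : Vec n := Q.f (max t 0) (x t) - Q.fProj x ρr t

/-- The matched uncertainty along the projected state. -/
noncomputable def matchedProj (t : ℝ) : Vec m :=
  pinv (Q.B (θ t)) *ₑ Q.fProj x ρr t + Q.matchedGain (θ t) *ₑ ballProj ρr (Q.avgState x t)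

/-- The remaining part of the matched uncertainty. -/
noncomputable def matchedRem (t : ℝ) : Vec m :=
  pinv (Q.B (θ t)) *ₑ Q.fRem x ρr t +
    Q.matchedGain (θ t) *ₑ (Q.avgState x t - ballProj ρr (Q.avgState x t))

/-- The unmatched uncertainty along the projected state. -/
noncomputable def unmatchedProj (t : ℝ) : Vec q := pinv (Q.Bu (θ t)) *ₑ Q.fProj x ρr t

/-- The remaining part of the unmatched uncertainty. -/
noncomputable def unmatchedRem (t : ℝ) : Vec q := pinv (Q.Bu (θ t)) *ₑ Q.fRem x ρr t

/-- The effect of averaging the state in the matched uncertainty. -/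
noncomputable def averagingError (t : ℝ) : Vec m :=
  Q.matchedGain (θ t) *ₑ (x t - Q.avgState x t)

/-- The ideal input. -/
noncomputable def refInput (t : ℝ) : Vec m := Q.Kr (θ t) *ₑ Q.r t

end Defs

/-- The signals into which the adaptive closed loop is decomposed: filtered uncertainties, the
response `yF` of `F(θ)` to the residual, and the state responses to each of them. -/
structure Decomposition (Q : System n m p q s h) (R : FReal n m s k) (θ : ℝ → Vec s)
    (x : ℝ → Vec n) (u : ℝ → Vec m) (ρr : ℝ) where
  xF : ℝ → Vec k
  isSolution_xF : IsSolution xF 0 fun t => R.A (θ t) *ₑ xF t + R.B (θ t) *ₑ Q.residual θ x u t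
  yF : ℝ → Vec m
  isSignal_yF : IsSignal yF
  yF_eq : ∀ t, 0 ≤ t → yF t = R.C (θ t) *ₑ xF t
  hp : ℝ → Vec m
  isSignal_hp : IsSignal hp
  hp_spec : Q.Hbar θ (Q.unmatchedProj θ x ρr) hp
  hd : ℝ → Vec m
  hd_spec : Q.Hbar θ (Q.unmatchedRem θ x ρr) hd
  cp : ℝ → Vec m
  cp_spec : Q.filter θ (Q.matchedProj θ x ρr) cp
  cd : ℝ → Vec m
  cd_spec : Q.filter θ (Q.matchedRem θ x ρr) cd
  chp : ℝ → Vec m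
  chp_spec : Q.filter θ hp chp
  chd : ℝ → Vec m
  chd_spec : Q.filter θ hd chd
  cr : ℝ → Vec m
  cr_spec : Q.filter θ (Q.refInput θ) cr
  input_eq : ∀ t, 0 ≤ t → Q.ω *ₑ u t = cr t - cp t - cd t - chp t - chd t - yF t
  Xp : ℝ → Vec n
  Xp_spec : IsSolution Xp 0 fun t =>
    Q.Am (θ t) *ₑ Xp t + Q.B (θ t) *ₑ (Q.matchedProj θ x ρr t - cp t)
  Xd : ℝ → Vec n
  Xd_spec : IsSolution Xd 0 fun t =>
    Q.Am (θ t) *ₑ Xd t + Q.B (θ t) *ₑ (Q.matchedRem θ x ρr t - cd t)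
  Yp : ℝ → Vec n
  Yp_spec : IsSolution Yp 0 fun t => Q.Am (θ t) *ₑ Yp t + Q.Bu (θ t) *ₑ Q.unmatchedProj θ x ρr t
  Yd : ℝ → Vec n
  Yd_spec : IsSolution Yd 0 fun t => Q.Am (θ t) *ₑ Yd t + Q.Bu (θ t) *ₑ Q.unmatchedRem θ x ρr t
  Zp : ℝ → Vec n
  Zp_spec : IsSolution Zp 0 fun t => Q.Am (θ t) *ₑ Zp t + Q.B (θ t) *ₑ chp t
  Zd : ℝ → Vec n
  Zd_spec : IsSolution Zd 0 fun t => Q.Am (θ t) *ₑ Zd t + Q.B (θ t) *ₑ chd t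
  XE : ℝ → Vec n
  XE_spec : IsSolution XE 0 fun t =>
    Q.Am (θ t) *ₑ XE t + Q.B (θ t) *ₑ (Q.averagingError θ x t - yF t)
  Xr : ℝ → Vec n
  Xr_spec : IsSolution Xr 0 fun t => Q.Am (θ t) *ₑ Xr t + Q.B (θ t) *ₑ cr t

variable {Q : System n m p q s h} {θ : ℝ → Vec s} {x : ℝ → Vec n}
  {u : ℝ → Vec m} {y : ℝ → Vec p} {xhat sig : ℝ → Vec n} {sigM : ℝ → Vec m} {sigU : ℝ → Vec q}
  {eta : ℝ → Vec m} {ρr : ℝ}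

namespace Regular

theorem isSignal_fProj (hQ : Q.Assumptions) (hreg : Q.Regular θ x u) (hρr : 0 < ρr) :
    IsSignal (Q.fProj x ρr) :=
  (hQ.continuous_f ((continuous_ballProj hρr).comp hreg.x_cont)).isSignal

theorem isSignal_fRem (hQ : Q.Assumptions) (hreg : Q.Regular θ x u) (hρr : 0 < ρr) :
    IsSignal (Q.fRem x ρr) :=
  (hQ.continuous_f hreg.x_cont).isSignal.sub (hreg.isSignal_fProj hQ hρr)

theorem isSignal_ballProj_avgState (hreg : Q.Regular θ x u) (hρr : 0 < ρr) :
    IsSignal fun t => ballProj ρr (Q.avgState x t) :=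
  isSignal_iff.2 ⟨(continuous_ballProj hρr).measurable.comp hreg.measurable_avgState,
    fun _ => ⟨ρr, fun _ _ => norm_ballProj_le hρr _⟩⟩

theorem isSignal_matchedProj (hQ : Q.Assumptions) (hreg : Q.Regular θ x u) (hρr : 0 < ρr) :
    IsSignal (Q.matchedProj θ x ρr) :=
  (IsSignal.act (hreg.comp hQ.cont_pinv_B) (hreg.isSignal_fProj hQ hρr)).add
    (IsSignal.act (hreg.comp (cont_matchedGain hQ)) (hreg.isSignal_ballProj_avgState hρr))

theorem isSignal_matchedRem (hQ : Q.Assumptions) (hreg : Q.Regular θ x u) (hρr : 0 < ρr) :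
    IsSignal (Q.matchedRem θ x ρr) :=
  (IsSignal.act (hreg.comp hQ.cont_pinv_B) (hreg.isSignal_fRem hQ hρr)).add
    (IsSignal.act (hreg.comp (cont_matchedGain hQ))
      ((hreg.isSignal_avgState hQ).sub (hreg.isSignal_ballProj_avgState hρr)))

theorem isSignal_unmatchedProj (hQ : Q.Assumptions) (hreg : Q.Regular θ x u) (hρr : 0 < ρr) :
    IsSignal (Q.unmatchedProj θ x ρr) :=
  IsSignal.act (hreg.comp hQ.cont_pinv_Bu) (hreg.isSignal_fProj hQ hρr)

theorem isSignal_unmatchedRem (hQ : Q.Assumptions) (hreg : Q.Regular θ x u) (hρr : 0 < ρr) :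
    IsSignal (Q.unmatchedRem θ x ρr) :=
  IsSignal.act (hreg.comp hQ.cont_pinv_Bu) (hreg.isSignal_fRem hQ hρr)

theorem isSignal_averagingError (hQ : Q.Assumptions) (hreg : Q.Regular θ x u) :
    IsSignal (Q.averagingError θ x) :=
  IsSignal.act (hreg.comp (cont_matchedGain hQ)) (hreg.x_cont.isSignal.sub
    (hreg.isSignal_avgState hQ))

theorem isSignal_refInput (hQ : Q.Assumptions) (hreg : Q.Regular θ x u) :
    IsSignal (Q.refInput θ) := IsSignal.act (hreg.comp hQ.cont_Kr) hQ.isSignal_r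

theorem exists_response (hQ : Q.Assumptions) (hreg : Q.Regular θ x u) {a : ℕ}
    {B : Vec s → Mat n a} (hB : ContinuousOn B Q.S.Θ) {v : ℝ → Vec a} (hv : IsSignal v) :
    ∃ z : ℝ → Vec n, IsSolution z 0 fun t => Q.Am (θ t) *ₑ z t + B (θ t) *ₑ v t :=
  exists_isSolution (A := fun t => Q.Am (θ t)) (b := fun t => B (θ t) *ₑ v t)
    (hreg.comp hQ.cont_Am) (M := maxNorm Q.S.Θ Q.Am)
    (fun t => norm_le_maxNorm Q.S.isCompact hQ.cont_Am (hreg.θ_mem t))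
    fun _ ht => (IsSignal.act (hreg.comp hB) hv).intervalIntegrable ht

theorem exists_filter (hreg : Q.Regular θ x u) {v : ℝ → Vec m} (hv : IsSignal v) :
    ∃ c, IsSignal c ∧ Q.filter θ v c :=
  IOMap.exists_stateSpace (S := Q.S) (A := fun _ => -(Q.ω * Q.K)) (B := fun _ => 1)
    (C := fun _ => Q.ω * Q.K) (D := fun _ => 0) continuousOn_const continuousOn_const
    continuousOn_const continuousOn_const hreg.θ_cont hreg.θ_mem hv

end Regular

section Filter

variable {v v' c c' : ℝ → Vec m}

theorem filter_congr (h : Q.filter θ v c) (hv : ∀ t, 0 ≤ t → v' t = v t)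
    (hc : ∀ t, 0 ≤ t → c' t = c t) : Q.filter θ v' c' :=
  IOMap.stateSpace_congr (A := fun _ => -(Q.ω * Q.K)) (B := fun _ => 1)
    (C := fun _ => Q.ω * Q.K) (D := fun _ => 0) (θ := θ) h hv hc

theorem filter_add (h : Q.filter θ v c) (h' : Q.filter θ v' c') :
    Q.filter θ (fun t => v t + v' t) (fun t => c t + c' t) :=
  IOMap.stateSpace_add (A := fun _ => -(Q.ω * Q.K)) (B := fun _ => 1)
    (C := fun _ => Q.ω * Q.K) (D := fun _ => 0) (θ := θ) h h'

theorem filter_sub (h : Q.filter θ v c) (h' : Q.filter θ v' c') :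
    Q.filter θ (fun t => v t - v' t) (fun t => c t - c' t) :=
  IOMap.stateSpace_sub (A := fun _ => -(Q.ω * Q.K)) (B := fun _ => 1)
    (C := fun _ => Q.ω * Q.K) (D := fun _ => 0) (θ := θ) h h'

end Filter

/-- The unmatched component of the estimate. -/
theorem pinv_Bu_estimate (hQ : Q.Assumptions) (hreg : Q.Regular θ x u) (t : ℝ) :
    pinv (Q.Bu (θ t)) *ₑ Q.estimate θ x u t = Q.unmatchedProj θ x ρr t +
      Q.unmatchedRem θ x ρr t + pinv (Q.Bu (θ t)) *ₑ Q.residual θ x u t := by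
  have hB : ∀ v, pinv (Q.Bu (θ t)) *ₑ Q.B (θ t) *ₑ v = 0 := fun v => by
    rw [← mul_act, hQ.pinv_Bu_mul_B (hreg.θ_mem t), zero_act]
  simp only [residual, unmatchedProj, unmatchedRem, fRem, lumped, act_sub, act_add, hB]
  abel

/-- The matched component of the estimate. -/
theorem pinv_B_estimate (hQ : Q.Assumptions) (hreg : Q.Regular θ x u) (t : ℝ) :
    pinv (Q.B (θ t)) *ₑ Q.estimate θ x u t = (Q.ω - 1) *ₑ u t + Q.matchedProj θ x ρr t +
      Q.matchedRem θ x ρr t + pinv (Q.B (θ t)) *ₑ Q.residual θ x u t := by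
  have hB : ∀ v, pinv (Q.B (θ t)) *ₑ Q.B (θ t) *ₑ v = v := fun v => by
    rw [← mul_act, hQ.pinv_B_mul (hreg.θ_mem t), one_act]
  simp only [residual, matchedProj, matchedRem, fRem, lumped, matchedGain, mul_act]
  generalize Q.ω - 1 = W
  simp only [act_sub, act_add, hB]
  abel

/-- The plant in terms of the matched and unmatched uncertainties. -/
theorem plant_eq (hQ : Q.Assumptions) (hreg : Q.Regular θ x u) {t : ℝ} (ht : 0 ≤ t) :
    Q.A (θ t) *ₑ x t + Q.B (θ t) *ₑ Q.ω *ₑ (Q.Kx (θ t) *ₑ x t + u t) + Q.f t (x t) =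
      Q.Am (θ t) *ₑ x t + Q.B (θ t) *ₑ (Q.ω *ₑ u t + Q.matchedProj θ x ρr t +
        Q.matchedRem θ x ρr t + Q.averagingError θ x t) +
      Q.Bu (θ t) *ₑ (Q.unmatchedProj θ x ρr t + Q.unmatchedRem θ x ρr t) := by
  have hf : Q.f t (x t) = Q.B (θ t) *ₑ pinv (Q.B (θ t)) *ₑ Q.f t (x t) +
      Q.Bu (θ t) *ₑ pinv (Q.Bu (θ t)) *ₑ Q.f t (x t) := by
    rw [← mul_act, ← mul_act, ← add_act, hQ.B_pinv_add (hreg.θ_mem t), one_act]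
  simp only [unmatchedProj, unmatchedRem, fRem, matchedProj, matchedRem, averagingError,
    matchedGain, Am, max_eq_left ht, act_sub, act_add, add_act, sub_act, one_act, mul_act]
  nth_rewrite 1 [hf]
  abel

/-- The estimated `(ω - I)u` turns the control law into the filter equation for `ωu`. The signals
`hd` and `cr` are defined as what the other ones leave over, and linearity shows that they belong to
the right mappings; uniqueness of outputs is not needed for this. -/
theorem exists_decomposition (hQ : Q.Assumptions) {R : FReal n m s k} (hR : R.Valid Q)
    (hreg : Q.Regular θ x u) (had : Q.IsAdaptive θ x u y xhat sig sigM sigU eta)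
    (hρr : 0 < ρr) : Nonempty (Q.Decomposition R θ x u ρr) := by
  have hres := hreg.isSignal_residual hQ
  obtain ⟨xF, hxF⟩ := exists_isSolution (hreg.comp hR.cont_A) (M := maxNorm Q.S.Θ R.A)
    (fun t => norm_le_maxNorm Q.S.isCompact hR.cont_A (hreg.θ_mem t))
    (b := fun t => R.B (θ t) *ₑ Q.residual θ x u t)
    fun t ht => (IsSignal.act (hreg.comp hR.cont_B) hres).intervalIntegrable ht
  set yF : ℝ → Vec m := clip fun t => R.C (θ t) *ₑ xF t with hyF
  have hyFs : IsSignal yF :=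
    ((hreg.comp hR.cont_C).continuousOn.act hxF.continuousOn).clip.isSignal
  have hyFe : ∀ t, 0 ≤ t → yF t = R.C (θ t) *ₑ xF t := fun t ht => clip_of_nonneg _ ht
  -- `w` is the signal that `F` hands to the filter, and `y₂` is its part through `H̄`, to be
  -- removed from `eta`.
  obtain ⟨w, ⟨y₁, y₂, hy₁, ⟨z, hz, hy₂⟩, hw⟩, hfw⟩ := hR.realizes θ hreg.θ_adm _ hres yF
    ⟨xF, hxF, fun t ht => by rw [hyFe t ht, zero_act, add_zero]⟩
  have hres' : IsSignal fun t => pinv (Q.Bu (θ t)) *ₑ Q.residual θ x u t :=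
    IsSignal.act (hreg.comp hQ.cont_pinv_Bu) hres
  have hest' : IsSignal fun t => pinv (Q.Bu (θ t)) *ₑ Q.estimate θ x u t :=
    IsSignal.act (hreg.comp hQ.cont_pinv_Bu) (hreg.isSignal_estimate hQ)
  have hy₂' : Q.Hbar θ (fun t => pinv (Q.Bu (θ t)) *ₑ Q.residual θ x u t) (clip y₂) :=
    IOMap.stateSpace_congr hy₂ (fun t ht => (hz t ht).symm) fun t ht => clip_of_nonneg _ ht
  have hy₂s : IsSignal (clip y₂) := by
    have := IOMap.isSignal_clip_output hQ.cont_CH hQ.cont_DH hreg.θ_cont hreg.θ_mem hres' hy₂'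
    rwa [clip_clip] at this
  have heta : Q.Hbar θ (fun t => pinv (Q.Bu (θ t)) *ₑ Q.estimate θ x u t) (clip eta) :=
    IOMap.stateSpace_congr had.feedforward (fun t ht => (had.sigU_eq hQ hreg ht).symm)
      fun t ht => clip_of_nonneg _ ht
  have hetas : IsSignal (clip eta) := by
    have := IOMap.isSignal_clip_output hQ.cont_CH hQ.cont_DH hreg.θ_cont hreg.θ_mem hest' heta
    rwa [clip_clip] at this
  obtain ⟨hp, hps, hpH⟩ := IOMap.exists_stateSpace hQ.cont_AH hQ.cont_BH hQ.cont_CH hQ.cont_DH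
    hreg.θ_cont hreg.θ_mem (hreg.isSignal_unmatchedProj hQ hρr)
  have hdH : Q.Hbar θ (Q.unmatchedRem θ x ρr) (fun t => clip eta t - clip y₂ t - hp t) := by
    refine IOMap.stateSpace_congr (IOMap.stateSpace_sub (IOMap.stateSpace_sub heta hy₂') hpH)
      (fun t _ => ?_) fun _ _ => rfl
    rw [pinv_Bu_estimate (ρr := ρr) hQ hreg t]
    abel
  have hds : IsSignal fun t => clip eta t - clip y₂ t - hp t := (hetas.sub hy₂s).sub hps
  set hd : ℝ → Vec m := fun t => clip eta t - clip y₂ t - hp t with hhd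
  obtain ⟨cp, cps, hcp⟩ := hreg.exists_filter (hreg.isSignal_matchedProj hQ hρr)
  obtain ⟨cd, cds, hcd⟩ := hreg.exists_filter (hreg.isSignal_matchedRem hQ hρr)
  obtain ⟨chp, chps, hchp⟩ := hreg.exists_filter hps
  obtain ⟨chd, chds, hchd⟩ := hreg.exists_filter hds
  have hdet := hQ.filter_dc _ hQ.ω_mem
  -- The filter state is `-(ωK)⁻¹ω u`. Since `(ωK)⁻¹ωK = I`, multiplying the control law by this
  -- matrix gives the filter equation.
  have hv : Q.filter θ (fun t => Q.matchedProj θ x ρr t + Q.matchedRem θ x ρr t + hp t + hd t +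
      w t - Q.refInput θ t) (fun t => -(Q.ω *ₑ u t)) := by
    refine ⟨fun t => (-((Q.ω * Q.K)⁻¹ * Q.ω)) *ₑ u t, ?_, fun t _ => ?_⟩
    · have h1 := had.control.map (-((Q.ω * Q.K)⁻¹ * Q.ω))
      rw [act_zero] at h1
      refine h1.congr (fun _ _ => rfl) fun t ht => ?_
      have hinv : ∀ v : Vec m, (Q.ω * Q.K)⁻¹ *ₑ Q.ω *ₑ Q.K *ₑ v = v := fun v => by
        rw [← mul_act Q.ω, ← mul_act, Matrix.nonsing_inv_mul _ hdet, one_act]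
      have hinv' : ∀ v : Vec m, Q.ω *ₑ Q.K *ₑ (Q.ω * Q.K)⁻¹ *ₑ v = v := fun v => by
        rw [← mul_act Q.ω, ← mul_act, Matrix.mul_nonsing_inv _ hdet, one_act]
      beta_reduce
      rw [had.sigM_eq hQ hreg ht, pinv_B_estimate (ρr := ρr) hQ hreg t, hw t ht, hy₁ t ht]
      have heq : eta t = hp t + hd t + y₂ t := by
        rw [hhd]
        simp only [clip_of_nonneg _ ht]
        abel
      rw [heq]
      simp only [neg_act, act_neg, neg_neg, mul_act, hinv, hinv', one_act, sub_act, refInput]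
      abel
    · have hinv' : ∀ v : Vec m, Q.ω *ₑ Q.K *ₑ (Q.ω * Q.K)⁻¹ *ₑ v = v := fun v => by
        rw [← mul_act Q.ω, ← mul_act, Matrix.mul_nonsing_inv _ hdet, one_act]
      simp only [neg_act, act_neg, mul_act, hinv', zero_act, add_zero]
  have hcr : Q.filter θ (Q.refInput θ)
      (fun t => cp t + cd t + chp t + chd t + yF t - -(Q.ω *ₑ u t)) := by
    have h₁ := filter_add (filter_add (filter_add (filter_add hcp hcd) hchp) hchd) hfw
    refine filter_congr (filter_sub h₁ hv) (fun t _ => ?_) fun _ _ => rfl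
    abel
  have hωu : Continuous fun t => Q.ω *ₑ u t :=
    Continuous.act (M := fun _ => Q.ω) continuous_const hreg.u_cont
  have hcrs : IsSignal fun t => cp t + cd t + chp t + chd t + yF t - -(Q.ω *ₑ u t) :=
    ((((cps.add cds).add chps).add chds).add hyFs).sub hωu.isSignal.neg
  obtain ⟨Xp, hXp⟩ := hreg.exists_response hQ hQ.cont_B
    ((hreg.isSignal_matchedProj hQ hρr).sub cps)
  obtain ⟨Xd, hXd⟩ := hreg.exists_response hQ hQ.cont_B
    ((hreg.isSignal_matchedRem hQ hρr).sub cds)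
  obtain ⟨Yp, hYp⟩ := hreg.exists_response hQ hQ.cont_Bu (hreg.isSignal_unmatchedProj hQ hρr)
  obtain ⟨Yd, hYd⟩ := hreg.exists_response hQ hQ.cont_Bu (hreg.isSignal_unmatchedRem hQ hρr)
  obtain ⟨Zp, hZp⟩ := hreg.exists_response hQ hQ.cont_B chps
  obtain ⟨Zd, hZd⟩ := hreg.exists_response hQ hQ.cont_B chds
  obtain ⟨XE, hXE⟩ := hreg.exists_response hQ hQ.cont_B
    ((hreg.isSignal_averagingError hQ).sub hyFs)
  obtain ⟨Xr, hXr⟩ := hreg.exists_response hQ hQ.cont_B hcrs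
  exact ⟨{
    xF := xF, isSolution_xF := hxF, yF := yF, isSignal_yF := hyFs, yF_eq := hyFe
    hp := hp, isSignal_hp := hps, hp_spec := hpH, hd := hd, hd_spec := hdH
    cp := cp, cp_spec := hcp, cd := cd, cd_spec := hcd
    chp := chp, chp_spec := hchp
    chd := chd, chd_spec := hchd
    cr := _, cr_spec := hcr
    input_eq := fun t _ => by abel
    Xp := Xp, Xp_spec := hXp, Xd := Xd, Xd_spec := hXd, Yp := Yp, Yp_spec := hYp
    Yd := Yd, Yd_spec := hYd, Zp := Zp, Zp_spec := hZp, Zd := Zd, Zd_spec := hZd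
    XE := XE, XE_spec := hXE, Xr := Xr, Xr_spec := hXr }⟩

end System

namespace System

variable {n m p q s h k : ℕ} {Q : System n m p q s h} {θ : ℝ → Vec s} {x : ℝ → Vec n}
  {u : ℝ → Vec m} {y : ℝ → Vec p} {xhat sig : ℝ → Vec n} {sigM : ℝ → Vec m} {sigU : ℝ → Vec q}
  {eta : ℝ → Vec m} {ρr γ₁ γbar τ : ℝ}

/-! ### Bounds on the uncertainties -/

section Constants

variable (Q) in
theorem bf1_nonneg (hQ : Q.Assumptions) : 0 ≤ Q.bf1 := mul_nonneg Q.bBdag_nonneg hQ.bf0_nonneg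

variable (Q) in
theorem bf2_nonneg (hQ : Q.Assumptions) : 0 ≤ Q.bf2 := mul_nonneg Q.bBudag_nonneg hQ.bf0_nonneg

theorem Assumptions.Lf1_nonneg (hQ : Q.Assumptions) {δ : ℝ} (hδ : 0 < δ) : 0 ≤ Q.Lf1 δ :=
  add_nonneg (mul_nonneg (hQ.Lf_pos δ hδ).le Q.bBdag_nonneg) (maxNorm_nonneg _ _)

theorem Assumptions.Lf2_nonneg (hQ : Q.Assumptions) {δ : ℝ} (hδ : 0 < δ) : 0 ≤ Q.Lf2 δ :=
  mul_nonneg (hQ.Lf_pos δ hδ).le Q.bBudag_nonneg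

end Constants

namespace Regular

/-- The Lipschitz constant may be taken at any radius `δ ≥ ρ_r`: the stability condition uses `ρ_r +
γ₁`, the performance bounds use `ρ_r`. -/
theorem norm_fProj_le (hQ : Q.Assumptions) (hρr : 0 < ρr) {δ t : ℝ} (hδ : ρr ≤ δ) (ht : 0 ≤ t) :
    ‖Q.fProj x ρr t‖ ≤ Q.Lf δ * ρr + Q.bf0 := by
  rw [fProj, max_eq_left ht]
  exact hQ.norm_f_le' (hρr.trans_le hδ) ht (norm_ballProj_le hρr _) hδ

theorem norm_fRem_le (hQ : Q.Assumptions) (hρr : 0 < ρr) (hγ₁ : 0 < γ₁) {t : ℝ} (ht : 0 ≤ t)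
    (hx : ‖x t‖ ≤ ρr + γ₁) : ‖Q.fRem x ρr t‖ ≤ Q.Lf (ρr + γ₁) * γ₁ := by
  have hρ : 0 < ρr + γ₁ := by positivity
  rw [fRem, fProj, max_eq_left ht]
  refine (hQ.f_lip _ hρ t ht _ _ hx ((norm_ballProj_le hρr _).trans (by linarith))).trans ?_
  exact mul_le_mul_of_nonneg_left (norm_sub_ballProj_le hρr hγ₁.le hx) (hQ.Lf_pos _ hρ).le

theorem norm_matchedProj_le (hQ : Q.Assumptions) (hreg : Q.Regular θ x u) (hρr : 0 < ρr)
    {δ t : ℝ} (hδ : ρr ≤ δ) (ht : 0 ≤ t) :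
    ‖Q.matchedProj θ x ρr t‖ ≤ Q.Lf1 δ * ρr + Q.bf1 := by
  have h1 := norm_act_le_of_le (norm_le_maxNorm Q.S.isCompact hQ.cont_pinv_B (hreg.θ_mem t))
    (norm_fProj_le (x := x) hQ hρr hδ ht)
  have h2 := norm_act_le_of_le (hQ.norm_E_le (hreg.θ_mem t))
    (norm_ballProj_le hρr (Q.avgState x t))
  refine (norm_add_le _ _).trans ((add_le_add h1 h2).trans (le_of_eq ?_))
  rw [Lf1, bf1, bBdag]
  ring

theorem norm_matchedRem_le (hQ : Q.Assumptions) (hreg : Q.Regular θ x u) (hρr : 0 < ρr)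
    (hγ₁ : 0 < γ₁) (hx : ∀ t ∈ Icc 0 τ, ‖x t‖ ≤ ρr + γ₁) {t : ℝ} (ht : t ∈ Icc 0 τ) :
    ‖Q.matchedRem θ x ρr t‖ ≤ Q.Lf1 (ρr + γ₁) * γ₁ := by
  have h1 := norm_act_le_of_le (norm_le_maxNorm Q.S.isCompact hQ.cont_pinv_B (hreg.θ_mem t))
    (norm_fRem_le hQ hρr hγ₁ ht.1 (hx t ht))
  have h2 := norm_act_le_of_le (hQ.norm_E_le (hreg.θ_mem t))
    (norm_sub_ballProj_le hρr hγ₁.le (hreg.norm_avgState_le hQ hx ht))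
  refine (norm_add_le _ _).trans ((add_le_add h1 h2).trans (le_of_eq ?_))
  rw [Lf1, bBdag]
  ring

theorem norm_unmatchedProj_le (hQ : Q.Assumptions) (hreg : Q.Regular θ x u) (hρr : 0 < ρr)
    {δ t : ℝ} (hδ : ρr ≤ δ) (ht : 0 ≤ t) :
    ‖Q.unmatchedProj θ x ρr t‖ ≤ Q.Lf2 δ * ρr + Q.bf2 := by
  refine (norm_act_le_of_le (norm_le_maxNorm Q.S.isCompact hQ.cont_pinv_Bu (hreg.θ_mem t))
    (norm_fProj_le (x := x) hQ hρr hδ ht)).trans (le_of_eq ?_)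
  rw [Lf2, bf2, bBudag]
  ring

theorem norm_unmatchedRem_le (hQ : Q.Assumptions) (hreg : Q.Regular θ x u) (hρr : 0 < ρr)
    (hγ₁ : 0 < γ₁) {t : ℝ} (ht : 0 ≤ t) (hx : ‖x t‖ ≤ ρr + γ₁) :
    ‖Q.unmatchedRem θ x ρr t‖ ≤ Q.Lf2 (ρr + γ₁) * γ₁ := by
  refine (norm_act_le_of_le (norm_le_maxNorm Q.S.isCompact hQ.cont_pinv_Bu (hreg.θ_mem t))
    (norm_fRem_le hQ hρr hγ₁ ht hx)).trans (le_of_eq ?_)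
  rw [Lf2, bBudag]
  ring

theorem norm_refInput_le (hQ : Q.Assumptions) (hreg : Q.Regular θ x u) {t : ℝ} (ht : 0 ≤ t) :
    ‖Q.refInput θ t‖ ≤ Q.bKr * Q.rNorm :=
  norm_act_le_of_le (norm_le_maxNorm Q.S.isCompact hQ.cont_Kr (hreg.θ_mem t)) (hQ.norm_r_le ht)

end Regular

theorem bxdot_nonneg (hQ : Q.Assumptions) {ρ ρu : ℝ} (hρ : 0 < ρ) (hρu : 0 ≤ ρu) :
    0 ≤ Q.bxdot ρ ρu := by
  have := Q.bAm_nonneg; have := Q.bB_nonneg; have := Q.bΩ_nonneg; have := Q.dΩ_nonneg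
  have := Q.bKx_nonneg; have := (hQ.Lf_pos ρ hρ).le; have := hQ.bf0_nonneg
  rw [bxdot]
  positivity

theorem budot_nonneg (hQ : Q.Assumptions) {g : Gains} (hg : g.Valid Q) {ρ ρu : ℝ} (hρ : 0 < ρ)
    (hρu : 0 ≤ ρu) : 0 ≤ Q.budot g ρ ρu := by
  have := Q.bBbarInv_nonneg; have := Q.bKr_nonneg; have := Q.rNorm_nonneg
  have := Q.bB_nonneg; have := Q.dΩ_nonneg; have := hg.Hbar.1
  have := Q.bKx_nonneg; have := (hQ.Lf_pos ρ hρ).le; have := hQ.bf0_nonneg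
  rw [budot, bσc, bσ]
  positivity

theorem residualBound_nonneg (hQ : Q.Assumptions) {g : Gains} (hg : g.Valid Q)
    (hθ : Q.S.Admissible θ) {ρ ρu : ℝ} (hρ : 0 < ρ) (hρu : 0 ≤ ρu) :
    0 ≤ Q.residualBound g ρ ρu := by
  have := Q.bB_nonneg; have := Q.dΩ_nonneg; have := Q.bKx_nonneg; have := hQ.bf0_nonneg
  have := (hQ.Lf_pos ρ hρ).le; have := hQ.LB_pos.le; have := hQ.LKx_pos.le; have := hQ.lf_pos.le
  have := hQ.T_pos.le; have := hQ.bθ_nonneg hθ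
  have := bxdot_nonneg hQ hρ hρu; have := budot_nonneg hQ hg hρ hρu
  have he : 0 ≤ 1 - Real.exp (-(Q.a * Q.T)) :=
    sub_nonneg.2 (Real.exp_le_one_iff.2 (neg_nonpos.2 (mul_pos hQ.a_pos hQ.T_pos).le))
  rw [residualBound, lfbar, bσ]
  positivity

/-! ### Bounds on the components of the closed loop -/

namespace Decomposition

variable {R : FReal n m s k} {g : Gains} {ρ ρu : ℝ}

/-- The responses of `F(θ)` to the residual and the averaging error are together at most `γ₀`. -/
theorem norm_yF_add_averagingError_le (D : Q.Decomposition R θ x u ρr) (hQ : Q.Assumptions)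
    (hg : g.Valid Q) (hR : R.Valid Q) (hreg : Q.Regular θ x u)
    (had : Q.IsAdaptive θ x u y xhat sig sigM sigU eta) (hρ : 0 < ρ) (hρu : 0 ≤ ρu)
    (hx : ∀ t ∈ Icc 0 τ, ‖x t‖ ≤ ρ) (hu : ∀ t ∈ Icc 0 τ, ‖u t‖ ≤ ρu) {t : ℝ}
    (ht : t ∈ Icc 0 τ) : ‖D.yF t‖ + ‖Q.averagingError θ x t‖ ≤ Q.γ₀ g R ρ ρu := by
  have hb := bxdot_nonneg hQ hρ hρu
  have hxl := had.norm_state_sub_le hQ hreg hρ hx hu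
  have hul := had.norm_input_sub_le hQ hg hreg hρ hx hu
  have hres : ∀ t ∈ Icc 0 τ, Q.T ≤ t →
      ‖Q.residual θ x u t‖ ≤ √n * Q.residualBound g ρ ρu := fun t ht hT =>
    norm_le_sqrt_mul (hreg.norm_residual_le hQ hρ hx hu hxl hul hb
      (budot_nonneg hQ hg hρ hρu) ht hT)
  have h1 := norm_realization_le hQ hR hreg D.isSolution_xF hρ hx hu
    (mul_nonneg (Real.sqrt_nonneg _) (residualBound_nonneg hQ hg hreg.θ_adm hρ hρu)) hres ht
  rw [← D.yF_eq t ht.1] at h1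
  have h2 : ‖x t - Q.avgState x t‖ ≤ √n * (2 * Q.T * Q.bxdot ρ ρu) := by
    rw [norm_sub_rev]
    exact norm_le_sqrt_mul (hreg.norm_avgState_sub_le hQ hb hxl ht)
  have hBK : ContinuousOn (fun θ => Q.B θ * Q.Kx θ) Q.S.Θ := hQ.cont_B.mat_mul hQ.cont_Kx
  have h3 := norm_act_le_of_le (norm_le_maxNorm Q.S.isCompact hBK (hreg.θ_mem t)) h2
  rw [mul_act] at h3
  -- `K_x(x - average)` is bounded through `B K_x(x - average)` and the lower bound on the gain of
  -- `F`. Only afterwards is `ω - I` applied, so `‖B K_x‖` and `d_Ω` enter as separate factors.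
  have h4 := norm_le_gain_mul hQ hg hR hreg.θ_adm.zero_mem (hreg.θ_mem t)
    (Q.Kx (θ t) *ₑ (x t - Q.avgState x t))
  have hγF : 0 ≤ maxNorm Q.S.Θ R.C * beta Q.S.Θ 0 R.μ R.P R.B :=
    mul_nonneg (maxNorm_nonneg _ _) (beta_nonneg hR.lyapunov _ _)
  have h5 := norm_act_le_of_le hQ.norm_ω_sub_le (h4.trans (mul_le_mul_of_nonneg_left h3 hγF))
  rw [averagingError, matchedGain, mul_act]
  refine (add_le_add h1 h5).trans (le_of_eq ?_)
  rw [γ₀, bσtilde_eq]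
  ring

end Decomposition

/-! ### Membership in the input-output mappings -/

section Mappings

variable {v c : ℝ → Vec m} {X : ℝ → Vec n}

theorem Hxm_of_isSolution
    (hX : IsSolution X 0 fun t => Q.Am (θ t) *ₑ X t + Q.B (θ t) *ₑ v t) : Q.Hxm θ v X :=
  ⟨X, hX, fun t _ => by rw [one_act, zero_act, add_zero]⟩

theorem Gxm_of_isSolution (hc : Q.filter θ v c)
    (hX : IsSolution X 0 fun t => Q.Am (θ t) *ₑ X t + Q.B (θ t) *ₑ (v t - c t)) : Q.Gxm θ v X :=
  ⟨fun t => v t - c t, ⟨v, c, fun _ _ => (one_act _).symm, hc, fun _ _ => rfl⟩,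
    Hxm_of_isSolution hX⟩

theorem Gxum_of_isSolution {z : ℝ → Vec q} {w : ℝ → Vec m} {Y Z : ℝ → Vec n}
    (hw : Q.Hbar θ z w) (hc : Q.filter θ w c)
    (hY : IsSolution Y 0 fun t => Q.Am (θ t) *ₑ Y t + Q.Bu (θ t) *ₑ z t)
    (hZ : IsSolution Z 0 fun t => Q.Am (θ t) *ₑ Z t + Q.B (θ t) *ₑ c t) :
    Q.Gxum θ z fun t => Y t - Z t :=
  ⟨Y, Z, ⟨Y, hY, fun t _ => by rw [one_act, zero_act, add_zero]⟩,
    ⟨c, ⟨w, hw, hc⟩, Hxm_of_isSolution hZ⟩, fun _ _ => rfl⟩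

theorem invFilter_of_filter (hc : Q.filter θ v c) : Q.invFilter θ v fun t => Q.ω⁻¹ *ₑ c t :=
  ⟨c, hc, fun _ _ => rfl⟩

theorem CIKr_of_filter (hc : Q.filter θ (Q.refInput θ) c) :
    Q.CIKr θ Q.r fun t => c t - Q.refInput θ t :=
  ⟨Q.refInput θ, fun _ _ => rfl, c, Q.refInput θ, hc, fun _ _ => (one_act _).symm,
    fun _ _ => rfl⟩

theorem invFilterIKr_of_filter (hc : Q.filter θ (Q.refInput θ) c) :
    Q.invFilterIKr θ Q.r fun t => Q.ω⁻¹ *ₑ c t - Q.refInput θ t :=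
  ⟨Q.refInput θ, fun _ _ => rfl, _, Q.refInput θ, invFilter_of_filter hc,
    fun _ _ => (one_act _).symm, fun _ _ => rfl⟩

theorem HxmCKr_of_filter (hc : Q.filter θ (Q.refInput θ) c)
    (hX : IsSolution X 0 fun t => Q.Am (θ t) *ₑ X t + Q.B (θ t) *ₑ c t) : Q.HxmCKr θ Q.r X :=
  ⟨c, ⟨Q.refInput θ, fun _ _ => rfl, hc⟩, Hxm_of_isSolution hX⟩

end Mappings

end System

/-! ### Size of the state and input components. -/

namespace System

variable {n m p q s h k : ℕ} {Q : System n m p q s h} {θ : ℝ → Vec s} {x : ℝ → Vec n}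
  {u : ℝ → Vec m} {y : ℝ → Vec p} {xhat sig : ℝ → Vec n} {sigM : ℝ → Vec m} {sigU : ℝ → Vec q}
  {eta : ℝ → Vec m} {ρr γ₁ γbar τ : ℝ} {R : FReal n m s k} {g : Gains}

/-- The DC-gain condition makes `ωK` invertible, and with it the factor `ω`. -/
theorem Assumptions.isUnit_ω (hQ : Q.Assumptions) : IsUnit Q.ω.det := by
  have := hQ.filter_dc _ hQ.ω_mem
  rw [Matrix.det_mul] at this
  exact isUnit_of_mul_isUnit_left this

namespace Decomposition

/-- The part of the state that vanishes with the remainders and the estimation error. -/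
def Xdev (D : Q.Decomposition R θ x u ρr) (t : ℝ) : Vec n := D.Xd t + (D.Yd t - D.Zd t) + D.XE t

/-- The part of the state that is caused by the uncertainties along the projected state. -/
def Xunc (D : Q.Decomposition R θ x u ρr) (t : ℝ) : Vec n := D.Xp t + (D.Yp t - D.Zp t)

theorem isSolution_Xunc_add_Xdev (D : Q.Decomposition R θ x u ρr) :
    IsSolution (fun t => D.Xunc t + D.Xdev t) 0 fun t =>
      Q.Am (θ t) *ₑ (D.Xunc t + D.Xdev t) +
      Q.B (θ t) *ₑ (Q.matchedProj θ x ρr t - D.cp t + (Q.matchedRem θ x ρr t - D.cd t) - D.chp t -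
        D.chd t + (Q.averagingError θ x t - D.yF t)) +
      Q.Bu (θ t) *ₑ (Q.unmatchedProj θ x ρr t + Q.unmatchedRem θ x ρr t) := by
  have h := (D.Xp_spec.add (D.Yp_spec.sub D.Zp_spec)).add
    ((D.Xd_spec.add (D.Yd_spec.sub D.Zd_spec)).add D.XE_spec)
  simp only [sub_zero, add_zero] at h
  refine h.congr (fun _ _ => rfl) fun t _ => ?_
  simp only [Xunc, Xdev, act_add, act_sub]
  abel

/-- When `ωu` is inserted in the plant, all uncertainties are accounted for by the two removed
parts; what is left starts at `x₀` and is driven by the filtered reference alone. -/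
theorem isSolution_sub (D : Q.Decomposition R θ x u ρr) (hQ : Q.Assumptions)
    (hreg : Q.Regular θ x u) (had : Q.IsAdaptive θ x u y xhat sig sigM sigU eta) :
    IsSolution (fun t => x t - (D.Xunc t + D.Xdev t)) Q.x₀ fun t =>
      Q.Am (θ t) *ₑ (x t - (D.Xunc t + D.Xdev t)) + Q.B (θ t) *ₑ D.cr t := by
  have h := had.plant.sub D.isSolution_Xunc_add_Xdev
  rw [sub_zero] at h
  refine h.congr (fun _ _ => rfl) fun t ht => ?_
  rw [plant_eq (ρr := ρr) hQ hreg ht, D.input_eq t ht]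
  simp only [act_add, act_sub]
  abel

/-- The response to the initial state. -/
theorem norm_initial_le (D : Q.Decomposition R θ x u ρr) (hQ : Q.Assumptions)
    (hreg : Q.Regular θ x u) (had : Q.IsAdaptive θ x u y xhat sig sigM sigU eta)
    {P : Vec s → Mat n n} {μ : ℝ} (hP : IsLyapunov Q.S Q.Am P μ) {t : ℝ} (ht : 0 ≤ t) :
    ‖x t - (D.Xunc t + D.Xdev t) - D.Xr t‖ ≤ Q.ρin P := by
  have hs : IsSolution (fun t => x t - (D.Xunc t + D.Xdev t) - D.Xr t) Q.x₀ fun t =>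
      Q.Am (θ t) *ₑ (x t - (D.Xunc t + D.Xdev t) - D.Xr t) := by
    have h := (D.isSolution_sub hQ hreg had).sub D.Xr_spec
    rw [sub_zero] at h
    refine h.congr (fun _ _ => rfl) fun t ht => ?_
    simp only [act_sub]
    abel
  have hc := (hreg.comp hQ.cont_Am).continuousOn.act hs.continuousOn
  have h := hP.norm_le hreg.θ_adm le_rfl (t₁ := t) (w := fun _ => 0)
    (hs.continuousOn.mono fun r hr => hr.1)
    (fun r hr => by
      rw [add_zero]
      exact hs.hasDerivWithinAt hr.1
        ((hc r hr.1).mono fun r' (hr' : r < r') => (hr.1.trans hr'.le : (0 : ℝ) ≤ r')))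
    le_rfl (fun r _ => by rw [act_zero, norm_zero]) ⟨ht, le_rfl⟩
  rw [mul_zero, add_zero, hs.initial] at h
  refine h.trans ?_
  rw [ρin, mul_comm]
  exact mul_le_mul_of_nonneg_right hQ.x₀_bound (Real.sqrt_nonneg _)

variable {ρ ρu : ℝ}

/-- The bound on the deviation part of the state. -/
theorem norm_Xdev_le (D : Q.Decomposition R θ x u ρr) (hQ : Q.Assumptions)
    (hg : g.Valid Q) (hR : R.Valid Q) (hreg : Q.Regular θ x u)
    (had : Q.IsAdaptive θ x u y xhat sig sigM sigU eta) (hρr : 0 < ρr) (hγ₁ : 0 < γ₁)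
    (hρu : 0 ≤ ρu) (hx : ∀ t ∈ Icc 0 τ, ‖x t‖ ≤ ρr + γ₁) (hu : ∀ t ∈ Icc 0 τ, ‖u t‖ ≤ ρu)
    {t : ℝ} (ht : t ∈ Icc 0 τ) :
    ‖D.Xdev t‖ ≤ (g.Gxm * Q.Lf1 (ρr + γ₁) + g.Gxum * Q.Lf2 (ρr + γ₁)) * γ₁ +
      g.Hxm * Q.γ₀ g R (ρr + γ₁) ρu := by
  have hρ : 0 < ρr + γ₁ := by positivity
  have h1 := hg.Gxm.norm_le hreg.θ_adm (hreg.isSignal_matchedRem hQ hρr)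
    (Gxm_of_isSolution D.cd_spec D.Xd_spec) (mul_nonneg (hQ.Lf1_nonneg hρ) hγ₁.le)
    (fun r hr => hreg.norm_matchedRem_le hQ hρr hγ₁ hx hr) ht
  have h2 := hg.Gxum.norm_le hreg.θ_adm (hreg.isSignal_unmatchedRem hQ hρr)
    (Gxum_of_isSolution D.hd_spec D.chd_spec D.Yd_spec D.Zd_spec)
    (mul_nonneg (hQ.Lf2_nonneg hρ) hγ₁.le)
    (fun r hr => hreg.norm_unmatchedRem_le hQ hρr hγ₁ hr.1 (hx r hr)) ht
  have hE := fun r (hr : r ∈ Icc 0 τ) =>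
    D.norm_yF_add_averagingError_le hQ hg hR hreg had hρ hρu hx hu hr
  have h3 := hg.Hxm.norm_le hreg.θ_adm ((hreg.isSignal_averagingError hQ).sub D.isSignal_yF)
    (Hxm_of_isSolution D.XE_spec)
    ((add_nonneg (norm_nonneg _) (norm_nonneg _)).trans (hE t ht))
    (fun r hr => ((norm_sub_le _ _).trans (add_comm _ _).le).trans (hE r hr)) ht
  refine (norm_add_le _ _).trans ((add_le_add ((norm_add_le _ _).trans (add_le_add h1 h2))
    h3).trans (le_of_eq ?_))
  ring

/-- The bound on the state response to the uncertainties along the projected state. -/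
theorem norm_Xunc_le (D : Q.Decomposition R θ x u ρr) (hQ : Q.Assumptions)
    (hg : g.Valid Q) (hreg : Q.Regular θ x u) (hρr : 0 < ρr) {δ : ℝ} (hδ : ρr ≤ δ)
    {t : ℝ} (ht : 0 ≤ t) :
    ‖D.Xunc t‖ ≤ g.Gxm * (Q.Lf1 δ * ρr + Q.bf1) + g.Gxum * (Q.Lf2 δ * ρr + Q.bf2) := by
  have hδ0 := hρr.trans_le hδ
  have h1 := hg.Gxm.norm_le hreg.θ_adm (hreg.isSignal_matchedProj hQ hρr)
    (Gxm_of_isSolution D.cp_spec D.Xp_spec)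
    (add_nonneg (mul_nonneg (hQ.Lf1_nonneg hδ0) hρr.le) (Q.bf1_nonneg hQ))
    (fun r hr => hreg.norm_matchedProj_le hQ hρr hδ hr.1) (τ := t) ⟨ht, le_rfl⟩
  have h2 := hg.Gxum.norm_le hreg.θ_adm (hreg.isSignal_unmatchedProj hQ hρr)
    (Gxum_of_isSolution D.hp_spec D.chp_spec D.Yp_spec D.Zp_spec)
    (add_nonneg (mul_nonneg (hQ.Lf2_nonneg hδ0) hρr.le) (Q.bf2_nonneg hQ))
    (fun r hr => hreg.norm_unmatchedProj_le hQ hρr hδ hr.1) (τ := t) ⟨ht, le_rfl⟩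
  exact (norm_add_le _ _).trans (add_le_add h1 h2)

/-- The output of the uncertainties along the projected state. -/
theorem norm_act_Xunc_le (D : Q.Decomposition R θ x u ρr) (hQ : Q.Assumptions)
    (hg : g.Valid Q) (hreg : Q.Regular θ x u) (hρr : 0 < ρr) {t : ℝ} (ht : 0 ≤ t) :
    ‖Q.C (θ t) *ₑ D.Xunc t‖ ≤
      g.Gm * (Q.Lf1 ρr * ρr + Q.bf1) + g.Gum * (Q.Lf2 ρr * ρr + Q.bf2) := by
  have h1 := hg.Gm.norm_le (y := fun t => Q.C (θ t) *ₑ D.Xp t) hreg.θ_adm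
    (hreg.isSignal_matchedProj hQ hρr)
    ⟨D.Xp, Gxm_of_isSolution D.cp_spec D.Xp_spec, fun _ _ => rfl⟩
    (add_nonneg (mul_nonneg (hQ.Lf1_nonneg hρr) hρr.le) (Q.bf1_nonneg hQ))
    (fun r hr => hreg.norm_matchedProj_le hQ hρr le_rfl hr.1) (τ := t) ⟨ht, le_rfl⟩
  have h2 := hg.Gum.norm_le (y := fun t => Q.C (θ t) *ₑ (D.Yp t - D.Zp t)) hreg.θ_adm
    (hreg.isSignal_unmatchedProj hQ hρr)
    ⟨_, Gxum_of_isSolution D.hp_spec D.chp_spec D.Yp_spec D.Zp_spec, fun _ _ => rfl⟩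
    (add_nonneg (mul_nonneg (hQ.Lf2_nonneg hρr) hρr.le) (Q.bf2_nonneg hQ))
    (fun r hr => hreg.norm_unmatchedProj_le hQ hρr le_rfl hr.1) (τ := t) ⟨ht, le_rfl⟩
  rw [Xunc, act_add]
  exact (norm_add_le _ _).trans (add_le_add h1 h2)

/-- The part of the input that vanishes with the remainders and the estimation error. -/
noncomputable def udev (D : Q.Decomposition R θ x u ρr) (t : ℝ) : Vec m :=
  Q.ω⁻¹ *ₑ D.cd t + Q.ω⁻¹ *ₑ D.chd t + Q.ω⁻¹ *ₑ D.yF t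

theorem input_eq_sub_udev (D : Q.Decomposition R θ x u ρr) (hQ : Q.Assumptions) {t : ℝ}
    (ht : 0 ≤ t) : u t = Q.ω⁻¹ *ₑ (D.cr t - D.cp t - D.chp t) - D.udev t := by
  have h : u t = Q.ω⁻¹ *ₑ Q.ω *ₑ u t := by
    rw [← mul_act, Matrix.nonsing_inv_mul _ hQ.isUnit_ω, one_act]
  rw [h, D.input_eq t ht, udev]
  simp only [act_sub]
  abel

/-- The counterpart of `norm_Xdev_le` for the input. Of the joint bound on `yF` and `averagingError`
only the share of `yF` is used. -/
theorem norm_udev_le (D : Q.Decomposition R θ x u ρr) (hQ : Q.Assumptions)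
    (hg : g.Valid Q) (hR : R.Valid Q) (hreg : Q.Regular θ x u)
    (had : Q.IsAdaptive θ x u y xhat sig sigM sigU eta) (hρr : 0 < ρr) (hγ₁ : 0 < γ₁)
    (hρu : 0 ≤ ρu) (hx : ∀ t ∈ Icc 0 τ, ‖x t‖ ≤ ρr + γ₁) (hu : ∀ t ∈ Icc 0 τ, ‖u t‖ ≤ ρu)
    {t : ℝ} (ht : t ∈ Icc 0 τ) :
    ‖D.udev t‖ ≤ (Q.l1InvFilter * Q.Lf1 (ρr + γ₁) + g.invFilterHbar * Q.Lf2 (ρr + γ₁)) * γ₁ +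
      ‖Q.ω⁻¹‖ * Q.γ₀ g R (ρr + γ₁) ρu := by
  have hρ : 0 < ρr + γ₁ := by positivity
  have h1 := norm_le_l1InvFilter hQ hreg.θ_adm (hreg.isSignal_matchedRem hQ hρr)
    (invFilter_of_filter D.cd_spec) (mul_nonneg (hQ.Lf1_nonneg hρ) hγ₁.le)
    (fun r hr => hreg.norm_matchedRem_le hQ hρr hγ₁ hx hr) ht
  have h2 := hg.invFilterHbar.norm_le hreg.θ_adm (hreg.isSignal_unmatchedRem hQ hρr)
    ⟨D.hd, D.hd_spec, invFilter_of_filter D.chd_spec⟩ (mul_nonneg (hQ.Lf2_nonneg hρ) hγ₁.le)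
    (fun r hr => hreg.norm_unmatchedRem_le hQ hρr hγ₁ hr.1 (hx r hr)) ht
  have hE := D.norm_yF_add_averagingError_le hQ hg hR hreg had hρ hρu hx hu ht
  have h3 := norm_act_le_of_le (le_refl ‖Q.ω⁻¹‖)
    ((le_add_of_nonneg_right (norm_nonneg (Q.averagingError θ x t))).trans hE)
  refine (norm_add_le _ _).trans ((add_le_add ((norm_add_le _ _).trans (add_le_add h1 h2))
    h3).trans (le_of_eq ?_))
  ring

/-- The input of the reference part. -/
theorem norm_refPart_le (D : Q.Decomposition R θ x u ρr) (hQ : Q.Assumptions)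
    (hg : g.Valid Q) (hreg : Q.Regular θ x u) (hρr : 0 < ρr) {t : ℝ} (ht : 0 ≤ t) :
    ‖Q.ω⁻¹ *ₑ (D.cr t - D.cp t - D.chp t)‖ ≤ Q.ρur g ρr := by
  have hf1 := add_nonneg (mul_nonneg (hQ.Lf1_nonneg hρr) hρr.le) (Q.bf1_nonneg hQ)
  have hf2 := add_nonneg (mul_nonneg (hQ.Lf2_nonneg hρr) hρr.le) (Q.bf2_nonneg hQ)
  have hh : ∀ r ∈ Icc 0 t, ‖D.hp r‖ ≤ g.Hbar * (Q.Lf2 ρr * ρr + Q.bf2) := fun r hr =>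
    hg.Hbar.norm_le hreg.θ_adm (hreg.isSignal_unmatchedProj hQ hρr) D.hp_spec hf2
      (fun r hr => hreg.norm_unmatchedProj_le hQ hρr le_rfl hr.1) hr
  have hb := mul_nonneg Q.bKr_nonneg Q.rNorm_nonneg
  have h0 := mul_nonneg hg.Hbar.1.le hf2
  exact norm_le_l1InvFilter hQ hreg.θ_adm
    (((hreg.isSignal_refInput hQ).sub (hreg.isSignal_matchedProj hQ hρr)).sub D.isSignal_hp)
    (invFilter_of_filter (filter_sub (filter_sub D.cr_spec D.cp_spec) D.chp_spec))
    (by linarith)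
    (fun r hr => by
      refine (norm_sub_le _ _).trans (add_le_add ((norm_sub_le _ _).trans ?_) (hh r hr))
      rw [add_assoc]
      exact add_le_add (hreg.norm_refInput_le hQ hr.1)
        (hreg.norm_matchedProj_le hQ hρr le_rfl hr.1)) ⟨ht, le_rfl⟩

/-- The input of the reference part compared with the ideal input. -/
theorem norm_refPart_sub_le (D : Q.Decomposition R θ x u ρr) (hQ : Q.Assumptions)
    (hg : g.Valid Q) (hreg : Q.Regular θ x u) (hρr : 0 < ρr) {t : ℝ} (ht : 0 ≤ t) :
    ‖Q.ω⁻¹ *ₑ (D.cr t - D.cp t - D.chp t) - Q.refInput θ t‖ ≤ Q.α₂ g ρr := by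
  have hf1 := add_nonneg (mul_nonneg (hQ.Lf1_nonneg hρr) hρr.le) (Q.bf1_nonneg hQ)
  have hf2 := add_nonneg (mul_nonneg (hQ.Lf2_nonneg hρr) hρr.le) (Q.bf2_nonneg hQ)
  have h1 := norm_le_l1InvFilter hQ hreg.θ_adm (hreg.isSignal_matchedProj hQ hρr)
    (invFilter_of_filter D.cp_spec) hf1
    (fun r hr => hreg.norm_matchedProj_le hQ hρr le_rfl hr.1) (τ := t) ⟨ht, le_rfl⟩
  have h2 := hg.invFilterHbar.norm_le hreg.θ_adm (hreg.isSignal_unmatchedProj hQ hρr)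
    ⟨D.hp, D.hp_spec, invFilter_of_filter D.chp_spec⟩ hf2
    (fun r hr => hreg.norm_unmatchedProj_le hQ hρr le_rfl hr.1) (τ := t) ⟨ht, le_rfl⟩
  have h3 := hg.invFilterIKr.norm_le hreg.θ_adm hQ.isSignal_r
    (invFilterIKr_of_filter D.cr_spec) Q.rNorm_nonneg
    (fun r hr => hQ.norm_r_le hr.1) (τ := t) ⟨ht, le_rfl⟩
  have heq : Q.ω⁻¹ *ₑ (D.cr t - D.cp t - D.chp t) - Q.refInput θ t =
      Q.ω⁻¹ *ₑ D.cr t - Q.refInput θ t - (Q.ω⁻¹ *ₑ D.cp t + Q.ω⁻¹ *ₑ D.chp t) := by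
    simp only [act_sub]
    abel
  rw [heq, α₂, add_comm (Q.l1InvFilter * _ + _)]
  exact (norm_sub_le _ _).trans (add_le_add h3 ((norm_add_le _ _).trans (add_le_add h1 h2)))

end Decomposition

/-! ### Bootstrap -/

/-- At the first time at which `φ` reaches `c` the bound holds on the whole interval before it, so
the step makes it strict there, a contradiction. -/
theorem le_of_bootstrap {φ : ℝ → ℝ} (hφ : Continuous φ) {c : ℝ} (h0 : φ 0 < c)
    (hstep : ∀ τ, 0 ≤ τ → (∀ t ∈ Icc 0 τ, φ t ≤ c) → φ τ < c) {t : ℝ} (ht : 0 ≤ t) : φ t ≤ c := by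
  by_contra! hlt
  have hiv : ∀ {b : ℝ}, 0 ≤ b → c < φ b → ∃ r ∈ Icc 0 b, φ r = c := fun hb hc =>
    intermediate_value_Icc hb hφ.continuousOn ⟨h0.le, hc.le⟩
  have hcomp : IsCompact (Icc 0 t ∩ φ ⁻¹' {c}) :=
    isCompact_Icc.inter_right (isClosed_singleton.preimage hφ)
  obtain ⟨r, hr, hrc⟩ := hiv ht hlt
  obtain ⟨τ, ⟨hτ, hτc⟩, hmin⟩ := hcomp.exists_isLeast ⟨r, hr, hrc⟩
  refine (hstep τ hτ.1 fun z hz => ?_).ne hτc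
  by_contra! hzc
  obtain ⟨w, hw, hwc⟩ := hiv hz.1 hzc
  have hle := hmin ⟨⟨hw.1, hw.2.trans (hz.2.trans hτ.2)⟩, hwc⟩
  have hzτ : z = τ := le_antisymm hz.2 (hle.trans hw.2)
  rw [hzτ] at hzc
  exact hzc.ne' hτc

end System

namespace System

variable {n m p q s h k : ℕ} {Q : System n m p q s h} {θ : ℝ → Vec s} {x : ℝ → Vec n}
  {u : ℝ → Vec m} {y : ℝ → Vec p} {xhat sig : ℝ → Vec n} {sigM : ℝ → Vec m} {sigU : ℝ → Vec q}
  {eta : ℝ → Vec m} {ρr γ₁ γbar τ : ℝ} {R : FReal n m s k} {g : Gains}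
  {P : Vec s → Mat n n} {μ : ℝ}

/-! ### Consequences of the design conditions -/

theorem ρin_nonneg (hQ : Q.Assumptions) : 0 ≤ Q.ρin P :=
  mul_nonneg hQ.ρ₀_pos.le (Real.sqrt_nonneg _)

/-- The other terms of the stability condition are nonnegative, so `ρ_in < ρ_r`; and `ρ₀ ≤ ρ_in`
because the eigenvalue ratio is at least one when `n > 0`. -/
theorem norm_x₀_lt (hQ : Q.Assumptions) (hg : g.Valid Q) (hP : IsLyapunov Q.S Q.Am P μ)
    (hne : Q.S.Θ.Nonempty) (hρr : 0 < ρr) (hγ₁ : 0 < γ₁)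
    (hstab : Q.StabilityCondition g P ρr γ₁) : ‖Q.x₀‖ < ρr := by
  rcases Nat.eq_zero_or_pos n with rfl | hn
  · rwa [Subsingleton.elim Q.x₀ 0, norm_zero]
  have hρ : 0 < ρr + γ₁ := by positivity
  have h1 := mul_nonneg hg.Gxm.1.le (add_nonneg (mul_nonneg (hQ.Lf1_nonneg hρ) hρr.le)
    (Q.bf1_nonneg hQ))
  have h2 := mul_nonneg hg.Gxum.1.le (add_nonneg (mul_nonneg (hQ.Lf2_nonneg hρ) hρr.le)
    (Q.bf2_nonneg hQ))
  have h3 := mul_nonneg hg.HxmCKr.1.le Q.rNorm_nonneg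
  have h4 : Q.ρ₀ ≤ Q.ρin P := le_mul_of_one_le_right hQ.ρ₀_pos.le (one_le_sqrt_lam_ratio hP hne hn)
  have h5 := hQ.x₀_bound
  rw [StabilityCondition] at hstab
  linarith

/-- Divided by `ρ_r`, the stability condition says that the denominator in `GammaConstraint` is
positive. Clearing it gives the small-gain inequality that keeps the deviation of the state below
`γ₁`. -/
theorem deviation_lt (hQ : Q.Assumptions) (hg : g.Valid Q) (hρr : 0 < ρr)
    (hstab : Q.StabilityCondition g P ρr γ₁) (hγ : Q.GammaConstraint g ρr γ₁ γbar) :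
    (g.Gxm * Q.Lf1 (ρr + γ₁) + g.Gxum * Q.Lf2 (ρr + γ₁)) * γ₁ + g.Hxm * γbar < γ₁ := by
  have h1 := mul_nonneg hg.Gxm.1.le (Q.bf1_nonneg hQ)
  have h2 := mul_nonneg hg.Gxum.1.le (Q.bf2_nonneg hQ)
  have h3 := mul_nonneg hg.HxmCKr.1.le Q.rNorm_nonneg
  have h4 := ρin_nonneg (P := P) hQ
  rw [StabilityCondition] at hstab
  have hd : 0 < 1 - g.Gxm * Q.Lf1 (ρr + γ₁) - g.Gxum * Q.Lf2 (ρr + γ₁) := by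
    refine pos_of_mul_pos_left (b := ρr) ?_ hρr.le
    linarith
  rw [GammaConstraint, div_mul_eq_mul_div, div_lt_iff₀ hd] at hγ
  linarith

theorem ρur_nonneg (hQ : Q.Assumptions) (hg : g.Valid Q) (hρr : 0 < ρr) : 0 ≤ Q.ρur g ρr := by
  have hf1 := add_nonneg (mul_nonneg (hQ.Lf1_nonneg hρr) hρr.le) (Q.bf1_nonneg hQ)
  have hf2 := add_nonneg (mul_nonneg (hQ.Lf2_nonneg hρr) hρr.le) (Q.bf2_nonneg hQ)
  have hb := mul_nonneg Q.bKr_nonneg Q.rNorm_nonneg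
  have h0 := mul_nonneg hg.Hbar.1.le hf2
  exact mul_nonneg l1InvFilter_nonneg (by linarith)

theorem γ₂_nonneg (hQ : Q.Assumptions) (hg : g.Valid Q) (hρr : 0 < ρr) (hγ₁ : 0 < γ₁)
    (hγbar : 0 < γbar) : 0 ≤ Q.γ₂ g ρr γ₁ γbar := by
  have hρ : 0 < ρr + γ₁ := by positivity
  exact add_nonneg (mul_nonneg (add_nonneg (mul_nonneg l1InvFilter_nonneg (hQ.Lf1_nonneg hρ))
    (mul_nonneg hg.invFilterHbar.1.le (hQ.Lf2_nonneg hρ))) hγ₁.le)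
    (mul_nonneg (norm_nonneg _) hγbar.le)

/-! ### Boundedness of the closed loop -/

/-- If the bounds hold on `[0, τ]`, then the state bound is strict. -/
theorem norm_state_lt (D : Q.Decomposition R θ x u ρr) (hQ : Q.Assumptions) (hg : g.Valid Q)
    (hP : IsLyapunov Q.S Q.Am P μ) (hR : R.Valid Q)
    (hρr : 0 < ρr) (hγ₁ : 0 < γ₁) (hγbar : 0 < γbar) (hstab : Q.StabilityCondition g P ρr γ₁)
    (hγ : Q.GammaConstraint g ρr γ₁ γbar) (hT : Q.SamplingConstraint g R ρr γ₁ γbar)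
    (hreg : Q.Regular θ x u) (had : Q.IsAdaptive θ x u y xhat sig sigM sigU eta)
    (hx : ∀ t ∈ Icc 0 τ, ‖x t‖ ≤ ρr + γ₁)
    (hu : ∀ t ∈ Icc 0 τ, ‖u t‖ ≤ Q.ρur g ρr + Q.γ₂ g ρr γ₁ γbar) (hτ : 0 ≤ τ) :
    ‖x τ‖ < ρr + γ₁ := by
  have hτ' : τ ∈ Icc 0 τ := ⟨hτ, le_rfl⟩
  have hρu := add_nonneg (ρur_nonneg hQ hg hρr) (γ₂_nonneg hQ hg hρr hγ₁ hγbar)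
  have h1 := D.norm_initial_le hQ hreg had hP hτ
  have h2 := D.norm_Xunc_le hQ hg hreg hρr (le_add_of_nonneg_right hγ₁.le) hτ
  have h3 := D.norm_Xdev_le hQ hg hR hreg had hρr hγ₁ hρu hx hu hτ'
  have h4 := hg.HxmCKr.norm_le hreg.θ_adm hQ.isSignal_r (HxmCKr_of_filter D.cr_spec D.Xr_spec)
    Q.rNorm_nonneg (fun r hr => hQ.norm_r_le hr.1) hτ'
  have h5 := deviation_lt hQ hg hρr hstab hγ
  have h6 := mul_le_mul_of_nonneg_left hT.le hg.Hxm.1.le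
  have heq : x τ = x τ - (D.Xunc τ + D.Xdev τ) - D.Xr τ + D.Xunc τ + D.Xdev τ + D.Xr τ := by abel
  rw [StabilityCondition] at hstab
  rw [heq]
  refine (norm_add_le _ _).trans_lt ?_
  have h7 := norm_add_le (x τ - (D.Xunc τ + D.Xdev τ) - D.Xr τ + D.Xunc τ) (D.Xdev τ)
  have h8 := norm_add_le (x τ - (D.Xunc τ + D.Xdev τ) - D.Xr τ) (D.Xunc τ)
  linarith

/-- If the bounds hold on `[0, τ]`, then so does the input bound without the slack in `γ₀`. -/
theorem norm_udev_le_γ₂ (D : Q.Decomposition R θ x u ρr) (hQ : Q.Assumptions) (hg : g.Valid Q)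
    (hR : R.Valid Q) (hρr : 0 < ρr) (hγ₁ : 0 < γ₁) (hγbar : 0 < γbar)
    (hreg : Q.Regular θ x u) (had : Q.IsAdaptive θ x u y xhat sig sigM sigU eta)
    (hx : ∀ t ∈ Icc 0 τ, ‖x t‖ ≤ ρr + γ₁)
    (hu : ∀ t ∈ Icc 0 τ, ‖u t‖ ≤ Q.ρur g ρr + Q.γ₂ g ρr γ₁ γbar) (hτ : 0 ≤ τ) :
    ‖D.udev τ‖ ≤ Q.γ₂ g ρr γ₁ γbar -
      ‖Q.ω⁻¹‖ * (γbar - Q.γ₀ g R (ρr + γ₁) (Q.ρur g ρr + Q.γ₂ g ρr γ₁ γbar)) := by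
  have hρu := add_nonneg (ρur_nonneg hQ hg hρr) (γ₂_nonneg hQ hg hρr hγ₁ hγbar)
  refine (D.norm_udev_le hQ hg hR hreg had hρr hγ₁ hρu hx hu ⟨hτ, le_rfl⟩).trans (le_of_eq ?_)
  generalize Q.γ₀ g R (ρr + γ₁) (Q.ρur g ρr + Q.γ₂ g ρr γ₁ γbar) = e
  rw [γ₂]
  ring

theorem Assumptions.norm_inv_ω_pos (hQ : Q.Assumptions) (hm : 0 < m) : 0 < ‖Q.ω⁻¹‖ := by
  have : Nonempty (Fin m) := ⟨⟨0, hm⟩⟩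
  rw [norm_pos_iff]
  intro h0
  have := Matrix.nonsing_inv_mul _ hQ.isUnit_ω
  rw [h0, zero_mul] at this
  exact zero_ne_one this

/-- The adaptive closed loop stays in the balls of radius `ρ` and `ρ_u`. -/
theorem norm_closedLoop_le (D : Q.Decomposition R θ x u ρr) (hQ : Q.Assumptions) (hg : g.Valid Q)
    (hP : IsLyapunov Q.S Q.Am P μ) (hR : R.Valid Q)
    (hρr : 0 < ρr) (hγ₁ : 0 < γ₁) (hγbar : 0 < γbar) (hstab : Q.StabilityCondition g P ρr γ₁)
    (hγ : Q.GammaConstraint g ρr γ₁ γbar) (hT : Q.SamplingConstraint g R ρr γ₁ γbar)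
    (hreg : Q.Regular θ x u) (had : Q.IsAdaptive θ x u y xhat sig sigM sigU eta) :
    (∀ t, 0 ≤ t → ‖x t‖ ≤ ρr + γ₁) ∧
      ∀ t, 0 ≤ t → ‖u t‖ ≤ Q.ρur g ρr + Q.γ₂ g ρr γ₁ γbar := by
  have hρu := add_nonneg (ρur_nonneg hQ hg hρr) (γ₂_nonneg hQ hg hρr hγ₁ hγbar)
  have hx0 : ‖x 0‖ < ρr + γ₁ := by
    rw [had.plant.initial]
    linarith [norm_x₀_lt hQ hg hP ⟨_, hreg.θ_mem 0⟩ hρr hγ₁ hstab]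
  -- For `m = 0` the norm of `ω⁻¹` is zero and the input bound has no slack; but then the input is
  -- trivial and the bootstrap runs on the state alone.
  rcases Nat.eq_zero_or_pos m with rfl | hm
  · have hu : ∀ t, ‖u t‖ ≤ Q.ρur g ρr + Q.γ₂ g ρr γ₁ γbar := fun t => by
      rwa [Subsingleton.elim (u t) 0, norm_zero]
    exact ⟨fun t ht => le_of_bootstrap hreg.x_cont.norm hx0 (fun τ hτ hx =>
      norm_state_lt D hQ hg hP hR hρr hγ₁ hγbar hstab hγ hT hreg had hx (fun t _ => hu t) hτ) ht,
      fun t _ => hu t⟩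
  · have hω := hQ.norm_inv_ω_pos hm
    have hγ₂ : 0 < Q.γ₂ g ρr γ₁ γbar := by
      have hρ : 0 < ρr + γ₁ := by positivity
      exact add_pos_of_nonneg_of_pos (mul_nonneg (add_nonneg
        (mul_nonneg l1InvFilter_nonneg (hQ.Lf1_nonneg hρ))
        (mul_nonneg hg.invFilterHbar.1.le (hQ.Lf2_nonneg hρ))) hγ₁.le) (mul_pos hω hγbar)
    -- State and input are treated together, since the bound on the estimation error presupposes
    -- both.
    have key : ∀ t, 0 ≤ t → max (‖x t‖ - (ρr + γ₁))
        (‖u t‖ - (Q.ρur g ρr + Q.γ₂ g ρr γ₁ γbar)) ≤ 0 := by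
      intro t ht
      refine le_of_bootstrap (φ := fun t => max (‖x t‖ - (ρr + γ₁))
        (‖u t‖ - (Q.ρur g ρr + Q.γ₂ g ρr γ₁ γbar))) ((hreg.x_cont.norm.sub continuous_const).max
          (hreg.u_cont.norm.sub continuous_const)) ?_ ?_ ht
      · refine max_lt (sub_neg.2 hx0) ?_
        rw [had.control.initial, norm_zero]
        linarith [ρur_nonneg hQ hg hρr]
      · intro τ hτ hmax
        have hx : ∀ t ∈ Icc 0 τ, ‖x t‖ ≤ ρr + γ₁ := fun t ht =>
          sub_nonpos.1 ((le_max_left _ _).trans (hmax t ht))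
        have hu : ∀ t ∈ Icc 0 τ, ‖u t‖ ≤ Q.ρur g ρr + Q.γ₂ g ρr γ₁ γbar := fun t ht =>
          sub_nonpos.1 ((le_max_right _ _).trans (hmax t ht))
        refine max_lt (sub_neg.2
          (norm_state_lt D hQ hg hP hR hρr hγ₁ hγbar hstab hγ hT hreg had hx hu hτ)) ?_
        have h1 := norm_udev_le_γ₂ D hQ hg hR hρr hγ₁ hγbar hreg had hx hu hτ
        have h2 := D.norm_refPart_le hQ hg hreg hρr hτ
        have h3 := mul_pos hω (sub_pos.2 hT)
        rw [D.input_eq_sub_udev hQ hτ]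
        linarith [norm_sub_le (Q.ω⁻¹ *ₑ (D.cr τ - D.cp τ - D.chp τ)) (D.udev τ)]
    exact ⟨fun t ht => sub_nonpos.1 ((le_max_left _ _).trans (key t ht)),
      fun t ht => sub_nonpos.1 ((le_max_right _ _).trans (key t ht))⟩

/-- The performance bounds for regular closed-loop signals. -/
theorem Regular.norm_sub_ideal_le (hQ : Q.Assumptions) (hg : g.Valid Q)
    (hP : IsLyapunov Q.S Q.Am P μ) (hR : R.Valid Q)
    (hρr : 0 < ρr) (hγ₁ : 0 < γ₁) (hγbar : 0 < γbar) (hstab : Q.StabilityCondition g P ρr γ₁)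
    (hγ : Q.GammaConstraint g ρr γ₁ γbar) (hT : Q.SamplingConstraint g R ρr γ₁ γbar)
    (hreg : Q.Regular θ x u) (had : Q.IsAdaptive θ x u y xhat sig sigM sigU eta)
    {xid : ℝ → Vec n} {uid : ℝ → Vec m} {yid : ℝ → Vec p} (hid : Q.IsIdeal θ xid uid yid)
    {t : ℝ} (ht : 0 ≤ t) :
    ‖x t - xid t‖ ≤ Q.α₁ g ρr + γ₁ ∧ ‖u t - uid t‖ ≤ Q.α₂ g ρr + Q.γ₂ g ρr γ₁ γbar ∧
      ‖y t - yid t‖ ≤ Q.α₃ g ρr + Q.bC * γ₁ := by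
  obtain ⟨D⟩ := exists_decomposition hQ hR hreg had hρr
  obtain ⟨hx, hu⟩ := norm_closedLoop_le D hQ hg hP hR hρr hγ₁ hγbar hstab hγ hT hreg had
  have hρu := add_nonneg (ρur_nonneg hQ hg hρr) (γ₂_nonneg hQ hg hρr hγ₁ hγbar)
  have ht' : t ∈ Icc 0 t := ⟨ht, le_rfl⟩
  have hdev : ‖D.Xdev t‖ ≤ γ₁ := by
    have h3 := D.norm_Xdev_le hQ hg hR hreg had hρr hγ₁ hρu (fun r hr => hx r hr.1)
      (fun r hr => hu r hr.1) ht'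
    have h5 := deviation_lt hQ hg hρr hstab hγ
    have h6 := mul_le_mul_of_nonneg_left hT.le hg.Hxm.1.le
    linarith
  -- The common initial state cancels against the ideal system, so this difference is exactly the
  -- response to `(𝒞 - I)K_r r`, without a `ρ_in` term.
  have hZ : IsSolution (fun t => x t - (D.Xunc t + D.Xdev t) - xid t) 0 fun t =>
      Q.Am (θ t) *ₑ (x t - (D.Xunc t + D.Xdev t) - xid t) +
        Q.B (θ t) *ₑ (D.cr t - Q.refInput θ t) := by
    have h := (D.isSolution_sub hQ hreg had).sub hid.state
    rw [sub_self] at h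
    refine h.congr (fun _ _ => rfl) fun r hr => ?_
    rw [hid.input r hr, refInput]
    simp only [act_sub]
    abel
  refine ⟨?_, ?_, ?_⟩
  · have h1 := hg.HxmCIKr.norm_le hreg.θ_adm hQ.isSignal_r
      ⟨_, CIKr_of_filter D.cr_spec, Hxm_of_isSolution hZ⟩ Q.rNorm_nonneg
      (fun r hr => hQ.norm_r_le hr.1) ht'
    have h2 := D.norm_Xunc_le hQ hg hreg hρr le_rfl ht
    have heq : x t - xid t =
        D.Xunc t + (x t - (D.Xunc t + D.Xdev t) - xid t) + D.Xdev t := by abel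
    rw [heq]
    exact (norm_add_le _ _).trans (add_le_add ((norm_add_le _ _).trans (add_le_add h2 h1)) hdev)
  · have h1 := norm_udev_le_γ₂ D hQ hg hR hρr hγ₁ hγbar hreg had (fun r hr => hx r hr.1)
      (fun r hr => hu r hr.1) ht
    have h2 := D.norm_refPart_sub_le hQ hg hreg hρr ht
    have h3 := mul_nonneg (norm_nonneg Q.ω⁻¹) (sub_nonneg.2 hT.le)
    have heq : u t - uid t =
        Q.ω⁻¹ *ₑ (D.cr t - D.cp t - D.chp t) - Q.refInput θ t - D.udev t := by
      rw [hid.input t ht, ← refInput]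
      nth_rewrite 1 [D.input_eq_sub_udev hQ ht]
      abel
    rw [heq]
    exact (norm_sub_le _ _).trans (add_le_add h2 (by linarith))
  · have h1 := hg.HmCIKr.norm_le (y := fun t => Q.C (θ t) *ₑ
        (x t - (D.Xunc t + D.Xdev t) - xid t)) hreg.θ_adm hQ.isSignal_r
      ⟨_, CIKr_of_filter D.cr_spec, _, hZ, fun r _ => by rw [zero_act, add_zero]⟩ Q.rNorm_nonneg
      (fun r hr => hQ.norm_r_le hr.1) ht'
    have h2 := D.norm_act_Xunc_le hQ hg hreg hρr ht
    have h3 := norm_act_le_of_le (norm_le_maxNorm Q.S.isCompact hQ.cont_C (hreg.θ_mem t)) hdev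
    have heq : y t - yid t = Q.C (θ t) *ₑ D.Xunc t +
        Q.C (θ t) *ₑ (x t - (D.Xunc t + D.Xdev t) - xid t) + Q.C (θ t) *ₑ D.Xdev t := by
      rw [had.output t ht, hid.output t ht, ← act_sub, ← act_add, ← act_add]
      congr 1
      abel
    rw [heq]
    exact (norm_add_le _ _).trans (add_le_add ((norm_add_le _ _).trans (add_le_add h2 h1)) h3)

/-! ### Reduction to regular signals -/

/-- All conditions concern `t ≥ 0`, so continuing the signals to negative times by their initial
values loses nothing and makes them continuous on the whole axis. -/
theorem _root_.LPV.ParamBox.Admissible.regular_clip (hθ : Q.S.Admissible θ)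
    (had : Q.IsAdaptive θ x u y xhat sig sigM sigU eta) :
    Q.Regular (clip θ) (clip x) (clip u) where
  θ_adm t ht := by
    obtain ⟨h1, v, hv, h2⟩ := hθ t ht
    refine ⟨by rwa [clip_of_nonneg _ ht], v, hv, h2.congr (fun r hr => clip_of_nonneg _ hr)
      (clip_of_nonneg _ ht)⟩
  θ_cont := hθ.continuousOn.clip
  θ_mem t := (hθ _ (le_max_right t 0)).1
  x_cont := had.plant.continuousOn.clip
  u_cont := had.control.continuousOn.clip

theorem IsAdaptive.clip (hQ : Q.Assumptions)
    (had : Q.IsAdaptive θ x u y xhat sig sigM sigU eta) :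
    Q.IsAdaptive (clip θ) (clip x) (clip u) y xhat sig sigM sigU eta := by
  have hc : ∀ {α : Type} (v : ℝ → α) {t : ℝ}, 0 ≤ t → LPV.clip v t = v t :=
    fun v _ ht => clip_of_nonneg v ht
  obtain ⟨z, hz, hzeta⟩ := had.feedforward
  refine ⟨had.plant.congr (fun t ht => hc _ ht) fun t ht => ?_, fun t ht => ?_,
    had.predictor.congr (fun _ _ => rfl) fun t ht => ?_, fun i t ht => ?_, fun t ht j => ?_,
    fun t ht j => ?_, ⟨z, hz.congr (fun _ _ => rfl) fun t ht => ?_, fun t ht => ?_⟩,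
    had.control.congr (fun t ht => hc _ ht) fun t ht => ?_⟩
  · simp only [hc _ ht]
  · rw [hc _ ht, hc _ ht, had.output t ht]
  · simp only [hc _ ht]
  · rw [had.adapt i t ht, hc _ (mul_nonneg i.cast_nonneg hQ.T_pos.le)]
  · rw [hc _ ht, had.matched t ht j]
  · rw [hc _ ht, had.unmatched t ht j]
  · rw [hc _ ht]
  · rw [hc _ ht, hzeta t ht]
  · simp only [hc _ ht]

theorem IsIdeal.clip {xid : ℝ → Vec n} {uid : ℝ → Vec m} {yid : ℝ → Vec p}
    (hid : Q.IsIdeal θ xid uid yid) : Q.IsIdeal (clip θ) xid uid yid where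
  state := hid.state.congr (fun _ _ => rfl) fun t ht => by rw [clip_of_nonneg _ ht]
  input t ht := by rw [clip_of_nonneg _ ht, hid.input t ht]
  output t ht := by rw [clip_of_nonneg _ ht, hid.output t ht]

end System

end LPV

/-! ### The performance bounds in the `L_∞` norm. -/

theorem mainTheorem2 {n m p q s h k : ℕ} (Sys : LPV.System n m p q s h) (hSys : Sys.Assumptions)
    (g : LPV.Gains) (hg : g.Valid Sys)
    (P : LPV.Vec s → LPV.Mat n n) (μP : ℝ) (hP : LPV.IsLyapunov Sys.S Sys.Am P μP)
    (R : LPV.FReal n m s k) (hR : R.Valid Sys)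
    (ρr γ₁ γbar : ℝ) (hρr : 0 < ρr) (hγ₁ : 0 < γ₁) (hγbar : 0 < γbar)
    (hstab : Sys.StabilityCondition g P ρr γ₁)
    (hγ : Sys.GammaConstraint g ρr γ₁ γbar)
    (hT : Sys.SamplingConstraint g R ρr γ₁ γbar)
    (θ : ℝ → LPV.Vec s) (hθ : Sys.S.Admissible θ)
    (x : ℝ → LPV.Vec n) (u : ℝ → LPV.Vec m) (y : ℝ → LPV.Vec p)
    (xhat sig : ℝ → LPV.Vec n) (sigM : ℝ → LPV.Vec m) (sigU : ℝ → LPV.Vec q)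
    (eta : ℝ → LPV.Vec m) (had : Sys.IsAdaptive θ x u y xhat sig sigM sigU eta)
    (xid : ℝ → LPV.Vec n) (uid : ℝ → LPV.Vec m) (yid : ℝ → LPV.Vec p)
    (hid : Sys.IsIdeal θ xid uid yid) :
    LPV.linfNorm (fun t => x t - xid t) ≤ ENNReal.ofReal (Sys.α₁ g ρr + γ₁) ∧
    LPV.linfNorm (fun t => u t - uid t) ≤
      ENNReal.ofReal (Sys.α₂ g ρr + Sys.γ₂ g ρr γ₁ γbar) ∧
    LPV.linfNorm (fun t => y t - yid t) ≤ ENNReal.ofReal (Sys.α₃ g ρr + Sys.bC * γ₁) := by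
  have key := fun t (ht : (0 : ℝ) ≤ t) =>
    (hθ.regular_clip had).norm_sub_ideal_le hSys hg hP hR hρr hγ₁ hγbar hstab hγ hT
      (had.clip hSys) hid.clip ht
  -- At `t = 0` the bounds show that the right-hand sides are nonnegative, as required to pass to
  -- `ENNReal.ofReal`.
  have h0 := key 0 le_rfl
  refine ⟨(LPV.linfNorm_le_iff ((norm_nonneg _).trans h0.1)).2 fun t ht => ?_,
    (LPV.linfNorm_le_iff ((norm_nonneg _).trans h0.2.1)).2 fun t ht => ?_,
    (LPV.linfNorm_le_iff ((norm_nonneg _).trans h0.2.2)).2 fun t ht => (key t ht).2.2⟩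
  · have h := (key t ht).1
    rwa [LPV.clip_of_nonneg _ ht] at h
  · have h := (key t ht).2.1
    rwa [LPV.clip_of_nonneg _ ht] at h
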